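/- Let $n\ge 0$, let $I=[0,1]$, let $D^2\subset\mathbb{R}^2$ be the closed unit disk, $\mathcal{C}=D^2\times I\subset\mathbb{R}^3$, and let $\mathbf{a}=(a_1,\dots,a_n)$ be an $n$-tuple of distinct points of $D^2$. Let $\mathrm{Conf}(\mathcal{C},n)=\{x\in\mathcal{C}^n : x_i\ne x_j \text{ for } i\neq j\}$. Let $\mathrm{map}_{\mathbf a}(I^n,\mathrm{Conf}(\mathcal{C},n))$ be the space, with the compact-open topology, of continuous maps $f=(f_1,\dots,f_n)\colon I^n\to\mathrm{Conf}(\mathcal{C},n)$ such that for every $i$ one has $f_i(t)=(a_i,0)$ whenever $t_i=0$ and $f_i(t)=(a_i,1)$ whenever $t_i=1$, and such that $f(\operatorname{int} I^n)\subset\operatorname{int}\mathrm{Conf}(\mathcal{C},n)$ (interior taken in $(\mathbb{R}^3)^n$). Let $m_1,\dots,m_n$ be natural numbers. For each $i$ fix disjoint closed subintervals $A_{i,0},\dots,A_{i,m_i}$ of positive length in $(0,1)$, in increasing order. Let $\mathcal{P}_\nu[m]$ be the poset of nonempty subsets of $\{0,\dots,m\}$ ordered by inclusion. For $S=(S_1,\dots,S_n)\in\mathcal{P}_\nu[m_1]\times\dots\times\mathcal{P}_\nu[m_n]$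 put $I(S_i)=[0,1]\setminus\bigcup_{j\in S_i}A_{i,j}$, and let $L_S$ be the space of $n$-tuples $\sigma=(\sigma_1,\dots,\sigma_n)$ of smooth (not necessarily immersive) maps $\sigma_i\colon I(S_i)\to\mathcal{C}$ with $\sigma_i(I(S_i))\cap\sigma_j(I(S_j))=\emptyset$ for $i\neq j$ and with prescribed behavior on the boundary, topologized by uniform convergence of all derivatives on compact subsets of the $I(S_i)$. Here the prescribed behavior on the boundary is either (i) $\sigma_i(0)=(a_i,0)$ and $\sigma_i(1)=(a_i,1)$ for all $i$; or (ii) in addition to (i), for all $i$, $\sigma_i(x)\in\operatorname{int}\mathcal{C}$ for all $x\in I(S_i)\cap(0,1)$, and $\sigma_i$ meets $D^2\times\{0\}$ and $D^2\times\{1\}$ orthogonally, i.e. $\sigma_i'(0)$ and $\sigma_i'(1)$ are nonzero vertical vectors. For $S\subset T$ (componentwise) restriction gives a map $L_S\to L_T$. The $(m_1,\dots,m_n)$ stage of the multivariable Taylor tower is $$T_{(m_1,\dots,m_n)}\operatorname{slink}_{\mathbf a}(\sqcup_i I_i,\mathcal{C})=\operatorname{holim}_{S\in\mathcal{P}_\nu[m_1]\times\dots\times\mathcal{P}_\nu[m_n]}L_S,$$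 where for a diagram $F$ of spaces over a finite poset $P$ the homotopy limit $\operatorname{holim}_P F=\mathrm{Nat}(|P\downarrow -|,F)$ is the subspace of $\prod_{c\in P}\mathrm{Map}(|P\downarrow c|,F(c))$ of families compatible with the morphisms of $P$, and $|P\downarrow c|$ is the geometric realization of the nerve of $\{c'\in P: c'\le c\}$. Then, for either of the conventions (i), (ii) and every choice of the intervals $A_{i,j}$, there is a homotopy equivalence $$\mathrm{map}_{\mathbf a}(I^n,\mathrm{Conf}(\mathcal{C},n))\simeq T_{(1,1,\dots,1)}\operatorname{slink}_{\mathbf a}(\sqcup_{i=1}^n I_i,\mathcal{C}).$$ -/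

import Mathlib

open CategoryTheory
open scoped unitInterval ContDiff

noncomputable section

namespace StringLink

/-- Euclidean three-space, written as plane times vertical line. -/
abbrev Space : Type := EuclideanSpace ℝ (Fin 2) × ℝ

/-- The solid cylinder `D² × [0,1]`. -/
def cylinder : Set Space := Metric.closedBall (0 : EuclideanSpace ℝ (Fin 2)) 1 ×ˢ Set.Icc (0 : ℝ) 1

/-- The configuration space of `n` distinct ordered points of `X`, as a subset of `(ℝ³)ⁿ`. -/
def Conf (X : Set Space) (n : ℕ) : Set (Fin n → Space) :=
  {x | (∀ i, x i ∈ X) ∧ ∀ i j, i ≠ j → x i ≠ x j}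

/-- The space of continuous maps from the cube `Iⁿ` to `Conf(cylinder, n)` that are based at `a`
(endpoint condition) and send the interior of the cube to the interior of the configuration space
(support condition), with the compact-open topology. -/
def MapSpace {n : ℕ} (a : Fin n → EuclideanSpace ℝ (Fin 2)) : Type :=
  {f : C(Fin n → I, Conf cylinder n) //
    (∀ i t, t i = 0 → (f t).1 i = (a i, 0)) ∧
    (∀ i t, t i = 1 → (f t).1 i = (a i, 1)) ∧
    ∀ t, (∀ i, 0 < t i ∧ t i < 1) → (f t).1 ∈ interior (Conf cylinder n)}

instance {n : ℕ} (a : Fin n → EuclideanSpace ℝ (Fin 2)) : TopologicalSpace (MapSpace a) :=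
  instTopologicalSpaceSubtype

/-! ### Spaces of link maps -/

/-- A map on a subset of the line, extended by zero, so that derivatives within the subset make
sense. -/
def extendZero {J : Set ℝ} (f : J → Space) : ℝ → Space := Function.extend Subtype.val f 0

/-- What is prescribed of a strand near the boundary of the cylinder: only its values at the
endpoints of the unit interval, or in addition the support condition of string links. -/
inductive BoundaryBehavior
  | endpoints
  | endpointsAndSupport

/-- The support condition for a strand defined on `J ⊆ [0,1]`: all of it except for its endpoints
lies in the interior of the cylinder, and at the endpoints it is orthogonal to the bottom and top
disks, i.e. its velocity there is a nonzero vertical vector. -/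
def SupportCondition (J : Set ℝ) (f : J → Space) : Prop :=
  (∀ x : J, 0 < (x : ℝ) → (x : ℝ) < 1 → f x ∈ interior cylinder) ∧
  ∀ x : J, ((x : ℝ) = 0 ∨ (x : ℝ) = 1) →
    (derivWithin (extendZero f) J x).1 = 0 ∧ (derivWithin (extendZero f) J x).2 ≠ 0

/-- `f` is a smooth link map from `J 1 ⊔ ⋯ ⊔ J n`, where `J i ⊆ [0,1]`, to the cylinder, with the
prescribed behavior on the boundary: strands are smooth, and distinct strands have disjoint
images. -/
structure IsLinkMap (β : BoundaryBehavior) {n : ℕ} (a : Fin n → EuclideanSpace ℝ (Fin 2))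
    (J : Fin n → Set ℝ) (f : ∀ i, J i → Space) : Prop where
  smooth : ∀ i, ContDiffOn ℝ ∞ (extendZero (f i)) (J i)
  mem_cylinder : ∀ i x, f i x ∈ cylinder
  bottom : ∀ i (x : J i), (x : ℝ) = 0 → f i x = (a i, 0)
  top : ∀ i (x : J i), (x : ℝ) = 1 → f i x = (a i, 1)
  disjoint : ∀ i j, i ≠ j → ∀ (x : J i) (y : J j), f i x ≠ f j y
  support : β = BoundaryBehavior.endpointsAndSupport → ∀ i, SupportCondition (J i) (f i)

/-- The set of link maps from `J 1 ⊔ ⋯ ⊔ J n` to the cylinder. -/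
def LinkMapSpace (β : BoundaryBehavior) {n : ℕ} (a : Fin n → EuclideanSpace ℝ (Fin 2))
    (J : Fin n → Set ℝ) : Type :=
  {f : ∀ i, J i → Space // IsLinkMap β a J f}

/-- The `k`-th derivative of the `i`-th strand, as an element of the space of functions with the
topology of uniform convergence on compact sets. -/
def LinkMapSpace.strandDeriv {β : BoundaryBehavior} {n : ℕ}
    {a : Fin n → EuclideanSpace ℝ (Fin 2)} {J : Fin n → Set ℝ} (i : Fin n) (k : ℕ)
    (f : LinkMapSpace β a J) : UniformOnFun (J i) Space {K | IsCompact K} :=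
  UniformOnFun.ofFun {K | IsCompact K}
    (fun x => iteratedDerivWithin k (extendZero (f.1 i)) (J i) x)

/-- The (weak) `C^∞` topology: uniform convergence on compact sets of all derivatives. -/
instance (β : BoundaryBehavior) {n : ℕ} (a : Fin n → EuclideanSpace ℝ (Fin 2))
    (J : Fin n → Set ℝ) : TopologicalSpace (LinkMapSpace β a J) :=
  ⨅ (i : Fin n) (k : ℕ), TopologicalSpace.induced (LinkMapSpace.strandDeriv i k) inferInstance

/-- `J'` is relatively open in `J`, componentwise. -/
def IsOpenSub {n : ℕ} (J J' : Fin n → Set ℝ) : Prop :=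
  ∀ i, ∃ U : Set ℝ, IsOpen U ∧ J' i = J i ∩ U

lemma IsOpenSub.subset {n : ℕ} {J J' : Fin n → Set ℝ} (h : IsOpenSub J J') (i : Fin n) :
    J' i ⊆ J i := by
  obtain ⟨U, -, e⟩ := h i
  exact e ▸ Set.inter_subset_left

lemma IsOpenSub.eventuallyEq {n : ℕ} {J J' : Fin n → Set ℝ} (h : IsOpenSub J J') (i : Fin n)
    (x : J' i) : J' i =ᶠ[nhds (x : ℝ)] J i := by
  obtain ⟨U, hU, e⟩ := h i
  have hx : (x : ℝ) ∈ U := (e ▸ x.2 : (x : ℝ) ∈ J i ∩ U).2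
  filter_upwards [hU.mem_nhds hx] with y hy
  have : (y ∈ J' i) = (y ∈ J i) := by
    rw [e]; exact propext ⟨fun h => h.1, fun h => ⟨h, hy⟩⟩
  exact this

lemma extendZero_apply {J : Set ℝ} (f : J → Space) (x : J) : extendZero f x = f x :=
  Subtype.val_injective.extend_apply f 0 x

lemma extendZero_inclusion {J J' : Set ℝ} (h : J' ⊆ J) (f : J → Space) :
    Set.EqOn (extendZero (f ∘ Set.inclusion h)) (extendZero f) J' := by
  intro x hx
  rw [extendZero_apply _ (⟨x, hx⟩ : J'), extendZero_apply f (⟨x, h hx⟩ : J)]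
  rfl

lemma iteratedDerivWithin_extendZero_inclusion {n : ℕ} {J J' : Fin n → Set ℝ}
    (h : IsOpenSub J J') (i : Fin n) (f : J i → Space) (k : ℕ) (x : J' i) :
    iteratedDerivWithin k (extendZero (f ∘ Set.inclusion (h.subset i))) (J' i) x =
      iteratedDerivWithin k (extendZero f) (J i) x := by
  rw [iteratedDerivWithin_congr (extendZero_inclusion (h.subset i) f) x.2]
  simp only [iteratedDerivWithin]
  rw [iteratedFDerivWithin_congr_set (h.eventuallyEq i x)]

/-- Restriction of link maps to relatively open subsets of their domains. -/
def LinkMapSpace.restrict {β : BoundaryBehavior} {n : ℕ}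
    {a : Fin n → EuclideanSpace ℝ (Fin 2)} {J J' : Fin n → Set ℝ} (h : IsOpenSub J J')
    (f : LinkMapSpace β a J) : LinkMapSpace β a J' :=
  ⟨fun i => f.1 i ∘ Set.inclusion (h.subset i),
    { smooth := fun i => ((f.2.smooth i).mono (h.subset i)).congr
        (extendZero_inclusion (h.subset i) (f.1 i))
      mem_cylinder := fun i x => f.2.mem_cylinder i _
      bottom := fun i x hx => f.2.bottom i _ hx
      top := fun i x hx => f.2.top i _ hx
      disjoint := fun i j hij x y => f.2.disjoint i j hij _ _
      support := fun hβ i => by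
        refine ⟨fun x h0 h1 => (f.2.support hβ i).1 _ h0 h1, fun x hx => ?_⟩
        rw [derivWithin_congr (extendZero_inclusion (h.subset i) (f.1 i))
          (extendZero_inclusion (h.subset i) (f.1 i) x.2),
          derivWithin_congr_set (h.eventuallyEq i x)]
        exact (f.2.support hβ i).2 (Set.inclusion (h.subset i) x) hx }⟩

lemma LinkMapSpace.continuous_restrict {β : BoundaryBehavior} {n : ℕ}
    {a : Fin n → EuclideanSpace ℝ (Fin 2)} {J J' : Fin n → Set ℝ} (h : IsOpenSub J J') :
    Continuous (LinkMapSpace.restrict h : LinkMapSpace β a J → LinkMapSpace β a J') := by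
  refine continuous_iInf_rng.2 fun i => continuous_iInf_rng.2 fun k => continuous_induced_rng.2 ?_
  have h1 : Continuous (LinkMapSpace.strandDeriv (β := β) (a := a) (J := J) i k) :=
    continuous_iff_le_induced.2 ((iInf_le _ i).trans (iInf_le _ k))
  have h2 := (UniformOnFun.precomp_uniformContinuous (β := Space)
    (𝔖 := {K : Set (J i) | IsCompact K}) (𝔗 := {K : Set (J' i) | IsCompact K})
    (f := Set.inclusion (h.subset i))
    (fun K hK => IsCompact.image hK (continuous_inclusion (h.subset i)))).continuous.comp h1
  refine h2.congr fun f => ?_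
  funext x
  exact (iteratedDerivWithin_extendZero_inclusion h i (f.1 i) k x).symm

/-! ### Homotopy limits over finite posets -/

/-- The geometric realization of (the nerve of) a finite poset in barycentric coordinates: convex
combinations of elements of a chain. -/
def realization (P : Type) [PartialOrder P] [Fintype P] : Set (P → ℝ) :=
  {w | (∀ s, 0 ≤ w s) ∧ ∑ s, w s = 1 ∧ IsChain (· ≤ ·) {s | w s ≠ 0}}

/-- The geometric realization of the poset of objects over `c`, as a subset of the geometric
realization of the whole poset. -/
def realizationOver {P : Type} [PartialOrder P] [Fintype P] (c : P) : Set (P → ℝ) :=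
  {w | w ∈ realization P ∧ ∀ s, w s ≠ 0 → s ≤ c}

lemma realizationOver_mono {P : Type} [PartialOrder P] [Fintype P] {c d : P} (h : c ≤ d) :
    realizationOver c ⊆ realizationOver d :=
  fun _ hw => ⟨hw.1, fun s hs => (hw.2 s hs).trans h⟩

/-- The homotopy limit of a diagram of spaces indexed by a finite poset: natural transformations
from `c ↦ |P ↓ c|` to the diagram, as a subspace of the product of the mapping spaces. -/
def Holim {P : Type} [PartialOrder P] [Fintype P] (F : P ⥤ TopCat.{0}) : Type :=
  {φ : ∀ c : P, C(realizationOver c, F.obj c) //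
    ∀ (c d : P) (h : c ≤ d) (w : realizationOver c),
      φ d (Set.inclusion (realizationOver_mono h) w) = F.map (homOfLE h) (φ c w)}

instance {P : Type} [PartialOrder P] [Fintype P] (F : P ⥤ TopCat.{0}) :
    TopologicalSpace (Holim F) :=
  instTopologicalSpaceSubtype

/-! ### The Taylor tower -/

/-- The product over `i` of the posets of nonempty subsets of `{0, …, m i}`. -/
def PunctureIndex {n : ℕ} (m : Fin n → ℕ) : Type :=
  ∀ i, {S : Finset (Fin (m i + 1)) // S.Nonempty}

instance {n : ℕ} (m : Fin n → ℕ) : PartialOrder (PunctureIndex m) :=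
  inferInstanceAs (PartialOrder (∀ i, {S : Finset (Fin (m i + 1)) // S.Nonempty}))

instance {n : ℕ} (m : Fin n → ℕ) : Fintype (PunctureIndex m) :=
  inferInstanceAs (Fintype (∀ i, {S : Finset (Fin (m i + 1)) // S.Nonempty}))

/-- For each `i`, disjoint closed subintervals `[left i j, right i j]`, `j = 0, …, m i`, of the
interior of the `i`-th unit interval, in increasing order. -/
structure Punctures {n : ℕ} (m : Fin n → ℕ) where
  left : ∀ i, Fin (m i + 1) → ℝ
  right : ∀ i, Fin (m i + 1) → ℝ
  left_pos : ∀ i j, 0 < left i j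
  left_lt_right : ∀ i j, left i j < right i j
  right_lt_one : ∀ i j, right i j < 1
  increasing : ∀ i j k, j < k → right i j < left i k

/-- The unit interval with the closed subintervals indexed by `S i` removed. -/
def Punctures.domain {n : ℕ} {m : Fin n → ℕ} (A : Punctures m) (S : PunctureIndex m)
    (i : Fin n) : Set ℝ :=
  Set.Icc 0 1 \ ⋃ j ∈ (S i).1, Set.Icc (A.left i j) (A.right i j)

lemma Punctures.isOpenSub {n : ℕ} {m : Fin n → ℕ} (A : Punctures m) {S T : PunctureIndex m}
    (h : S ≤ T) : IsOpenSub (A.domain S) (A.domain T) := by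
  intro i
  refine ⟨(⋃ j ∈ (T i).1, Set.Icc (A.left i j) (A.right i j))ᶜ, ?_, ?_⟩
  · exact (Set.Finite.isClosed_biUnion (T i).1.finite_toSet
      fun j _ => isClosed_Icc).isOpen_compl
  · have hi : (S i).1 ⊆ (T i).1 := h i
    ext x
    simp only [Punctures.domain, Set.mem_sdiff, Set.mem_inter_iff, Set.mem_compl_iff]
    exact ⟨fun hx => ⟨⟨hx.1, fun hS => hx.2 (Set.biUnion_subset_biUnion_left hi hS)⟩, hx.2⟩,
      fun hx => ⟨hx.1.1, hx.2⟩⟩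

/-- The diagram of spaces of punctured link maps, with restriction maps. -/
def punctureDiagram (β : BoundaryBehavior) {n : ℕ} (a : Fin n → EuclideanSpace ℝ (Fin 2))
    {m : Fin n → ℕ} (A : Punctures m) : PunctureIndex m ⥤ TopCat.{0} where
  obj S := TopCat.of (LinkMapSpace β a (A.domain S))
  map h := TopCat.ofHom
    ⟨LinkMapSpace.restrict (A.isOpenSub (leOfHom h)), LinkMapSpace.continuous_restrict _⟩
  map_id _ := rfl
  map_comp _ _ := rfl

/-- The `(m 1, …, m n)` stage of the multivariable Taylor tower of the space of string link
maps. -/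
def TaylorStage (β : BoundaryBehavior) {n : ℕ} (a : Fin n → EuclideanSpace ℝ (Fin 2))
    {m : Fin n → ℕ} (A : Punctures m) : Type :=
  Holim (punctureDiagram β a A)

instance (β : BoundaryBehavior) {n : ℕ} (a : Fin n → EuclideanSpace ℝ (Fin 2))
    {m : Fin n → ℕ} (A : Punctures m) : TopologicalSpace (TaylorStage β a A) :=
  inferInstanceAs (TopologicalSpace (Holim (punctureDiagram β a A)))

end StringLink

end

/-! The poset of nonempty subsets of `{0, 1}` realizes to an interval, so the indexing poset of the
stage `(1, …, 1)` realizes to the cube, and the part over an object `c` to a closed face. A point of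
the homotopy limit is therefore a family of punctured link maps over the cube (`taylorMap`,
`TaylorStage.eval`). Over `u`, the `i`-th strand lives on a bottom, a middle and a top component;
the middle one merges with the bottom one at `u i = 0` and with the top one at `u i = 1`.
Contracting components to base points leaves nothing free in the bottom and top ones, whose base
points have prescribed values, and leaves one point for each middle component. These points form a
based map from the cube to the configuration space. Evaluation at a moving base point gives
`toBased`; locally constant strands give `fromBased`.

Locally constant strands are not yet link maps: a middle point of one strand may sit at an endpoint
of another, and the velocity at the ends is zero. Both defects are cured by `push`, which shrinks
the cylinder by an amount depending on the strand parameter. The amount is maximal on middle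
components that carry an arbitrary point and smaller wherever the value is a prescribed endpoint.
`push_eq_push` shows that comparing heights then separates the strands. The push is quadratic in the
horizontal direction, so velocities at the ends stay vertical, and its vertical speed supplies the
one lost in the contraction (`PushFamily.isLinkMap_pushed`).

One composite is deformed to the identity of the space of based maps by undoing the push and then
moving, inside faces, along segments of the cube (`unpush`, `unstretch`). For the other, the cube is
stretched, components are contracted halfway without a push, then contracted completely while the
push is turned on, and finally the push is rescaled. Half contracted strands lie over compact sets,
so distinct ones have positive distance, bounded below by a positive function `margin` continuous on
the tower; pushes up to this size preserve disjointness (`contractFamily`).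

The support condition on maps of the cube does not matter for the homotopy type: a push by an amount
vanishing exactly on the boundary of the cube moves everything else into the interior
(`mapSpaceEquiv`). -/

noncomputable section

namespace StringLink

/-! ### Families of smooth functions depending continuously on a parameter -/

section Families

variable {Z Z' E E' : Type*} [TopologicalSpace Z] [TopologicalSpace Z']
  [NormedAddCommGroup E] [NormedSpace ℝ E] [NormedAddCommGroup E'] [NormedSpace ℝ E']
  {J J' : Set ℝ} {Ω Ω' : Set Z} {k : ℕ} {F G : Z → ℝ → E}

/-- A family of functions of a real variable in `J`, parametrized by `Ω`, that is `k` times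
differentiable in that variable with jointly continuous derivatives. -/
def CkFamily (J : Set ℝ) (Ω : Set Z) : ℕ → (Z → ℝ → E) → Prop
  | 0, F => ContinuousOn (fun x : Z × ℝ => F x.1 x.2) (Ω ×ˢ J)
  | k + 1, F => ContinuousOn (fun x : Z × ℝ => F x.1 x.2) (Ω ×ˢ J) ∧ ∃ F' : Z → ℝ → E,
      (∀ z ∈ Ω, ∀ s ∈ J, HasDerivWithinAt (F z) (F' z s) J s) ∧ CkFamily J Ω k F'

lemma CkFamily.continuousOn (h : CkFamily J Ω k F) :
    ContinuousOn (fun x : Z × ℝ => F x.1 x.2) (Ω ×ˢ J) := by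
  cases k with
  | zero => exact h
  | succ k => exact h.1

lemma CkFamily.of_succ (h : CkFamily J Ω (k + 1) F) : CkFamily J Ω k F := by
  induction k generalizing F with
  | zero => exact h.1
  | succ k ih =>
    obtain ⟨h0, F', h1, h2⟩ := h
    exact ⟨h0, F', h1, ih h2⟩

lemma CkFamily.congr (h : CkFamily J Ω k F) (e : ∀ z ∈ Ω, ∀ s ∈ J, G z s = F z s) :
    CkFamily J Ω k G := by
  have hc : ContinuousOn (fun x : Z × ℝ => G x.1 x.2) (Ω ×ˢ J) :=
    h.continuousOn.congr fun x hx => e x.1 hx.1 x.2 hx.2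
  cases k with
  | zero => exact hc
  | succ k =>
    obtain ⟨-, F', h1, h2⟩ := h
    exact ⟨hc, F', fun z hz s hs => (h1 z hz s hs).congr (e z hz) (e z hz s hs), h2⟩

lemma CkFamily.mono (h : CkFamily J Ω k F) (hΩ : Ω' ⊆ Ω) : CkFamily J Ω' k F := by
  induction k generalizing F with
  | zero => exact ContinuousOn.mono h (Set.prod_mono_left hΩ)
  | succ k ih =>
    obtain ⟨h0, F', h1, h2⟩ := h
    exact ⟨h0.mono (Set.prod_mono_left hΩ), F', fun z hz => h1 z (hΩ hz), ih h2⟩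

lemma CkFamily.add (hF : CkFamily J Ω k F) (hG : CkFamily J Ω k G) :
    CkFamily J Ω k (fun z s => F z s + G z s) := by
  induction k generalizing F G with
  | zero => exact ContinuousOn.add hF hG
  | succ k ih =>
    obtain ⟨h0, F', h1, h2⟩ := hF
    obtain ⟨g0, G', g1, g2⟩ := hG
    exact ⟨h0.add g0, fun z s => F' z s + G' z s,
      fun z hz s hs => (h1 z hz s hs).add (g1 z hz s hs), ih h2 g2⟩

lemma CkFamily.smul {f : Z → ℝ → ℝ} (hf : CkFamily J Ω k f) (hG : CkFamily J Ω k G) :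
    CkFamily J Ω k (fun z s => f z s • G z s) := by
  induction k generalizing f G with
  | zero => exact ContinuousOn.smul hf hG
  | succ k ih =>
    have hf' := hf.of_succ
    have hG' := hG.of_succ
    obtain ⟨h0, F', h1, h2⟩ := hf
    obtain ⟨g0, G', g1, g2⟩ := hG
    exact ⟨h0.smul g0, fun z s => f z s • G' z s + F' z s • G z s,
      fun z hz s hs => (h1 z hz s hs).smul (g1 z hz s hs), (ih hf' g2).add (ih h2 hG')⟩

lemma CkFamily.prodMk {G : Z → ℝ → E'} (hF : CkFamily J Ω k F) (hG : CkFamily J Ω k G) :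
    CkFamily J Ω k (fun z s => (F z s, G z s)) := by
  induction k generalizing F G with
  | zero => exact ContinuousOn.prodMk hF hG
  | succ k ih =>
    obtain ⟨h0, F', h1, h2⟩ := hF
    obtain ⟨g0, G', g1, g2⟩ := hG
    exact ⟨h0.prodMk g0, fun z s => (F' z s, G' z s),
      fun z hz s hs => (h1 z hz s hs).prodMk (g1 z hz s hs), ih h2 g2⟩

lemma CkFamily.clm (hF : CkFamily J Ω k F) (L : E →L[ℝ] E') :
    CkFamily J Ω k (fun z s => L (F z s)) := by
  induction k generalizing F with
  | zero => exact L.continuous.comp_continuousOn hF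
  | succ k ih =>
    obtain ⟨h0, F', h1, h2⟩ := hF
    exact ⟨L.continuous.comp_continuousOn h0, fun z s => L (F' z s),
      fun z hz s hs => L.hasFDerivAt.comp_hasDerivWithinAt s (h1 z hz s hs), ih h2⟩

lemma CkFamily.zero : CkFamily J Ω k (fun (_ : Z) (_ : ℝ) => (0 : E)) := by
  induction k with
  | zero => exact continuousOn_const
  | succ k ih => exact ⟨continuousOn_const, _, fun z _ s _ => hasDerivWithinAt_const s J 0, ih⟩

/-- Once the first derivative vanishes, so do all others, and joint continuity is all that remains.
This is how locally constant strands become smooth families. -/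
lemma CkFamily.of_hasDerivWithinAt_zero
    (hc : ContinuousOn (fun x : Z × ℝ => F x.1 x.2) (Ω ×ˢ J))
    (hd : ∀ z ∈ Ω, ∀ s ∈ J, HasDerivWithinAt (F z) 0 J s) : CkFamily J Ω k F := by
  cases k with
  | zero => exact hc
  | succ k => exact ⟨hc, _, hd, CkFamily.zero⟩

/-- By the chain rule the derivative is a product of a family of order `k` with a composite of
families of order `k`, so the induction closes. -/
lemma CkFamily.comp {Ψ : Set Z'} {g : Z → Z'} {ρ : Z → ℝ → ℝ} {F : Z' → ℝ → E}
    (hF : CkFamily J' Ψ k F) (hg : ContinuousOn g Ω) (hgm : Set.MapsTo g Ω Ψ)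
    (hρ : CkFamily J Ω k ρ) (hρm : ∀ z ∈ Ω, ∀ s ∈ J, ρ z s ∈ J') :
    CkFamily J Ω k (fun z s => F (g z) (ρ z s)) := by
  have hc : ContinuousOn (fun x : Z × ℝ => F (g x.1) (ρ x.1 x.2)) (Ω ×ˢ J) := by
    have h1 : ContinuousOn (fun x : Z × ℝ => (g x.1, ρ x.1 x.2)) (Ω ×ˢ J) :=
      (hg.comp continuousOn_fst fun x hx => hx.1).prodMk hρ.continuousOn
    exact hF.continuousOn.comp h1 fun x hx => ⟨hgm hx.1, hρm _ hx.1 _ hx.2⟩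
  induction k generalizing F with
  | zero => exact hc
  | succ k ih =>
    have hρ' := hρ.of_succ
    obtain ⟨-, F', h1, h2⟩ := hF
    obtain ⟨-, ρ', r1, r2⟩ := hρ
    refine ⟨hc, fun z s => ρ' z s • F' (g z) (ρ z s), fun z hz s hs => ?_,
      r2.smul (ih h2 hρ' ?_)⟩
    · exact (h1 _ (hgm hz) _ (hρm z hz s hs)).scomp s (r1 z hz s hs) (hρm z hz)
    · have h1 : ContinuousOn (fun x : Z × ℝ => (g x.1, ρ x.1 x.2)) (Ω ×ˢ J) :=
        (hg.comp continuousOn_fst fun x hx => hx.1).prodMk hρ'.continuousOn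
      exact h2.continuousOn.comp h1 fun x hx => ⟨hgm hx.1, hρm _ hx.1 _ hx.2⟩

/-- A family of smooth functions all of whose derivatives are jointly continuous. -/
def SmoothFamily (J : Set ℝ) (Ω : Set Z) (F : Z → ℝ → E) : Prop := ∀ k, CkFamily J Ω k F

lemma CkFamily.continuousOn_iteratedDerivWithin (hJ : UniqueDiffOn ℝ J) (h : CkFamily J Ω k F) :
    ContinuousOn (fun x : Z × ℝ => iteratedDerivWithin k (F x.1) J x.2) (Ω ×ˢ J) := by
  induction k generalizing F with
  | zero => simp only [iteratedDerivWithin_zero]; exact h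
  | succ k ih =>
    obtain ⟨-, F', h1, h2⟩ := h
    refine (ih h2).congr fun x hx => ?_
    simp only
    rw [iteratedDerivWithin_succ']
    exact iteratedDerivWithin_congr
      (fun s hs => (h1 x.1 hx.1 s hs).derivWithin (hJ s hs)) hx.2

lemma CkFamily.contDiffOn (hJ : UniqueDiffOn ℝ J) (h : CkFamily J Ω k F) {z : Z} (hz : z ∈ Ω) :
    ContDiffOn ℝ k (F z) J := by
  induction k generalizing F with
  | zero =>
    refine contDiffOn_zero.2 ?_
    exact h.continuousOn.comp (f := fun s : ℝ => (z, s)) (by fun_prop) fun s hs => ⟨hz, hs⟩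
  | succ k ih =>
    obtain ⟨-, F', h1, h2⟩ := h
    rw [Nat.cast_succ, contDiffOn_succ_iff_derivWithin hJ]
    refine ⟨fun s hs => (h1 z hz s hs).differentiableWithinAt, by simp, ?_⟩
    exact (ih h2).congr fun s hs => (h1 z hz s hs).derivWithin (hJ s hs)

/-- The recursive form is closed under sums, products and composition; the form on the right is the
one seen by the topology of `LinkMapSpace`. -/
lemma smoothFamily_iff (hJ : UniqueDiffOn ℝ J) :
    SmoothFamily J Ω F ↔ (∀ z ∈ Ω, ContDiffOn ℝ ∞ (F z) J) ∧
      ∀ k, ContinuousOn (fun x : Z × ℝ => iteratedDerivWithin k (F x.1) J x.2) (Ω ×ˢ J) := by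
  refine ⟨fun h => ⟨fun z hz => contDiffOn_infty.2 fun k => (h k).contDiffOn hJ hz,
    fun k => (h k).continuousOn_iteratedDerivWithin hJ⟩, fun ⟨h1, h2⟩ k => ?_⟩
  -- Differentiation raises `l` while `k` drops, so the induction has to carry all `l` at once.
  suffices ∀ l, CkFamily J Ω k (fun z => iteratedDerivWithin l (F z) J) by
    simpa only [iteratedDerivWithin_zero] using this 0
  induction k with
  | zero => exact fun l => h2 l
  | succ k ih =>
    refine fun l => ⟨h2 l, fun z => iteratedDerivWithin (l + 1) (F z) J, fun z hz s hs => ?_,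
      ih _⟩
    simp only [iteratedDerivWithin_succ]
    exact ((h1 z hz).differentiableOn_iteratedDerivWithin
      (by exact_mod_cast ENat.natCast_lt_top l) hJ s hs).hasDerivWithinAt

lemma SmoothFamily.mono (h : SmoothFamily J Ω F) (hΩ : Ω' ⊆ Ω) : SmoothFamily J Ω' F :=
  fun k => (h k).mono hΩ

lemma SmoothFamily.congr (h : SmoothFamily J Ω F) (e : ∀ z ∈ Ω, ∀ s ∈ J, G z s = F z s) :
    SmoothFamily J Ω G :=
  fun k => (h k).congr e

lemma SmoothFamily.add (hF : SmoothFamily J Ω F) (hG : SmoothFamily J Ω G) :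
    SmoothFamily J Ω (fun z s => F z s + G z s) := fun k => (hF k).add (hG k)

lemma SmoothFamily.smul {f : Z → ℝ → ℝ} (hf : SmoothFamily J Ω f) (hG : SmoothFamily J Ω G) :
    SmoothFamily J Ω (fun z s => f z s • G z s) := fun k => (hf k).smul (hG k)

lemma SmoothFamily.mul {f g : Z → ℝ → ℝ} (hf : SmoothFamily J Ω f) (hg : SmoothFamily J Ω g) :
    SmoothFamily J Ω (fun z s => f z s * g z s) := hf.smul hg

lemma SmoothFamily.prodMk {G : Z → ℝ → E'} (hF : SmoothFamily J Ω F)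
    (hG : SmoothFamily J Ω G) : SmoothFamily J Ω (fun z s => (F z s, G z s)) :=
  fun k => (hF k).prodMk (hG k)

lemma SmoothFamily.clm (hF : SmoothFamily J Ω F) (L : E →L[ℝ] E') :
    SmoothFamily J Ω (fun z s => L (F z s)) := fun k => (hF k).clm L

lemma SmoothFamily.of_param {g : Z → E} (hg : ContinuousOn g Ω) :
    SmoothFamily J Ω (fun z _ => g z) := fun _ =>
  CkFamily.of_hasDerivWithinAt_zero (hg.comp continuousOn_fst fun _ hx => hx.1)
    fun _ _ s _ => hasDerivWithinAt_const s J _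

lemma SmoothFamily.of_contDiff {g : ℝ → E} (hg : ContDiff ℝ ∞ g) :
    SmoothFamily J Ω (fun _ => g) := by
  intro k
  induction k generalizing g with
  | zero => exact hg.continuous.comp_continuousOn continuousOn_snd
  | succ k ih =>
    refine ⟨hg.continuous.comp_continuousOn continuousOn_snd, fun _ => deriv g,
      fun z _ s _ => ?_, ih ?_⟩
    · exact ((hg.differentiable (by simp)) s).hasDerivAt.hasDerivWithinAt
    · exact (contDiff_infty_iff_deriv.1 hg).2

lemma SmoothFamily.comp {Ψ : Set Z'} {g : Z → Z'} {ρ : Z → ℝ → ℝ} {F : Z' → ℝ → E}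
    (hF : SmoothFamily J' Ψ F) (hg : ContinuousOn g Ω) (hgm : Set.MapsTo g Ω Ψ)
    (hρ : SmoothFamily J Ω ρ) (hρm : ∀ z ∈ Ω, ∀ s ∈ J, ρ z s ∈ J') :
    SmoothFamily J Ω (fun z s => F (g z) (ρ z s)) :=
  fun k => (hF k).comp hg hgm (hρ k) hρm

lemma SmoothFamily.comp_param {Ψ : Set Z'} {g : Z → Z'} {F : Z' → ℝ → E}
    (hF : SmoothFamily J Ψ F) (hg : ContinuousOn g Ω) (hgm : Set.MapsTo g Ω Ψ) :
    SmoothFamily J Ω (fun z s => F (g z) s) :=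
  hF.comp hg hgm (.of_contDiff contDiff_id) fun _ _ _ hs => hs

/-- At a point outside a closed piece, the neighborhood filter within that piece is trivial, so
continuity within each piece holds at every point of `s` and the two can be glued. -/
lemma continuousOn_of_closed_cover {X Y : Type*} [TopologicalSpace X] [TopologicalSpace Y]
    {f : X → Y} {s t₁ t₂ : Set X} (h₁ : IsClosed t₁) (h₂ : IsClosed t₂) (hs : s ⊆ t₁ ∪ t₂)
    (hf₁ : ContinuousOn f (s ∩ t₁)) (hf₂ : ContinuousOn f (s ∩ t₂)) : ContinuousOn f s := by
  have key : ∀ t : Set X, IsClosed t → ContinuousOn f (s ∩ t) → ∀ x ∈ s,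
      ContinuousWithinAt f (s ∩ t) x := by
    intro t ht hf x hx
    by_cases hxt : x ∈ t
    · exact hf x ⟨hx, hxt⟩
    · have : x ∉ closure (s ∩ t) := fun h =>
        hxt (ht.closure_subset_iff.2 Set.inter_subset_right h)
      rw [mem_closure_iff_nhdsWithin_neBot, Filter.not_neBot] at this
      rw [ContinuousWithinAt, this]
      exact Filter.tendsto_bot
  intro x hx
  have h := (key t₁ h₁ hf₁ x hx).union (key t₂ h₂ hf₂ x hx)
  rwa [← Set.inter_union_distrib_left, Set.inter_eq_left.2 hs] at h

/-- Derivatives are taken with the parameter fixed, so a closed cover of the parameters never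
interferes with them; only the continuity of each derivative needs pasting. -/
lemma SmoothFamily.of_closed_cover (hJ : UniqueDiffOn ℝ J) {C₁ C₂ : Set Z}
    (h₁ : IsClosed C₁) (h₂ : IsClosed C₂) (hΩ : Ω ⊆ C₁ ∪ C₂)
    (hF₁ : SmoothFamily J (Ω ∩ C₁) F) (hF₂ : SmoothFamily J (Ω ∩ C₂) F) :
    SmoothFamily J Ω F := by
  rw [smoothFamily_iff hJ] at hF₁ hF₂ ⊢
  refine ⟨fun z hz => (hΩ hz).elim (fun h => hF₁.1 z ⟨hz, h⟩) fun h => hF₂.1 z ⟨hz, h⟩,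
    fun k => ?_⟩
  refine continuousOn_of_closed_cover (h₁.preimage continuous_fst) (h₂.preimage continuous_fst)
    (fun x hx => hΩ hx.1) ((hF₁.2 k).mono ?_) ((hF₂.2 k).mono ?_)
  · exact fun x hx => ⟨⟨hx.1.1, hx.2⟩, hx.1.2⟩
  · exact fun x hx => ⟨⟨hx.1.1, hx.2⟩, hx.1.2⟩

lemma SmoothFamily.continuousOn (h : SmoothFamily J Ω F) :
    ContinuousOn (fun x : Z × ℝ => F x.1 x.2) (Ω ×ˢ J) := (h 0).continuousOn

lemma SmoothFamily.differentiableWithinAt (h : SmoothFamily J Ω F) {z : Z} (hz : z ∈ Ω)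
    {s : ℝ} (hs : s ∈ J) : DifferentiableWithinAt ℝ (F z) J s := by
  obtain ⟨-, F', h1, -⟩ := h 1
  exact (h1 z hz s hs).differentiableWithinAt

end Families

/-! ### The topology of spaces of link maps -/

section LinkMaps

variable {β : BoundaryBehavior} {n : ℕ} {a : Fin n → EuclideanSpace ℝ (Fin 2)}
  {J : Fin n → Set ℝ}

/-- Local compactness of the domain makes evaluation jointly continuous for convergence on compact
sets, one derivative at a time. -/
lemma LinkMapSpace.smoothFamily_eval (i : Fin n) (hJ : UniqueDiffOn ℝ (J i))
    [LocallyCompactSpace (J i)] :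
    SmoothFamily (J i) Set.univ (fun f : LinkMapSpace β a J => extendZero (f.1 i)) := by
  rw [smoothFamily_iff hJ]
  refine ⟨fun f _ => f.2.smooth i, fun k => ?_⟩
  have h1 : Continuous (LinkMapSpace.strandDeriv (β := β) (a := a) (J := J) i k) :=
    continuous_iff_le_induced.2 ((iInf_le _ i).trans (iInf_le _ k))
  have h2 := UniformOnFun.continuousOn_eval₂ (β := Space) (𝔖 := {K : Set (J i) | IsCompact K})
    fun x => let ⟨V, hV, hx⟩ := exists_compact_mem_nhds x; ⟨V, hV, hx⟩
  have h3 : Continuous fun y : LinkMapSpace β a J × J i =>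
      iteratedDerivWithin k (extendZero (y.1.1 i)) (J i) y.2 := by
    rw [← continuousOn_univ]
    refine h2.comp (f := fun y : LinkMapSpace β a J × J i => (strandDeriv i k y.1, y.2))
      (by fun_prop) fun y _ => ?_
    have := ((y.1.2.smooth i).continuousOn_iteratedDerivWithin (m := k)
      (by exact_mod_cast le_top) hJ)
    exact (continuousOn_iff_continuous_domRestrict.1 this).continuousAt
  rw [continuousOn_iff_continuous_domRestrict]
  exact h3.comp (f := fun x : (Set.univ ×ˢ J i : Set (LinkMapSpace β a J × ℝ)) =>
    (x.1.1, (⟨x.1.2, x.2.2⟩ : J i))) (by fun_prop)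

/-- The converse of the previous lemma: currying a jointly continuous derivative is continuous into
the compact-open topology, with no local compactness required. -/
lemma LinkMapSpace.continuous_of_smoothFamily {Z : Type*} [TopologicalSpace Z]
    {f : Z → LinkMapSpace β a J} {G : Z → Fin n → ℝ → Space} (hJ : ∀ i, UniqueDiffOn ℝ (J i))
    (hfG : ∀ z i (s : J i), (f z).1 i s = G z i s)
    (hG : ∀ i, SmoothFamily (J i) Set.univ (fun z => G z i)) : Continuous f := by
  refine continuous_iInf_rng.2 fun i => continuous_iInf_rng.2 fun k => continuous_induced_rng.2 ?_
  have h1 := ((smoothFamily_iff (hJ i)).1 (hG i)).2 k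
  have h2 : Continuous fun x : Z × J i => iteratedDerivWithin k (G x.1 i) (J i) x.2 :=
    h1.comp_continuous (f := fun x : Z × J i => (x.1, (x.2 : ℝ))) (by fun_prop)
      fun x => ⟨trivial, x.2.2⟩
  have h3 := ContinuousMap.isUniformEmbedding_toUniformOnFunIsCompact.uniformContinuous.continuous.comp
    (ContinuousMap.curry ⟨_, h2⟩).continuous
  refine h3.congr fun z => ?_
  funext x
  refine iteratedDerivWithin_congr (fun s hs => ?_) x.2
  rw [extendZero_apply _ (⟨s, hs⟩ : J i), hfG]

end LinkMaps

/-! ### The realization of the poset of punctures as a cube -/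

/-- The indexing poset of the stage `(1, …, 1)`. -/
abbrev Idx (n : ℕ) : Type := PunctureIndex (fun _ : Fin n => 1)

/-- The endpoint of the unit interval that corresponds to removing all punctures but `j`. -/
def corner : Fin 2 → I := ![0, 1]

/-- The smallest object over which a point of the cube lies. -/
def carrier {n : ℕ} (u : Fin n → I) : Idx n := fun i =>
  ⟨Finset.univ.filter fun j : Fin 2 => u i ≠ corner j, by
    by_cases h : u i = 0
    · exact ⟨(1 : Fin 2), by simp [corner, h]⟩
    · exact ⟨(0 : Fin 2), Finset.mem_filter.2 ⟨Finset.mem_univ _, h⟩⟩⟩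

/-- The points lying over `c` form a closed face: each puncture missing from `c` freezes one
coordinate at the matching endpoint. -/
lemma carrier_le_iff {n : ℕ} {u : Fin n → I} {c : Idx n} :
    carrier u ≤ c ↔ ∀ (i : Fin n) (j : Fin 2), j ∉ (c i).1 → u i = corner j := by
  refine ⟨fun h i j hj => ?_, fun h i j hj => ?_⟩
  · by_contra hne
    exact hj ((h i : (carrier u i).1 ⊆ (c i).1) (by simp [carrier, hne]))
  · by_contra hne
    exact (by simpa [carrier] using hj : u i ≠ corner j) (h i j hne)

/-! ### Barycentric coordinates of the cube as lengths of level intervals -/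

/-- The threshold above which the point `v` of the interval sees the puncture `j`. -/
def threshold (j : Fin 2) (v : I) : I :=
  Set.projIcc 0 1 zero_le_one (1 - 2 * |(v : ℝ) - corner j|)

lemma continuous_threshold (j : Fin 2) : Continuous (threshold j) := by
  unfold threshold
  exact continuous_projIcc.comp (by fun_prop)

lemma threshold_corner (j : Fin 2) : threshold j (corner j) = 1 := by
  simp [threshold]

/-- Every point is at distance at least `1 / 2` from one of the endpoints. Hence some puncture is
seen at every level, which makes `level` take nonempty values. -/
lemma exists_threshold_eq_zero (v : I) : ∃ j, threshold j v = 0 := by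
  rcases le_total (v : ℝ) (1 / 2) with h | h
  · refine ⟨1, Set.projIcc_of_le_left _ ?_⟩
    simp only [corner, Matrix.cons_val_one, Matrix.cons_val_fin_one, Set.Icc.coe_one]
    rw [abs_of_nonpos (by linarith)]
    linarith
  · refine ⟨0, Set.projIcc_of_le_left _ ?_⟩
    simp only [corner, Matrix.cons_val_zero, Set.Icc.coe_zero, sub_zero]
    rw [abs_of_nonneg (by linarith)]
    linarith

/-- The punctures seen by a point of the cube at level `x`. -/
def level {n : ℕ} (u : Fin n → I) (x : I) : Idx n := fun i =>
  ⟨Finset.univ.filter fun j : Fin 2 => threshold j (u i) ≤ x, by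
    obtain ⟨j, hj⟩ := exists_threshold_eq_zero (u i)
    exact ⟨j, by simp [hj]⟩⟩

lemma mem_level {n : ℕ} {u : Fin n → I} {x : I} {i : Fin n} {j : Fin 2} :
    j ∈ (level u x i).1 ↔ threshold j (u i) ≤ x := by simp [level]

lemma level_mono {n : ℕ} (u : Fin n → I) : Monotone (level u) := fun _ _ h _ _ hj =>
  mem_level.2 ((mem_level.1 hj).trans h)

/-- The infimum of the levels at which precisely the punctures in `s` are seen. -/
def lower {n : ℕ} (u : Fin n → I) (s : Idx n) : I :=
  Finset.univ.sup fun p : Fin n × Fin 2 => if p.2 ∈ (s p.1).1 then threshold p.2 (u p.1) else ⊥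

/-- The supremum of the levels at which precisely the punctures in `s` are seen. -/
def upper {n : ℕ} (u : Fin n → I) (s : Idx n) : I :=
  Finset.univ.inf fun p : Fin n × Fin 2 => if p.2 ∈ (s p.1).1 then ⊤ else threshold p.2 (u p.1)

lemma lower_le_iff {n : ℕ} {u : Fin n → I} {s : Idx n} {x : I} :
    lower u s ≤ x ↔ ∀ (i : Fin n) (j : Fin 2), j ∈ (s i).1 → threshold j (u i) ≤ x := by
  simp only [lower, Finset.sup_le_iff, Finset.mem_univ, true_imp_iff, Prod.forall]
  refine forall₂_congr fun i j => ?_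
  split_ifs with h <;> simp [h]

lemma le_upper_iff {n : ℕ} {u : Fin n → I} {s : Idx n} {x : I} :
    x ≤ upper u s ↔ ∀ (i : Fin n) (j : Fin 2), j ∉ (s i).1 → x ≤ threshold j (u i) := by
  simp only [upper, Finset.le_inf_iff, Finset.mem_univ, true_imp_iff, Prod.forall]
  refine forall₂_congr fun i j => ?_
  split_ifs with h <;> simp [h]

lemma lt_upper_iff {n : ℕ} {u : Fin n → I} {s : Idx n} {x : I} (hx : x < 1) :
    x < upper u s ↔ ∀ (i : Fin n) (j : Fin 2), j ∉ (s i).1 → x < threshold j (u i) := by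
  rw [upper, Finset.lt_inf_iff (show x < ⊤ from hx)]
  simp only [Finset.mem_univ, true_imp_iff, Prod.forall]
  refine forall₂_congr fun i j => ?_
  split_ifs with h
  · simpa [h] using (show x < ⊤ from hx)
  · simp [h]

/-- Raising `x` switches a puncture on when its threshold is reached, so the levels at which exactly
`s` is seen form a half-open interval. The level `1` is excluded because `upper` never exceeds `1`.
-/
lemma lower_le_and_lt_upper_iff {n : ℕ} {u : Fin n → I} {s : Idx n} {x : I} (hx : x < 1) :
    (lower u s ≤ x ∧ x < upper u s) ↔ s = level u x := by
  rw [lower_le_iff, lt_upper_iff hx]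
  refine ⟨fun h => ?_, fun h => ?_⟩
  · funext i
    refine Subtype.ext (Finset.ext fun j => ?_)
    rw [mem_level]
    exact ⟨h.1 i j, fun hj => by_contra fun hn => (h.2 i j hn).not_ge hj⟩
  · subst h
    exact ⟨fun i j hj => mem_level.1 hj, fun i j hj => not_le.1 fun h => hj (mem_level.2 h)⟩

/-- The barycentric coordinates of a point of the cube. -/
def bary {n : ℕ} (u : Fin n → I) (s : Idx n) : ℝ := max ((upper u s : ℝ) - lower u s) 0

lemma continuous_bary {n : ℕ} : Continuous (bary : (Fin n → I) → Idx n → ℝ) := by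
  refine continuous_pi fun s => ?_
  have h1 : Continuous fun u : Fin n → I => lower u s := by
    unfold lower
    refine Continuous.finset_sup_apply fun p _ => ?_
    split_ifs
    · exact (continuous_threshold _).comp (continuous_apply _)
    · exact continuous_const
  have h2 : Continuous fun u : Fin n → I => upper u s := by
    unfold upper
    refine Continuous.finset_inf_apply fun p _ => ?_
    split_ifs
    · exact continuous_const
    · exact (continuous_threshold _).comp (continuous_apply _)
  unfold bary
  fun_prop

lemma exists_level_of_bary_ne_zero {n : ℕ} {u : Fin n → I} {s : Idx n} (h : bary u s ≠ 0) :
    ∃ x < 1, s = level u x := by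
  have h1 : lower u s < upper u s := by
    by_contra hn
    exact h (max_eq_right (sub_nonpos.2 (Subtype.coe_le_coe.2 (not_lt.1 hn))))
  have h2 : lower u s < 1 := h1.trans_le le_top
  exact ⟨_, h2, (lower_le_and_lt_upper_iff h2).1 ⟨le_rfl, h1⟩⟩

/-- Each weight is the length of a half-open interval, and these intervals partition `[0, 1)`;
additivity of Lebesgue measure gives the total. -/
lemma sum_bary {n : ℕ} (u : Fin n → I) : ∑ s, bary u s = 1 := by
  have hU : ⋃ s, Set.Ico (lower u s : ℝ) (upper u s) = Set.Ico 0 1 := by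
    ext x
    simp only [Set.mem_iUnion, Set.mem_Ico]
    refine ⟨fun ⟨s, h1, h2⟩ => ⟨(lower u s).2.1.trans h1, h2.trans_le (upper u s).2.2⟩,
      fun ⟨h0, h1⟩ => ?_⟩
    have := (lower_le_and_lt_upper_iff (u := u) (x := ⟨x, h0, h1.le⟩) h1).2 rfl
    exact ⟨_, this.1, this.2⟩
  have hd : Pairwise (Function.onFun Disjoint fun s => Set.Ico (lower u s : ℝ) (upper u s)) := by
    refine fun s s' hs => Set.disjoint_left.2 fun x hx hx' => hs ?_
    have h1 : x < 1 := hx.2.trans_le (upper u s).2.2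
    have h0 : 0 ≤ x := (lower u s).2.1.trans hx.1
    rw [(lower_le_and_lt_upper_iff (u := u) (s := s) (x := ⟨x, h0, h1.le⟩) h1).1 hx,
      (lower_le_and_lt_upper_iff (u := u) (s := s') (x := ⟨x, h0, h1.le⟩) h1).1 hx']
  have h := MeasureTheory.measure_iUnion (μ := MeasureTheory.volume) hd
    fun s => measurableSet_Ico
  rw [hU, tsum_fintype] at h
  simp only [Real.volume_Ico, sub_zero, ENNReal.ofReal_one] at h
  have h2 := congrArg ENNReal.toReal h
  rw [ENNReal.toReal_sum fun s _ => ENNReal.ofReal_ne_top] at h2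
  simp only [ENNReal.toReal_ofReal', ENNReal.toReal_one] at h2
  exact h2.symm

/-- Vertices of nonzero weight are values of the monotone map `level u`, hence form a chain. -/
lemma bary_mem {n : ℕ} (u : Fin n → I) : bary u ∈ realization (Idx n) := by
  refine ⟨fun s => le_max_right _ _, sum_bary u, fun s hs s' hs' _ => ?_⟩
  obtain ⟨x, -, rfl⟩ := exists_level_of_bary_ne_zero hs
  obtain ⟨x', -, rfl⟩ := exists_level_of_bary_ne_zero hs'
  exact (le_total x x').imp (fun h => level_mono u h) fun h => level_mono u h

lemma bary_mem_over {n : ℕ} {u : Fin n → I} {c : Idx n} (h : carrier u ≤ c) :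
    bary u ∈ realizationOver c := by
  refine ⟨bary_mem u, fun s hs i j hj => ?_⟩
  obtain ⟨x, hx, rfl⟩ := exists_level_of_bary_ne_zero hs
  by_contra hn
  rw [mem_level, carrier_le_iff.1 h i j hn, threshold_corner] at hj
  exact hx.not_ge hj

/-! ### From barycentric coordinates back to the cube -/

/-- The total weight of the vertices that do not see the puncture `j` of the `i`-th strand. -/
def missing {n : ℕ} (w : Idx n → ℝ) (i : Fin n) (j : Fin 2) : ℝ :=
  ∑ s with j ∉ (s i).1, w s

/-- The point of the cube with given barycentric coordinates. -/
def coord {n : ℕ} (w : Idx n → ℝ) (i : Fin n) : I :=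
  Set.projIcc 0 1 zero_le_one ((1 - missing w i 0 + missing w i 1) / 2)

lemma continuous_coord {n : ℕ} : Continuous (coord : (Idx n → ℝ) → Fin n → I) := by
  refine continuous_pi fun i => ?_
  unfold coord missing
  exact continuous_projIcc.comp (by fun_prop)

lemma missing_nonneg {n : ℕ} {w : Idx n → ℝ} (hw : w ∈ realization (Idx n)) (i : Fin n)
    (j : Fin 2) : 0 ≤ missing w i j := Finset.sum_nonneg fun s _ => hw.1 s

lemma missing_le_one {n : ℕ} {w : Idx n → ℝ} (hw : w ∈ realization (Idx n)) (i : Fin n)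
    (j : Fin 2) : missing w i j ≤ 1 :=
  hw.2.1 ▸ Finset.sum_le_univ_sum_of_nonneg hw.1

/-- On the realization the clamp in `coord` is inactive. -/
lemma coe_coord {n : ℕ} {w : Idx n → ℝ} (hw : w ∈ realization (Idx n)) (i : Fin n) :
    (coord w i : ℝ) = (1 - missing w i 0 + missing w i 1) / 2 := by
  have h0 := missing_nonneg hw i 0
  have h1 := missing_nonneg hw i 1
  have h2 := missing_le_one hw i 0
  have h3 := missing_le_one hw i 1
  rw [coord, Set.projIcc_of_mem _ (show _ ∈ Set.Icc (0 : ℝ) 1 from ⟨by linarith, by linarith⟩)]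

lemma missing_eq_zero {n : ℕ} {w : Idx n → ℝ} {i : Fin n} {j : Fin 2}
    (h : ∀ s, w s ≠ 0 → j ∈ (s i).1) : missing w i j = 0 :=
  Finset.sum_eq_zero fun s hs => by_contra fun h' => (Finset.mem_filter.1 hs).2 (h s h')

lemma missing_eq_one {n : ℕ} {w : Idx n → ℝ} (hw : w ∈ realization (Idx n)) {i : Fin n}
    {j : Fin 2} (h : ∀ s, w s ≠ 0 → j ∉ (s i).1) : missing w i j = 1 := by
  rw [missing, Finset.sum_filter, ← hw.2.1]
  refine Finset.sum_congr rfl fun s _ => ?_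
  by_cases hs : w s = 0
  · simp [hs]
  · rw [if_pos (h s hs)]

lemma mem_of_not_mem {n : ℕ} (s : Idx n) (i : Fin n) {j j' : Fin 2} (h : j ∉ (s i).1)
    (hj : j' ≠ j) : j' ∈ (s i).1 := by
  obtain ⟨k, hk⟩ := (s i).2
  have : k ≠ j := fun e => h (e ▸ hk)
  have e : ∀ k j j' : Fin 2, k ≠ j → j' ≠ j → k = j' := by decide
  exact e k j j' this hj ▸ hk

lemma carrier_coord_le {n : ℕ} {w : Idx n → ℝ} {c : Idx n} (hw : w ∈ realizationOver c) :
    carrier (coord w) ≤ c := by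
  refine carrier_le_iff.2 fun i j hj => Subtype.ext ?_
  have h1 : ∀ s, w s ≠ 0 → j ∉ (s i).1 := fun s hs h =>
    hj ((hw.2 s hs i : (s i).1 ⊆ (c i).1) h)
  have e1 := missing_eq_one hw.1 h1
  have e2 : ∀ j' ≠ j, missing w i j' = 0 := fun j' hj' =>
    missing_eq_zero fun s hs => mem_of_not_mem s i (h1 s hs) hj'
  rw [coe_coord hw.1]
  fin_cases j
  · have := e2 1 (by decide)
    simp_all [corner]
  · have := e2 0 (by decide)
    simp_all [corner]

lemma coe_threshold_coord {n : ℕ} {w : Idx n → ℝ} (hw : w ∈ realization (Idx n)) (i : Fin n)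
    {j j' : Fin 2} (h : j' ≠ j) :
    (threshold j (coord w i) : ℝ) = max 0 (missing w i j - missing w i j') := by
  have h0 := (coord w i).2.1
  have h1 := (coord w i).2.2
  have m := coe_coord hw i
  have a0 := missing_nonneg hw i 0
  have a1 := missing_nonneg hw i 1
  have a2 := missing_le_one hw i 0
  have a3 := missing_le_one hw i 1
  rw [threshold, Set.coe_projIcc]
  congr 1
  fin_cases j
  · obtain rfl : j' = 1 := by fin_cases j' <;> simp_all
    simp only [corner, Fin.zero_eta, Matrix.cons_val_zero, Set.Icc.coe_zero, sub_zero]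
    rw [abs_of_nonneg h0, m, min_eq_right (by linarith)]
    ring
  · obtain rfl : j' = 0 := by fin_cases j' <;> simp_all
    simp only [corner, Fin.mk_one, Matrix.cons_val_one, Matrix.cons_val_fin_one, Set.Icc.coe_one]
    rw [abs_of_nonpos (by linarith), m, min_eq_right (by linarith)]
    ring

/-- Both sides have total weight one, so it is enough to bound each weight from one side. Along the
chain supporting `w`, the vertex `s` should occupy the levels from `L`, the weight strictly below
it, to `w s + L`; the two bounds on `lower` and `upper` say that it occupies at least these. -/
lemma bary_coord {n : ℕ} {w : Idx n → ℝ} (hw : w ∈ realization (Idx n)) :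
    bary (coord w) = w := by
  have comp : ∀ s s', w s ≠ 0 → w s' ≠ 0 → s ≤ s' ∨ s' ≤ s := fun s s' hs hs' =>
    hw.2.2.total hs hs'
  have key : ∀ s, w s ≤ bary (coord w) s := by
    intro s
    by_cases hs : w s = 0
    · exact hs ▸ le_max_right _ _
    classical
    set L := ∑ s' with s' < s, w s' with hL
    have hL0 : 0 ≤ L := Finset.sum_nonneg fun s _ => hw.1 s
    have hU : ∑ s' with s' ≤ s, w s' = w s + L := by
      rw [hL, ← Finset.sum_insert (by simp)]
      refine Finset.sum_congr ?_ fun _ _ => rfl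
      ext x
      simp [le_iff_eq_or_lt]
    have hU1 : w s + L ≤ 1 := by
      rw [← hU, ← hw.2.1]
      exact Finset.sum_le_univ_sum_of_nonneg hw.1
    have hlow : (lower (coord w) s : ℝ) ≤ L := by
      have : lower (coord w) s ≤ ⟨L, hL0, by linarith [hw.1 s]⟩ := by
        refine lower_le_iff.2 fun i j hj => Subtype.coe_le_coe.1 ?_
        have hne : j + 1 ≠ j := by fin_cases j <;> simp
        rw [coe_threshold_coord hw i hne]
        refine max_le hL0 ?_
        have h1 := missing_nonneg hw i (j + 1)
        suffices missing w i j ≤ L by simp only; linarith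
        rw [missing, hL, Finset.sum_filter, Finset.sum_filter]
        refine Finset.sum_le_sum fun s' _ => ?_
        by_cases hs' : w s' = 0
        · simp [hs']
        -- A vertex of the chain that misses `j`, while `s` contains it, must lie strictly below
        -- `s`.
        by_cases h2 : j ∈ (s' i).1
        · rw [if_neg (not_not.2 h2)]
          split_ifs
          exacts [hw.1 s', le_rfl]
        · have h3 : s' < s := by
            rcases comp s s' hs hs' with h | h
            · exact absurd ((h i : (s i).1 ⊆ (s' i).1) hj) h2
            · exact lt_of_le_of_ne h fun e => h2 (e ▸ hj)
          rw [if_pos h2, if_pos h3]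
      exact this
    have hup : w s + L ≤ (upper (coord w) s : ℝ) := by
      have : (⟨w s + L, add_nonneg (hw.1 s) hL0, hU1⟩ : I) ≤ upper (coord w) s := by
        refine le_upper_iff.2 fun i j hj => Subtype.coe_le_coe.1 ?_
        have hne : j + 1 ≠ j := by fin_cases j <;> simp
        rw [coe_threshold_coord hw i hne]
        refine le_max_of_le_right ?_
        -- In `Fin 2`, `j + 1` is the other puncture. A vertex missing it would contain `j`, and so
        -- be incomparable with `s`, which contains `j + 1` but not `j`.
        have h0 : missing w i (j + 1) = 0 := by
          refine missing_eq_zero fun s' hs' => by_contra fun hn => ?_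
          have h1 := mem_of_not_mem s' i hn hne.symm
          rcases comp s s' hs hs' with h | h
          · exact hn ((h i : (s i).1 ⊆ (s' i).1) (mem_of_not_mem s i hj hne))
          · exact hj ((h i : (s' i).1 ⊆ (s i).1) h1)
        rw [h0, sub_zero, missing]
        simp only
        rw [← hU]
        refine Finset.sum_le_sum_of_subset_of_nonneg (fun s' hs' => ?_) fun s' _ _ => hw.1 s'
        have h1 : s' ≤ s := (Finset.mem_filter.1 hs').2
        exact Finset.mem_filter.2 ⟨Finset.mem_univ _,
          fun h2 => hj ((h1 i : (s' i).1 ⊆ (s i).1) h2)⟩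
      exact this
    exact le_max_of_le_left (by linarith)
  funext s
  exact ((Finset.sum_eq_sum_iff_of_le fun s _ => key s).1
    (hw.2.1.trans (sum_bary _).symm) s (Finset.mem_univ s)).symm

/-- The chain condition is closed because it says that the product of the weights of any two
incomparable vertices vanishes. Compactness is what later gives a positive distance between strands.
-/
lemma isCompact_realizationOver {n : ℕ} (c : Idx n) : IsCompact (realizationOver c) := by
  have h1 : IsClosed (realizationOver c) := by
    have e : realizationOver c = ((⋂ s, {w : Idx n → ℝ | 0 ≤ w s}) ∩ {w | ∑ s, w s = 1}) ∩
        ((⋂ s, ⋂ s', ⋂ _ : ¬ (s ≤ s' ∨ s' ≤ s), {w | w s * w s' = 0}) ∩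
          ⋂ s, ⋂ _ : ¬ s ≤ c, {w | w s = 0}) := by
      ext w
      simp only [realizationOver, realization, Set.mem_ofPred_eq, Set.mem_inter_iff,
        Set.mem_iInter, mul_eq_zero]
      refine ⟨fun ⟨⟨h1, h2, h3⟩, h4⟩ => ⟨⟨h1, h2⟩, fun s s' hs => ?_, fun s hs => ?_⟩,
        fun ⟨⟨h1, h2⟩, h3, h4⟩ => ⟨⟨h1, h2, fun s hs s' hs' _ => ?_⟩, fun s hs => ?_⟩⟩
      · by_contra! h
        exact hs (h3.total h.1 h.2)
      · by_contra h
        exact hs (h4 s h)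
      · by_contra h
        exact (h3 s s' h).elim hs hs'
      · by_contra h
        exact hs (h4 s h)
    rw [e]
    refine ((isClosed_iInter fun s => isClosed_le continuous_const (by fun_prop)).inter
      (isClosed_eq (by fun_prop) continuous_const)).inter
      ((isClosed_iInter fun s => isClosed_iInter fun s' => isClosed_iInter fun _ =>
        isClosed_eq (by fun_prop) continuous_const).inter
      (isClosed_iInter fun s => isClosed_iInter fun _ => isClosed_eq (by fun_prop)
        continuous_const))
  refine (isCompact_univ_pi fun _ : Idx n => isCompact_Icc (a := (0 : ℝ)) (b := 1)).of_isClosed_subset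
    h1 fun w hw s _ => ⟨hw.1.1 s, ?_⟩
  rw [← hw.1.2.1]
  exact Finset.single_le_sum (fun s _ => hw.1.1 s) (Finset.mem_univ s)

instance {n : ℕ} (c : Idx n) : CompactSpace (realizationOver c) :=
  isCompact_iff_compactSpace.1 (isCompact_realizationOver c)

/-! ### Pushing the cylinder into its interior -/

lemma mem_cylinder_iff {x : Space} : x ∈ cylinder ↔ ‖x.1‖ ≤ 1 ∧ 0 ≤ x.2 ∧ x.2 ≤ 1 := by
  simp [cylinder, Set.mem_prod]

lemma mem_interior_cylinder_iff {x : Space} :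
    x ∈ interior cylinder ↔ ‖x.1‖ < 1 ∧ 0 < x.2 ∧ x.2 < 1 := by
  rw [cylinder, interior_prod_eq, interior_closedBall _ one_ne_zero, interior_Icc]
  simp [Set.mem_prod]

/-- The embedding of the cylinder into itself that shrinks the disk by the factor `1 - l ^ 2` and
the interval by the factor `1 - l`. -/
def push (l : ℝ) (x : Space) : Space := ((1 - l ^ 2) • x.1, x.2 + l * (1 / 2 - x.2))

@[simp] lemma push_zero (x : Space) : push 0 x = x := by simp [push]

lemma continuous_push : Continuous fun y : ℝ × Space => push y.1 y.2 := by
  unfold push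
  fun_prop

lemma push_injective {l : ℝ} (h0 : 0 ≤ l) (h1 : l < 1) : Function.Injective (push l) := by
  intro x y h
  have e1 : (1 - l ^ 2) • x.1 = (1 - l ^ 2) • y.1 := congrArg Prod.fst h
  have e2 : x.2 + l * (1 / 2 - x.2) = y.2 + l * (1 / 2 - y.2) := congrArg Prod.snd h
  refine Prod.ext ((smul_right_injective _ (ne_of_gt ?_)) e1) ?_
  · nlinarith
  · have : (1 - l) * (x.2 - y.2) = 0 := by linarith
    rcases mul_eq_zero.1 this with h | h <;> linarith

lemma norm_push_fst {l : ℝ} (h0 : 0 ≤ l) (h1 : l ≤ 1) (x : Space) :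
    ‖(push l x).1‖ = (1 - l ^ 2) * ‖x.1‖ := by
  rw [push, norm_smul, Real.norm_of_nonneg (by nlinarith)]

lemma push_mem_cylinder {l : ℝ} (h0 : 0 ≤ l) (h1 : l ≤ 1) {x : Space} (hx : x ∈ cylinder) :
    push l x ∈ cylinder := by
  rw [mem_cylinder_iff] at hx ⊢
  obtain ⟨h2, h3, h4⟩ := hx
  rw [norm_push_fst h0 h1]
  have := norm_nonneg x.1
  refine ⟨by nlinarith [sq_nonneg l], ?_, ?_⟩ <;> simp only [push] <;> nlinarith

lemma push_mem_interior {l : ℝ} (h0 : 0 < l) (h1 : l ≤ 1) {x : Space} (hx : x ∈ cylinder) :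
    push l x ∈ interior cylinder := by
  rw [mem_cylinder_iff] at hx
  rw [mem_interior_cylinder_iff]
  obtain ⟨h2, h3, h4⟩ := hx
  rw [norm_push_fst h0.le h1]
  have := norm_nonneg x.1
  have hl : 0 < l ^ 2 := pow_pos h0 2
  have hl' : 0 ≤ 1 - l ^ 2 := by nlinarith
  refine ⟨by nlinarith [mul_le_mul_of_nonneg_left h2 hl'], ?_, ?_⟩ <;> simp only [push] <;>
    nlinarith

/-- The horizontal displacement is at most `l ^ 2` and the vertical one at most `l / 2`. -/
lemma dist_push_le {l : ℝ} (h0 : 0 ≤ l) (h1 : l ≤ 1) {x : Space} (hx : x ∈ cylinder) :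
    dist (push l x) x ≤ l := by
  rw [mem_cylinder_iff] at hx
  obtain ⟨h2, h3, h4⟩ := hx
  rw [Prod.dist_eq]
  refine max_le ?_ ?_
  · have : (push l x).1 - x.1 = (-l ^ 2) • x.1 := by
      simp only [push]
      module
    rw [dist_eq_norm, this, norm_smul, Real.norm_eq_abs, abs_neg, abs_of_nonneg (sq_nonneg l)]
    nlinarith [norm_nonneg x.1, mul_le_mul_of_nonneg_left h2 (sq_nonneg l)]
  · rw [Real.dist_eq, abs_le]
    simp only [push]
    constructor <;> nlinarith

lemma push_ne_of_dist {l l' m : ℝ} (h0 : 0 ≤ l) (h0' : 0 ≤ l') (h : l ≤ m) (h' : l' ≤ m)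
    (hm : m ≤ 1) {x y : Space} (hx : x ∈ cylinder) (hy : y ∈ cylinder) (hxy : 2 * m < dist x y) :
    push l x ≠ push l' y := by
  intro e
  have h1 := dist_push_le h0 (h.trans hm) hx
  have h2 := dist_push_le h0' (h'.trans hm) hy
  have h3 := dist_triangle_left x y (push l x)
  rw [e] at h1
  rw [e] at h3
  linarith

/-- This is where disjointness after pushing comes from. A point of the bottom disk pushed by `m *
θ` ends at height `m * θ / 2`, while any point of the cylinder pushed by `m * θ'` ends at height at
least `m * θ' / 2`; at the top it is the mirror image. So equal images force `θ' ≤ θ` whenever `θ`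
is maximal or the point lies on a disk. By symmetry the amounts agree, and injectivity of a single
push finishes. -/
lemma push_eq_push {m θ θ' : ℝ} (hm : 0 < m) (hm' : m < 1) (h0 : 0 ≤ θ) (h0' : 0 ≤ θ')
    (h1 : θ ≤ 1) (h1' : θ' ≤ 1) {x y : Space} (hx : x ∈ cylinder) (hy : y ∈ cylinder)
    (hθ : θ = 1 ∨ x.2 = 0 ∨ x.2 = 1) (hθ' : θ' = 1 ∨ y.2 = 0 ∨ y.2 = 1)
    (h : push (m * θ) x = push (m * θ') y) : θ = θ' ∧ x = y := by
  have e2 : x.2 + m * θ * (1 / 2 - x.2) = y.2 + m * θ' * (1 / 2 - y.2) := congrArg Prod.snd h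
  have key : ∀ {θ θ' : ℝ} {x y : Space}, 0 ≤ θ → 0 ≤ θ' → θ ≤ 1 → θ' ≤ 1 → x ∈ cylinder →
      y ∈ cylinder → (θ = 1 ∨ x.2 = 0 ∨ x.2 = 1) →
      x.2 + m * θ * (1 / 2 - x.2) = y.2 + m * θ' * (1 / 2 - y.2) → θ' ≤ θ := by
    intro θ θ' x y h0 h0' h1 h1' hx hy hθ e2
    rw [mem_cylinder_iff] at hx hy
    obtain ⟨-, hx0, hx1⟩ := hx
    obtain ⟨-, hy0, hy1⟩ := hy
    rcases hθ with hθ | hθ | hθ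
    · exact hθ ▸ h1'
    · rw [hθ] at e2
      by_contra! hlt
      nlinarith [mul_le_mul_of_nonneg_left h1' hm.le, mul_lt_mul_of_pos_left hlt hm]
    · rw [hθ] at e2
      by_contra! hlt
      nlinarith [mul_le_mul_of_nonneg_left h1' hm.le, mul_lt_mul_of_pos_left hlt hm]
  obtain rfl : θ = θ' := le_antisymm (key h0' h0 h1' h1 hy hx hθ' e2.symm)
    (key h0 h0' h1 h1' hx hy hθ e2)
  exact ⟨rfl, push_injective (by positivity) (by nlinarith) h⟩

lemma SmoothFamily.push {Z : Type*} [TopologicalSpace Z] {J : Set ℝ} {Ω : Set Z}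
    {l : Z → ℝ → ℝ} {X : Z → ℝ → Space} (hl : SmoothFamily J Ω l) (hX : SmoothFamily J Ω X) :
    SmoothFamily J Ω (fun z s => push (l z s) (X z s)) := by
  have c : ∀ r : ℝ, SmoothFamily J Ω (fun (_ : Z) (_ : ℝ) => r) := fun r =>
    .of_param continuousOn_const
  have h1 : SmoothFamily J Ω (fun z s => (X z s).1) := hX.clm (.fst ℝ _ _)
  have h2 : SmoothFamily J Ω (fun z s => (X z s).2) := hX.clm (.snd ℝ _ _)
  refine ((((c 1).add ((c (-1)).mul (hl.mul hl))).smul h1).prodMk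
    (h2.add (hl.mul ((c (1 / 2)).add ((c (-1)).mul h2))))).congr fun z _ s _ => ?_
  simp only [StringLink.push]
  refine Prod.ext ?_ ?_
  · simp only
    congr 1
    ring
  · simp only
    ring

/-- Where the amount vanishes, its square contributes nothing to first order, so a vertical velocity
stays vertical and only its size changes. -/
lemma hasDerivWithinAt_push {J : Set ℝ} {l : ℝ → ℝ} {X : ℝ → Space} {s l' e : ℝ}
    (hl : HasDerivWithinAt l l' J s) (hl0 : l s = 0) (hX : HasDerivWithinAt X (0, e) J s) :
    HasDerivWithinAt (fun s => push (l s) (X s)) (0, e + l' * (1 / 2 - (X s).2)) J s := by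
  have h1 : HasDerivWithinAt (fun s => (X s).1) 0 J s := hX.fst
  have h2 : HasDerivWithinAt (fun s => (X s).2) e J s := hX.snd
  have h3 := (((hl.pow 2).const_sub 1).smul h1).prodMk (h2.add (hl.mul (h2.const_sub (1 / 2))))
  refine h3.congr_deriv (Prod.ext ?_ ?_) <;> simp [hl0]

/-- Difference quotients of the height are nonnegative because the strand starts on the bottom disk
and stays in the cylinder. Hence its vertical speed cannot cancel the one contributed by the push.
-/
lemma deriv_snd_nonneg {J : Set ℝ} {X : ℝ → Space} {v : Space} {ε : ℝ} (hε : 0 < ε)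
    (hJ : Set.Ico 0 ε ⊆ J) (hX : ∀ s ∈ J, X s ∈ cylinder) (h0 : (X 0).2 = 0)
    (hd : HasDerivWithinAt X v J 0) : 0 ≤ v.2 := by
  have h2 : HasDerivWithinAt (fun s => (X s).2) v.2 (Set.Ico 0 ε) 0 := (hd.mono hJ).snd
  have h3 := hasDerivWithinAt_iff_tendsto_slope.1 h2
  have e : Set.Ico 0 ε \ {0} = Set.Ioo 0 ε := by
    ext x
    simp [lt_iff_le_and_ne, and_assoc, and_comm]
  rw [e] at h3
  have : (nhdsWithin 0 (Set.Ioo 0 ε)).NeBot := by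
    rw [nhdsWithin_Ioo_eq_nhdsGT hε]
    infer_instance
  refine ge_of_tendsto h3 (eventually_nhdsWithin_of_forall fun s hs => ?_)
  rw [slope_def_field, h0, sub_zero, sub_zero]
  exact div_nonneg (mem_cylinder_iff.1 (hX s (hJ ⟨hs.1.le, hs.2⟩))).2.1 hs.1.le

lemma deriv_snd_nonneg' {J : Set ℝ} {X : ℝ → Space} {v : Space} {ε : ℝ} (hε : ε < 1)
    (hJ : Set.Ioc ε 1 ⊆ J) (hX : ∀ s ∈ J, X s ∈ cylinder) (h1 : (X 1).2 = 1)
    (hd : HasDerivWithinAt X v J 1) : 0 ≤ v.2 := by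
  have h2 : HasDerivWithinAt (fun s => (X s).2) v.2 (Set.Ioc ε 1) 1 := (hd.mono hJ).snd
  have h3 := hasDerivWithinAt_iff_tendsto_slope.1 h2
  have e : Set.Ioc ε 1 \ {1} = Set.Ioo ε 1 := by
    ext x
    simp [lt_iff_le_and_ne, and_assoc, and_comm]
  rw [e] at h3
  have : (nhdsWithin 1 (Set.Ioo ε 1)).NeBot := by
    rw [nhdsWithin_Ioo_eq_nhdsLT hε]
    infer_instance
  refine ge_of_tendsto h3 (eventually_nhdsWithin_of_forall fun s hs => ?_)
  rw [slope_def_field, h1]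
  have := (mem_cylinder_iff.1 (hX s (hJ ⟨hs.1, hs.2.le⟩))).2.2
  exact div_nonneg_of_nonpos (by linarith) (by linarith [hs.2])

/-! ### Reparametrizations of a punctured interval -/

/-- The map of the interval that stretches its middle third over all of it. -/
def stretch (v : I) : I := Set.projIcc 0 1 zero_le_one (3 * (v : ℝ) - 1)

lemma continuous_stretch : Continuous stretch := by
  unfold stretch
  exact continuous_projIcc.comp (by fun_prop)

lemma stretch_eq_zero {v : I} (h : (v : ℝ) ≤ 1 / 3) : stretch v = 0 :=
  Set.projIcc_of_le_left _ (by linarith)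

lemma stretch_eq_one {v : I} (h : 2 / 3 ≤ (v : ℝ)) : stretch v = 1 :=
  Set.projIcc_of_right_le _ (by linarith)

lemma stretch_corner (j : Fin 2) : stretch (corner j) = corner j := by
  fin_cases j
  · exact stretch_eq_zero (by simp [corner])
  · exact stretch_eq_one (by norm_num [corner])

/-- A function on the interval with values in `[0, 1]` that vanishes at the endpoints only and
is equal to one on the middle third. -/
def bump (v : I) : ℝ := min 1 (min (3 * (v : ℝ)) (3 * (1 - v)))

lemma continuous_bump : Continuous bump := by
  unfold bump
  fun_prop

lemma bump_nonneg (v : I) : 0 ≤ bump v :=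
  le_min zero_le_one (le_min (by linarith [v.2.1]) (by linarith [v.2.2]))

lemma bump_le_one (v : I) : bump v ≤ 1 := min_le_left _ _

lemma bump_corner (j : Fin 2) : bump (corner j) = 0 := by
  fin_cases j <;> norm_num [bump, corner]

lemma bump_eq_one {v : I} (h : 1 / 3 ≤ (v : ℝ)) (h' : (v : ℝ) ≤ 2 / 3) : bump v = 1 :=
  min_eq_left (le_min (by linarith) (by linarith))

/-- Two disjoint closed subintervals `[l₀, r₀]`, `[l₁, r₁]` of the interior of the unit
interval. -/
structure Gaps where
  l₀ : ℝ
  r₀ : ℝ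
  l₁ : ℝ
  r₁ : ℝ
  l₀_pos : 0 < l₀
  l₀_lt : l₀ < r₀
  r₀_lt : r₀ < l₁
  l₁_lt : l₁ < r₁
  r₁_lt : r₁ < 1

namespace Gaps

variable (g : Gaps)

/-- The unit interval without the gaps in `S`. -/
def dom (S : Finset (Fin 2)) : Set ℝ :=
  {s | (0 ≤ s ∧ s ≤ 1) ∧ (0 ∈ S → s < g.l₀ ∨ g.r₀ < s) ∧ (1 ∈ S → s < g.l₁ ∨ g.r₁ < s)}

/-- The midpoint of the middle component. -/
def mid : ℝ := (g.r₀ + g.l₁) / 2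

lemma r₀_lt_mid : g.r₀ < g.mid := by
  have := g.r₀_lt
  unfold mid
  linarith

lemma mid_lt_l₁ : g.mid < g.l₁ := by
  have := g.r₀_lt
  unfold mid
  linarith

/-- A compact subset of `dom S`. -/
def core (S : Finset (Fin 2)) : Set ℝ :=
  {s | (0 ≤ s ∧ s ≤ 1) ∧ (0 ∈ S → s ≤ g.l₀ / 2 ∨ (g.r₀ + g.mid) / 2 ≤ s) ∧
    (1 ∈ S → s ≤ (g.l₁ + g.mid) / 2 ∨ (1 + g.r₁) / 2 ≤ s)}

lemma core_subset_dom (S : Finset (Fin 2)) : g.core S ⊆ g.dom S := by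
  have h1 := g.l₀_pos
  have h2 := g.r₀_lt_mid
  have h3 := g.mid_lt_l₁
  have h4 := g.r₁_lt
  refine fun s hs => ⟨hs.1, fun h => ?_, fun h => ?_⟩
  · rcases hs.2.1 h with h | h
    exacts [.inl (by linarith), .inr (by linarith)]
  · rcases hs.2.2 h with h | h
    exacts [.inl (by linarith), .inr (by linarith)]

lemma isCompact_core (S : Finset (Fin 2)) : IsCompact (g.core S) := by
  refine (isCompact_Icc (a := (0 : ℝ)) (b := 1)).of_isClosed_subset ?_ fun s hs => hs.1
  have imp : ∀ (p : Prop) (t : Set ℝ), IsClosed t → IsClosed {s | p → s ∈ t} := by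
    intro p t ht
    by_cases h : p <;> simp [h, ht]
  exact isClosed_Icc.inter ((imp (0 ∈ S) _ (isClosed_Iic.union isClosed_Ici)).inter
    (imp (1 ∈ S) _ (isClosed_Iic.union isClosed_Ici)))

lemma zero_mem_core (S : Finset (Fin 2)) : 0 ∈ g.core S := by
  have h1 := g.l₀_pos
  have h2 := g.r₀_lt_mid
  have h3 := g.mid_lt_l₁
  have h4 := g.l₀_lt
  exact ⟨⟨le_rfl, zero_le_one⟩, fun _ => .inl (by linarith), fun _ => .inl (by linarith)⟩

lemma zero_mem_dom (S : Finset (Fin 2)) : 0 ∈ g.dom S := g.core_subset_dom S (g.zero_mem_core S)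

lemma one_mem_dom (S : Finset (Fin 2)) : 1 ∈ g.dom S := by
  have h1 := g.r₁_lt
  have h2 := g.l₁_lt
  have h3 := g.r₀_lt
  exact ⟨⟨zero_le_one, le_rfl⟩, fun _ => .inr (by linarith), fun _ => .inr (by linarith)⟩

lemma Ico_subset_dom (S : Finset (Fin 2)) : Set.Ico 0 g.l₀ ⊆ g.dom S := by
  have h1 := g.r₁_lt
  have h2 := g.l₁_lt
  have h3 := g.r₀_lt
  have h4 := g.l₀_lt
  exact fun s hs => ⟨⟨hs.1, by linarith [hs.2]⟩, fun _ => .inl hs.2, fun _ => .inl (by linarith [hs.2])⟩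

lemma Ioc_subset_dom (S : Finset (Fin 2)) : Set.Ioc g.r₁ 1 ⊆ g.dom S := by
  have h0 := g.l₀_pos
  have h2 := g.l₁_lt
  have h3 := g.r₀_lt
  have h4 := g.l₀_lt
  exact fun s hs => ⟨⟨by linarith [hs.1], hs.2⟩, fun _ => .inr (by linarith [hs.1]), fun _ => .inr hs.1⟩

/-! ### Smooth transitions over the gaps and the contraction of components -/

/-- A smooth function that increases from zero to one over the first gap. -/
def step₀ (s : ℝ) : ℝ := Real.smoothTransition ((s - g.l₀) / (g.r₀ - g.l₀))

/-- A smooth function that increases from zero to one over the second gap. -/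
def step₁ (s : ℝ) : ℝ := Real.smoothTransition ((s - g.l₁) / (g.r₁ - g.l₁))

lemma contDiff_step₀ : ContDiff ℝ ∞ g.step₀ :=
  Real.smoothTransition.contDiff.comp ((contDiff_id.sub contDiff_const).div_const _)

lemma contDiff_step₁ : ContDiff ℝ ∞ g.step₁ :=
  Real.smoothTransition.contDiff.comp ((contDiff_id.sub contDiff_const).div_const _)

variable {g} {s : ℝ}

lemma step₀_eq_zero (h : s ≤ g.l₀) : g.step₀ s = 0 :=
  Real.smoothTransition.zero_of_nonpos
    (div_nonpos_of_nonpos_of_nonneg (by linarith) (by linarith [g.l₀_lt]))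

lemma step₁_eq_zero (h : s ≤ g.l₁) : g.step₁ s = 0 :=
  Real.smoothTransition.zero_of_nonpos
    (div_nonpos_of_nonpos_of_nonneg (by linarith) (by linarith [g.l₁_lt]))

lemma step₀_eq_one (h : g.r₀ ≤ s) : g.step₀ s = 1 :=
  Real.smoothTransition.one_of_one_le
    ((one_le_div (by linarith [g.l₀_lt])).2 (by linarith))

lemma step₁_eq_one (h : g.r₁ ≤ s) : g.step₁ s = 1 :=
  Real.smoothTransition.one_of_one_le
    ((one_le_div (by linarith [g.l₁_lt])).2 (by linarith))

variable (g)

/-- A smooth window function for the middle component. -/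
def window (s : ℝ) : ℝ := g.step₀ s * (1 - g.step₁ s)

lemma contDiff_window : ContDiff ℝ ∞ g.window :=
  g.contDiff_step₀.mul (contDiff_const.sub g.contDiff_step₁)

lemma window_nonneg (s : ℝ) : 0 ≤ g.window s :=
  mul_nonneg (Real.smoothTransition.nonneg _) (sub_nonneg.2 (Real.smoothTransition.le_one _))

lemma window_le_one (s : ℝ) : g.window s ≤ 1 :=
  mul_le_one₀ (Real.smoothTransition.le_one _) (sub_nonneg.2 (Real.smoothTransition.le_one _))
    (sub_le_self _ (Real.smoothTransition.nonneg _))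

/-- The path in the interval along which the base point of the middle component moves: from the
bottom to the middle, where it rests, and then to the top. -/
def path (v : I) : ℝ := g.mid * min 1 (3 * (v : ℝ)) + (1 - g.mid) * max 0 (3 * (v : ℝ) - 2)

lemma continuous_path : Continuous g.path := by
  unfold path
  fun_prop

lemma mid_pos : 0 < g.mid := by linarith [g.r₀_lt_mid, g.l₀_pos, g.l₀_lt]

lemma mid_lt_one : g.mid < 1 := by linarith [g.mid_lt_l₁, g.l₁_lt, g.r₁_lt]

variable {g} in
lemma path_le_mid {v : I} (h : (v : ℝ) ≤ 2 / 3) : g.path v ≤ g.mid := by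
  rw [path, max_eq_left (by linarith)]
  nlinarith [min_le_left 1 (3 * (v : ℝ)), g.mid_pos]

variable {g} in
lemma mid_le_path {v : I} (h : 1 / 3 ≤ (v : ℝ)) : g.mid ≤ g.path v := by
  rw [path, min_eq_left (by linarith)]
  nlinarith [le_max_left 0 (3 * (v : ℝ) - 2), g.mid_lt_one]

lemma path_mem (v : I) : 0 ≤ g.path v ∧ g.path v ≤ 1 := by
  have h1 := v.2.1
  have h2 := v.2.2
  have h3 := g.mid_pos
  have h4 := g.mid_lt_one
  rcases le_total (v : ℝ) (2 / 3) with h | h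
  · refine ⟨?_, (path_le_mid h).trans h4.le⟩
    have : (0 : ℝ) ≤ min 1 (3 * (v : ℝ)) := le_min zero_le_one (by linarith)
    exact add_nonneg (mul_nonneg h3.le this) (mul_nonneg (by linarith) (le_max_left _ _))
  · refine ⟨h3.le.trans (mid_le_path (by linarith)), ?_⟩
    rw [path, min_eq_left (by linarith), max_eq_right (by linarith)]
    nlinarith

lemma path_corner (j : Fin 2) : g.path (corner j) = (corner j : ℝ) := by
  fin_cases j <;> norm_num [path, corner]

/-- The base point of the component of `s`. -/
def base (v : I) (s : ℝ) : ℝ := g.window s * g.path v + g.step₁ s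

/-- The parameter of the base point of the component of `s`. -/
def slot (v : I) (s : ℝ) : ℝ := g.window s * v + g.step₁ s

/-- The contraction of the components to their base points. -/
def contract (τ : ℝ) (v : I) (s : ℝ) : ℝ := (1 - τ) * s + τ * g.base v s

/-- The amount by which strands are pushed into the interior of the cylinder. -/
def amount (v : I) (s : ℝ) : ℝ := s * (1 - s) + bump v * (1 - s * (1 - s)) * g.window s

@[simp] lemma contract_zero (v : I) (s : ℝ) : g.contract 0 v s = s := by simp [contract]

@[simp] lemma contract_one (v : I) (s : ℝ) : g.contract 1 v s = g.base v s := by simp [contract]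

lemma slot_mem (v : I) (s : ℝ) : 0 ≤ g.slot v s ∧ g.slot v s ≤ 1 := by
  have h0 : 0 ≤ g.step₀ s := Real.smoothTransition.nonneg _
  have h1 : 0 ≤ g.step₁ s := Real.smoothTransition.nonneg _
  have h0' : g.step₀ s ≤ 1 := Real.smoothTransition.le_one _
  have h1' : g.step₁ s ≤ 1 := Real.smoothTransition.le_one _
  have hw := g.window_nonneg s
  have hw' : g.window s ≤ 1 - g.step₁ s := by
    unfold window
    nlinarith
  unfold slot
  constructor <;> nlinarith [v.2.1, v.2.2, mul_nonneg hw v.2.1]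

lemma amount_mem (v : I) (h0 : 0 ≤ s) (h1 : s ≤ 1) : 0 ≤ g.amount v s ∧ g.amount v s ≤ 1 := by
  have h2 : 0 ≤ bump v * g.window s := mul_nonneg (bump_nonneg v) (g.window_nonneg s)
  have h3 : bump v * g.window s ≤ 1 := mul_le_one₀ (bump_le_one v) (g.window_nonneg s)
    (g.window_le_one s)
  have h4 : 0 ≤ s * (1 - s) := mul_nonneg h0 (by linarith)
  have h5 : s * (1 - s) ≤ 1 := by nlinarith
  unfold amount
  constructor <;> nlinarith

lemma amount_pos (v : I) (h0 : 0 < s) (h1 : s < 1) : 0 < g.amount v s := by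
  have h2 : 0 ≤ bump v * g.window s := mul_nonneg (bump_nonneg v) (g.window_nonneg s)
  have h4 : 0 < s * (1 - s) := mul_pos h0 (by linarith)
  have h5 : s * (1 - s) ≤ 1 := by nlinarith
  unfold amount
  nlinarith

variable {g} {S : Finset (Fin 2)} {u v : I}

/-- A gap that is kept in the domain forces both parameters to its endpoint. At `0` the window drops
out of `base` and `slot`, so the bottom values persist across the first gap; at `1` the window and
the second step add up so that the top values persist across the second. As `bump` vanishes at both
endpoints, `amount` shows no trace of the middle component there either. -/
lemma dom_trichotomy (hu : ∀ j ∉ S, u = corner j) (hv : ∀ j ∉ S, v = corner j)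
    (hs : s ∈ g.dom S) :
    (s < g.l₁ ∧ (0 ∈ S → s < g.l₀) ∧ g.base v s = 0 ∧ g.slot v s = 0 ∧
      g.amount u s = s * (1 - s)) ∨
    (g.r₀ < s ∧ (1 ∈ S → g.r₁ < s) ∧ g.base v s = 1 ∧ g.slot v s = 1 ∧
      g.amount u s = s * (1 - s)) ∨
    (g.r₀ < s ∧ s < g.l₁ ∧ g.base v s = g.path v ∧ g.slot v s = v ∧
      g.amount u s = s * (1 - s) + bump u * (1 - s * (1 - s))) := by
  have h1 := g.l₀_lt
  have h2 := g.r₀_lt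
  have h3 := g.l₁_lt
  rcases lt_or_ge s g.l₀ with h | h
  · left
    have e0 := step₀_eq_zero h.le
    have e1 : g.step₁ s = 0 := step₁_eq_zero (by linarith)
    simp [base, slot, amount, window, e0, e1, h, show s < g.l₁ by linarith]
  rcases lt_or_ge g.r₁ s with h' | h'
  · right; left
    have e0 : g.step₀ s = 1 := step₀_eq_one (by linarith)
    have e1 := step₁_eq_one h'.le
    simp [base, slot, amount, window, e0, e1, h', show g.r₀ < s by linarith]
  rcases le_or_gt s g.r₀ with h4 | h4
  · left
    have h0 : 0 ∉ S := fun h0 => by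
      rcases hs.2.1 h0 with h5 | h5 <;> linarith
    have e1 : g.step₁ s = 0 := step₁_eq_zero (by linarith)
    have ep := g.path_corner 0
    have eb := bump_corner 0
    rw [hu 0 h0, hv 0 h0]
    refine ⟨by linarith, fun h5 => absurd h5 h0, ?_, ?_, ?_⟩
    · rw [base, ep, e1]; simp [corner]
    · rw [slot, e1]; simp [corner]
    · rw [amount, eb]; simp
  rcases le_or_gt g.l₁ s with h5 | h5
  · right; left
    have h0 : 1 ∉ S := fun h0 => by
      rcases hs.2.2 h0 with h5 | h5 <;> linarith
    have e0 : g.step₀ s = 1 := step₀_eq_one (by linarith)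
    have ep := g.path_corner 1
    have eb := bump_corner 1
    rw [hu 1 h0, hv 1 h0]
    refine ⟨by linarith, fun h5 => absurd h5 h0, ?_, ?_, ?_⟩
    · rw [base, window, ep, e0]; simp [corner]
    · rw [slot, window, e0]; simp [corner]
    · rw [amount, eb]; simp
  · right; right
    have e0 : g.step₀ s = 1 := step₀_eq_one h4.le
    have e1 : g.step₁ s = 0 := step₁_eq_zero h5.le
    simp [base, slot, amount, window, e0, e1, h4, h5]

/-- The smooth transitions happen over the gaps only. Over a gap that is not removed, `v` is an
endpoint, and then `slot` is `0` up to `l₁` or `1` beyond `r₀`. -/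
lemma slot_locally_constant (hv : ∀ j ∉ S, v = corner j) (hs : s ∈ g.dom S) :
    ∀ᶠ s' in nhdsWithin s (g.dom S), g.slot v s' = g.slot v s := by
  have h1 := g.l₀_lt
  have h2 := g.r₀_lt
  have h3 := g.l₁_lt
  suffices ∃ U : Set ℝ, IsOpen U ∧ s ∈ U ∧ ∃ r, ∀ s' ∈ U, g.slot v s' = r by
    obtain ⟨U, hU, hsU, r, hr⟩ := this
    filter_upwards [mem_nhdsWithin_of_mem_nhds (hU.mem_nhds hsU)] with s' hs'
    rw [hr s' hs', hr s hsU]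
  rcases lt_or_ge s g.l₀ with h | h
  · refine ⟨_, isOpen_Iio, h, 0, fun s' (hs' : s' < _) => ?_⟩
    simp [slot, window, step₀_eq_zero hs'.le, step₁_eq_zero (show s' ≤ g.l₁ by linarith)]
  rcases lt_or_ge g.r₁ s with h' | h'
  · refine ⟨_, isOpen_Ioi, h', 1, fun s' (hs' : _ < s') => ?_⟩
    simp [slot, window, step₁_eq_one hs'.le]
  rcases le_or_gt s g.r₀ with h4 | h4
  · have h0 : 0 ∉ S := fun h0 => by
      rcases hs.2.1 h0 with h5 | h5 <;> linarith
    refine ⟨_, isOpen_Iio, (show s < g.l₁ by linarith), 0, fun s' (hs' : s' < _) => ?_⟩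
    rw [hv 0 h0]
    simp [slot, corner, step₁_eq_zero hs'.le]
  rcases le_or_gt g.l₁ s with h5 | h5
  · have h0 : 1 ∉ S := fun h0 => by
      rcases hs.2.2 h0 with h5 | h5 <;> linarith
    refine ⟨_, isOpen_Ioi, h4, 1, fun s' (hs' : _ < s') => ?_⟩
    rw [hv 1 h0]
    simp [slot, corner, window, step₀_eq_one hs'.le]
  · refine ⟨_, isOpen_Ioo, ⟨h4, h5⟩, v, fun s' hs' => ?_⟩
    simp [slot, window, step₀_eq_one hs'.1.le, step₁_eq_zero hs'.2.le]

lemma base_mem (hv : ∀ j ∉ S, v = corner j) (hs : s ∈ g.dom S) :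
    0 ≤ g.base v s ∧ g.base v s ≤ 1 := by
  rcases dom_trichotomy hv hv hs with h | h | h
  · rw [h.2.2.1]; norm_num
  · rw [h.2.2.1]; norm_num
  · rw [h.2.2.1]; exact g.path_mem v

lemma contract_mem_Icc (hv : ∀ j ∉ S, v = corner j) (hs : s ∈ g.dom S) {τ : ℝ} (h0 : 0 ≤ τ)
    (h1 : τ ≤ 1) : 0 ≤ g.contract τ v s ∧ g.contract τ v s ≤ 1 := by
  have hb := base_mem hv hs
  have hs' := hs.1
  unfold contract
  constructor <;> nlinarith

variable {S' : Finset (Fin 2)}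

/-- The contraction moves points along segments to base points in the same component. Here `S`
describes the domain at `v`, and `S'` the domain in which the strand is evaluated, after one more
stretching of `v`; the conditions on `S'` keep the moving base point clear of the gaps in `S'`. -/
lemma contract_mem_dom (hv : ∀ j ∉ S, v = corner j) (hs : s ∈ g.dom S) {τ : ℝ} (h0 : 0 ≤ τ)
    (h1 : τ ≤ 1) (hS₀ : 0 ∈ S' → 1 / 3 ≤ (v : ℝ)) (hS₁ : 1 ∈ S' → (v : ℝ) ≤ 2 / 3) :
    g.contract τ v s ∈ g.dom S' := by
  have e1 := g.l₀_pos
  have e2 := g.r₀_lt_mid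
  have e3 := g.mid_lt_l₁
  have e4 := g.r₁_lt
  refine ⟨contract_mem_Icc hv hs h0 h1, fun h => ?_, fun h => ?_⟩
  -- Otherwise `v` would be `0`, contrary to `1 / 3 ≤ v`; so the gap avoided in the target is
  -- already removed from the source.
  · have hS : 0 ∈ S := by
      by_contra hn
      have h2 := hS₀ h
      rw [hv 0 hn] at h2
      norm_num [corner] at h2
    have hp := mid_le_path (g := g) (hS₀ h)
    have key : ∀ b, g.r₀ < b → g.r₀ < s → g.r₀ < (1 - τ) * s + τ * b := fun b hb hs => by
      rcases h1.lt_or_eq with h1 | h1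
      · nlinarith
      · subst h1; linarith
    rcases dom_trichotomy hv hv hs with h3 | h3 | h3
    · left
      rw [contract, h3.2.2.1]
      have := h3.2.1 hS
      nlinarith [hs.1.1]
    · right
      rw [contract, h3.2.2.1]
      exact key _ (by linarith [g.l₁_lt]) h3.1
    · right
      rw [contract, h3.2.2.1]
      exact key _ (by linarith) h3.1
  · have hS : 1 ∈ S := by
      by_contra hn
      have h2 := hS₁ h
      rw [hv 1 hn] at h2
      norm_num [corner] at h2
    have hp := path_le_mid (g := g) (hS₁ h)
    have key : ∀ b, b < g.l₁ → s < g.l₁ → (1 - τ) * s + τ * b < g.l₁ := fun b hb hs => by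
      rcases h1.lt_or_eq with h1 | h1
      · nlinarith
      · subst h1; linarith
    rcases dom_trichotomy hv hv hs with h3 | h3 | h3
    · left
      rw [contract, h3.2.2.1]
      exact key _ (by linarith [g.l₀_lt]) h3.1
    · right
      rw [contract, h3.2.2.1]
      have := h3.2.1 hS
      nlinarith [hs.1.2]
    · left
      rw [contract, h3.2.2.1]
      exact key _ (by linarith) h3.2.1

/-- After half of the contraction every point is at least halfway between its original position and
its base point, which keeps it a definite distance away from the gaps in `S'`. The bounds defining
`core` are these halfway points. -/
lemma contract_mem_core (hv : ∀ j ∉ S, v = corner j) (hs : s ∈ g.dom S) {τ : ℝ} (h0 : 1 / 2 ≤ τ)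
    (h1 : τ ≤ 1) (hS₀ : 0 ∈ S' → 1 / 3 ≤ (v : ℝ)) (hS₁ : 1 ∈ S' → (v : ℝ) ≤ 2 / 3) :
    g.contract τ v s ∈ g.core S' := by
  have e1 := g.l₀_pos
  have e2 := g.r₀_lt_mid
  have e3 := g.mid_lt_l₁
  have e4 := g.r₁_lt
  have e5 := g.l₀_lt
  have e6 := g.l₁_lt
  refine ⟨contract_mem_Icc hv hs (by linarith) h1, fun h => ?_, fun h => ?_⟩
  · have hS : 0 ∈ S := by
      by_contra hn
      have h2 := hS₀ h
      rw [hv 0 hn] at h2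
      norm_num [corner] at h2
    have hp := mid_le_path (g := g) (hS₀ h)
    have key : ∀ b, g.mid ≤ b → g.r₀ < s → (g.r₀ + g.mid) / 2 ≤ (1 - τ) * s + τ * b :=
      fun b hb hs => by nlinarith
    rcases dom_trichotomy hv hv hs with h3 | h3 | h3
    · left
      rw [contract, h3.2.2.1]
      have := h3.2.1 hS
      nlinarith [hs.1.1]
    · right
      rw [contract, h3.2.2.1]
      exact key _ (by linarith) h3.1
    · right
      rw [contract, h3.2.2.1]
      exact key _ hp h3.1
  · have hS : 1 ∈ S := by
      by_contra hn
      have h2 := hS₁ h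
      rw [hv 1 hn] at h2
      norm_num [corner] at h2
    have hp := path_le_mid (g := g) (hS₁ h)
    have key : ∀ b, b ≤ g.mid → s < g.l₁ → (1 - τ) * s + τ * b ≤ (g.l₁ + g.mid) / 2 :=
      fun b hb hs => by nlinarith
    rcases dom_trichotomy hv hv hs with h3 | h3 | h3
    · left
      rw [contract, h3.2.2.1]
      exact key _ (by linarith) h3.1
    · right
      rw [contract, h3.2.2.1]
      have := h3.2.1 hS
      nlinarith [hs.1.2]
    · left
      rw [contract, h3.2.2.1]
      exact key _ hp h3.2.1

lemma mid_mem_dom : g.mid ∈ g.dom S := by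
  have h1 := g.r₀_lt_mid
  have h2 := g.mid_lt_l₁
  exact ⟨⟨g.mid_pos.le, g.mid_lt_one.le⟩, fun _ => .inr h1, fun _ => .inl h2⟩

lemma path_mem_dom (hS₀ : 0 ∈ S' → 1 / 3 ≤ (v : ℝ)) (hS₁ : 1 ∈ S' → (v : ℝ) ≤ 2 / 3) :
    g.path v ∈ g.dom S' := by
  -- With both gaps removed, the complete contraction sends the midpoint of the middle component to
  -- `path v`.
  have h := contract_mem_dom (S := Finset.univ) (v := v) (τ := 1) (by simp) g.mid_mem_dom
    zero_le_one le_rfl hS₀ hS₁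
  rcases dom_trichotomy (u := v) (v := v) (S := Finset.univ) (by simp) (by simp) g.mid_mem_dom
    with h3 | h3 | h3
  · have := h3.2.1 (by simp)
    linarith [g.r₀_lt_mid, g.l₀_lt]
  · have := h3.2.1 (by simp)
    linarith [g.mid_lt_l₁, g.l₁_lt]
  · rwa [contract_one, h3.2.2.1] at h

end Gaps

/-! ### Points and maps of the first stage of the Taylor tower -/

lemma SmoothFamily.of_subtype {Z E : Type*} [TopologicalSpace Z] [NormedAddCommGroup E]
    [NormedSpace ℝ E] {J : Set ℝ} (hJ : UniqueDiffOn ℝ J) {Ω : Set Z} {F : Z → ℝ → E}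
    (h : SmoothFamily J Set.univ (fun z : Ω => F z)) : SmoothFamily J Ω F := by
  rw [smoothFamily_iff hJ] at h ⊢
  refine ⟨fun z hz => h.1 ⟨z, hz⟩ trivial, fun k => ?_⟩
  rw [continuousOn_iff_continuous_domRestrict]
  exact (h.2 k).comp_continuous
    (f := fun x : (Ω ×ˢ J : Set (Z × ℝ)) => ((⟨x.1.1, x.2.1⟩ : Ω), x.1.2)) (by fun_prop)
    fun x => ⟨trivial, x.2.2⟩

variable {n : ℕ}

/-- The two gaps of the `i`-th strand. -/
def Punctures.gaps (A : Punctures (fun _ : Fin n => 1)) (i : Fin n) : Gaps where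
  l₀ := A.left i 0
  r₀ := A.right i 0
  l₁ := A.left i 1
  r₁ := A.right i 1
  l₀_pos := A.left_pos i 0
  l₀_lt := A.left_lt_right i 0
  r₀_lt := A.increasing i 0 1 (by decide)
  l₁_lt := A.left_lt_right i 1
  r₁_lt := A.right_lt_one i 1

lemma Punctures.domain_eq (A : Punctures (fun _ : Fin n => 1)) (c : Idx n) (i : Fin n) :
    A.domain c i = (A.gaps i).dom (c i).1 := by
  ext s
  simp only [Punctures.domain, Set.mem_sdiff, Set.mem_iUnion, not_exists, Set.mem_Icc, not_and,
    not_le, Gaps.dom, Set.mem_ofPred_eq, gaps]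
  refine and_congr_right fun _ => ⟨fun h => ⟨fun h0 => ?_, fun h0 => ?_⟩, fun h j hj hl => ?_⟩
  · exact (lt_or_ge s _).imp_right (h 0 h0)
  · exact (lt_or_ge s _).imp_right (h 1 h0)
  · have hj2 : ∀ j : Fin 2, j = 0 ∨ j = 1 := by decide
    rcases hj2 j with rfl | rfl
    · exact (h.1 hj).resolve_left hl.not_gt
    · exact (h.2 hj).resolve_left hl.not_gt

lemma Punctures.domain_eq_inter {m : Fin n → ℕ} (A : Punctures m) (c : PunctureIndex m)
    (i : Fin n) : ∃ U : Set ℝ, IsOpen U ∧ A.domain c i = Set.Icc 0 1 ∩ U :=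
  ⟨_, (Set.Finite.isClosed_biUnion (c i).1.finite_toSet fun _ _ => isClosed_Icc).isOpen_compl, rfl⟩

lemma Punctures.uniqueDiffOn {m : Fin n → ℕ} (A : Punctures m) (c : PunctureIndex m)
    (i : Fin n) : UniqueDiffOn ℝ (A.domain c i) := by
  obtain ⟨U, hU, e⟩ := A.domain_eq_inter c i
  exact e ▸ (uniqueDiffOn_Icc zero_lt_one).inter hU

instance {m : Fin n → ℕ} (A : Punctures m) (c : PunctureIndex m) (i : Fin n) :
    LocallyCompactSpace (A.domain c i) := by
  obtain ⟨U, hU, e⟩ := A.domain_eq_inter c i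
  exact IsLocallyClosed.locallyCompactSpace
    (e ▸ isClosed_Icc.isLocallyClosed.inter hU.isLocallyClosed)

variable {β : BoundaryBehavior} {a : Fin n → EuclideanSpace ℝ (Fin 2)}
  {A : Punctures (fun _ : Fin n => 1)}

/-- The link map at a point of the realization over `c`. -/
def TaylorStage.link (φ : TaylorStage β a A) (c : Idx n) (w : realizationOver c) :
    LinkMapSpace β a (A.domain c) := φ.1 c w

lemma TaylorStage.link_inclusion (φ : TaylorStage β a A) {c d : Idx n} (h : c ≤ d)
    (w : realizationOver c) :
    φ.link d (Set.inclusion (realizationOver_mono h) w) =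
      LinkMapSpace.restrict (A.isOpenSub h) (φ.link c w) := φ.2 c d h w

lemma TaylorStage.ext {φ ψ : TaylorStage β a A} (h : ∀ c w i s,
    (φ.link c w).1 i s = (ψ.link c w).1 i s) : φ = ψ :=
  Subtype.ext (funext fun c => ContinuousMap.ext fun w =>
    Subtype.ext (funext fun i => funext fun s => h c w i s))

lemma TaylorStage.continuous_link (c : Idx n) :
    Continuous fun z : TaylorStage β a A × realizationOver c => z.1.link c z.2 := by
  have h1 : Continuous fun φ : TaylorStage β a A => φ.1 c :=
    (continuous_apply c).comp continuous_subtype_val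
  exact continuous_eval.comp (h1.prodMap continuous_id)

/-- The strands of a point of the first stage, as functions on the cube and the line. -/
def TaylorStage.eval (φ : TaylorStage β a A) (u : Fin n → I) (i : Fin n) : ℝ → Space :=
  extendZero ((φ.link (carrier u) ⟨bary u, bary_mem_over le_rfl⟩).1 i)

lemma TaylorStage.eval_eq (φ : TaylorStage β a A) {u : Fin n → I} {c : Idx n}
    (h : carrier u ≤ c) (i : Fin n) (s : A.domain c i) :
    φ.eval u i s = (φ.link c ⟨bary u, bary_mem_over h⟩).1 i s := by
  have := φ.link_inclusion h ⟨bary u, bary_mem_over le_rfl⟩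
  have e := congrFun (congrFun (congrArg Subtype.val this) i) s
  exact (extendZero_apply _ (⟨s, (A.isOpenSub h).subset i s.2⟩ : A.domain (carrier u) i)).trans
    e.symm

/-- The carrier used in `eval` jumps, but over the face of `c` all values are restrictions to be
read off from the single continuous family of link maps over `c`. -/
lemma TaylorStage.smoothFamily_eval (c : Idx n) (i : Fin n) :
    SmoothFamily (A.domain c i) {z : TaylorStage β a A × (Fin n → I) | carrier z.2 ≤ c}
      (fun z => z.1.eval z.2 i) := by
  refine SmoothFamily.of_subtype (A.uniqueDiffOn c i) ?_
  have hc : Continuous fun z : {z : TaylorStage β a A × (Fin n → I) | carrier z.2 ≤ c} =>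
      z.1.1.link c ⟨bary z.1.2, bary_mem_over z.2⟩ := by
    refine (continuous_link c).comp (f := fun z : {z : TaylorStage β a A × (Fin n → I) |
      carrier z.2 ≤ c} => (z.1.1, (⟨bary z.1.2, bary_mem_over z.2⟩ : realizationOver c))) ?_
    exact (continuous_fst.comp continuous_subtype_val).prodMk
      ((continuous_bary.comp (continuous_snd.comp continuous_subtype_val)).subtype_mk _)
  refine ((LinkMapSpace.smoothFamily_eval i (A.uniqueDiffOn c i)).comp_param
    (g := fun z : {z : TaylorStage β a A × (Fin n → I) | carrier z.2 ≤ c} =>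
      z.1.1.link c ⟨bary z.1.2, bary_mem_over z.2⟩) hc.continuousOn
    fun _ _ => trivial).congr fun z _ s hs => ?_
  rw [z.1.1.eval_eq z.2 i ⟨s, hs⟩, extendZero_apply _ (⟨s, hs⟩ : A.domain c i)]

/-- The continuous map to the first stage of the Taylor tower that is given by a family of strands
parametrized by the cube. -/
def taylorMap {Y : Type*} [TopologicalSpace Y] (G : Y → (Fin n → I) → Fin n → ℝ → Space)
    (hL : ∀ y u c, carrier u ≤ c → IsLinkMap β a (A.domain c) (fun i s => G y u i s))
    (hG : ∀ c i, SmoothFamily (A.domain c i) {z : Y × (Fin n → I) | carrier z.2 ≤ c}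
      (fun z => G z.1 z.2 i)) : C(Y, TaylorStage β a A) :=
  let L (c : Idx n) (z : Y × realizationOver c) : LinkMapSpace β a (A.domain c) :=
    ⟨fun i s => G z.1 (coord z.2) i s, hL z.1 (coord z.2) c (carrier_coord_le z.2.2)⟩
  have hL' (c : Idx n) : Continuous (L c) := by
    have hg : Continuous fun z : Y × realizationOver c => (z.1, coord (z.2 : Idx n → ℝ)) :=
      continuous_fst.prodMk (continuous_coord.comp (continuous_subtype_val.comp continuous_snd))
    refine LinkMapSpace.continuous_of_smoothFamily
      (G := fun z i => G z.1 (coord (z.2 : Idx n → ℝ)) i) (A.uniqueDiffOn c)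
      (fun _ _ _ => rfl) fun i => ?_
    exact (hG c i).comp_param hg.continuousOn fun z _ => carrier_coord_le z.2.2
  { toFun := fun y => ⟨fun c => (⟨fun w => L c (y, w), (hL' c).comp (by fun_prop)⟩ :
        C(realizationOver c, LinkMapSpace β a (A.domain c))), fun _ _ _ _ => rfl⟩
    continuous_toFun := by
      refine Continuous.subtype_mk (continuous_pi fun c => ?_) _
      exact (ContinuousMap.curry
        (⟨L c, hL' c⟩ : C(Y × realizationOver c, LinkMapSpace β a (A.domain c)))).continuous }

/-- A point of the tower is determined by its family over the cube. Only `bary ∘ coord = id` on the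
realization is needed for this. -/
lemma TaylorStage.eval_coord (φ : TaylorStage β a A) (c : Idx n) (w : realizationOver c)
    (i : Fin n) (s : A.domain c i) : φ.eval (coord w) i s = (φ.link c w).1 i s := by
  rw [φ.eval_eq (carrier_coord_le w.2)]
  exact congrArg (fun w' => (φ.link c w').1 i s) (Subtype.ext (bary_coord w.2.1))

lemma TaylorStage.isLinkMap_eval (φ : TaylorStage β a A) {u : Fin n → I} {c : Idx n}
    (h : carrier u ≤ c) : IsLinkMap β a (A.domain c) (fun i s => φ.eval u i s) := by
  have : (fun i (s : A.domain c i) => φ.eval u i s) =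
      (φ.link c ⟨bary u, bary_mem_over h⟩).1 := by
    funext i s
    exact φ.eval_eq h i s
  rw [this]
  exact (φ.link c _).2

/-! ### Families of strands pushed into the interior -/

lemma Gaps.hasDerivAt_amount_zero (g : Gaps) (v : I) : HasDerivAt (g.amount v) 1 0 := by
  have h : HasDerivAt (fun s : ℝ => s * (1 - s)) (1 * (1 - 0) + 0 * (-1)) 0 :=
    (hasDerivAt_id (0 : ℝ)).mul ((hasDerivAt_id (0 : ℝ)).const_sub 1)
  refine (h.congr_deriv (by norm_num)).congr_of_eventuallyEq ?_
  filter_upwards [isOpen_Iio.mem_nhds (show (0 : ℝ) ∈ Set.Iio g.l₀ from g.l₀_pos)] with s hs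
  simp [amount, window, step₀_eq_zero (le_of_lt hs)]

lemma Gaps.hasDerivAt_amount_one (g : Gaps) (v : I) : HasDerivAt (g.amount v) (-1) 1 := by
  have h : HasDerivAt (fun s : ℝ => s * (1 - s)) (1 * (1 - 1) + 1 * (-1)) 1 :=
    (hasDerivAt_id (1 : ℝ)).mul ((hasDerivAt_id (1 : ℝ)).const_sub 1)
  refine (h.congr_deriv (by norm_num)).congr_of_eventuallyEq ?_
  filter_upwards [isOpen_Ioi.mem_nhds (show (1 : ℝ) ∈ Set.Ioi g.r₁ from g.r₁_lt)] with s hs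
  simp [amount, window, step₁_eq_one (le_of_lt hs)]

lemma Gaps.amount_zero (g : Gaps) (v : I) : g.amount v 0 = 0 := by
  simp [amount, window, step₀_eq_zero g.l₀_pos.le]

lemma Gaps.amount_one (g : Gaps) (v : I) : g.amount v 1 = 0 := by
  simp [amount, window, step₁_eq_one g.r₁_lt.le]

lemma Gaps.smoothFamily_amount (g : Gaps) {Z : Type*} [TopologicalSpace Z] {J : Set ℝ}
    {Ω : Set Z} {f : Z → I} (hf : Continuous f) :
    SmoothFamily J Ω (fun z s => g.amount (f z) s) := by
  have h1 : SmoothFamily J Ω (fun (_ : Z) (s : ℝ) => s * (1 - s)) :=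
    .of_contDiff (contDiff_id.mul (contDiff_const.sub contDiff_id))
  have h2 : SmoothFamily J Ω (fun (_ : Z) (s : ℝ) => (1 - s * (1 - s)) * g.window s) :=
    .of_contDiff ((contDiff_const.sub (contDiff_id.mul (contDiff_const.sub contDiff_id))).mul
      g.contDiff_window)
  refine (h1.add (SmoothFamily.mul (.of_param (continuous_bump.comp hf).continuousOn) h2)).congr
    fun z _ s _ => ?_
  simp only [amount, mul_assoc, Function.comp]

/-- A continuous family, parametrized by `Y`, of families of strands parametrized by the cube that
become link maps after being pushed into the interior of the cylinder. -/
structure PushFamily (β : BoundaryBehavior) (a : Fin n → EuclideanSpace ℝ (Fin 2))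
    (A : Punctures (fun _ : Fin n => 1)) (Y : Type*) [TopologicalSpace Y] where
  scale : Y → ℝ
  continuous_scale : Continuous scale
  scale_nonneg : ∀ y, 0 ≤ scale y
  scale_lt_one : ∀ y, scale y < 1
  strand : Y → (Fin n → I) → Fin n → ℝ → Space
  smooth : ∀ c i, SmoothFamily (A.domain c i) {z : Y × (Fin n → I) | carrier z.2 ≤ c}
    (fun z => strand z.1 z.2 i)
  mem_cylinder : ∀ y u c, carrier u ≤ c → ∀ i, ∀ s ∈ A.domain c i, strand y u i s ∈ cylinder
  bottom : ∀ y u i, strand y u i 0 = (a i, 0)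
  top : ∀ y u i, strand y u i 1 = (a i, 1)
  disjoint : ∀ y u c, carrier u ≤ c → ∀ i j, i ≠ j → ∀ s ∈ A.domain c i, ∀ s' ∈ A.domain c j,
    push (scale y * (A.gaps i).amount (u i) s) (strand y u i s) ≠
      push (scale y * (A.gaps j).amount (u j) s') (strand y u j s')
  mem_interior : β = .endpointsAndSupport → ∀ y u c, carrier u ≤ c → scale y = 0 →
    ∀ i, ∀ s ∈ A.domain c i, 0 < s → s < 1 → strand y u i s ∈ interior cylinder
  hasDeriv : β = .endpointsAndSupport → ∀ y u c, carrier u ≤ c → ∀ i s, s = 0 ∨ s = 1 →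
    ∃ e, HasDerivWithinAt (strand y u i) (0, e) (A.domain c i) s ∧ (0 < scale y ∨ e ≠ 0)

namespace PushFamily

variable {Y : Type*} [TopologicalSpace Y] (D : PushFamily β a A Y)

/-- The pushed strands. -/
def pushed (y : Y) (u : Fin n → I) (i : Fin n) (s : ℝ) : Space :=
  push (D.scale y * (A.gaps i).amount (u i) s) (D.strand y u i s)

lemma scale_mul_mem (y : Y) (v : I) (i : Fin n) {s : ℝ} (h0 : 0 ≤ s) (h1 : s ≤ 1) :
    0 ≤ D.scale y * (A.gaps i).amount v s ∧ D.scale y * (A.gaps i).amount v s ≤ 1 := by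
  have h := (A.gaps i).amount_mem v h0 h1
  exact ⟨mul_nonneg (D.scale_nonneg y) h.1, mul_le_one₀ (D.scale_lt_one y).le h.1 h.2⟩

lemma smooth_pushed (c : Idx n) (i : Fin n) :
    SmoothFamily (A.domain c i) {z : Y × (Fin n → I) | carrier z.2 ≤ c}
      (fun z => D.pushed z.1 z.2 i) := by
  refine SmoothFamily.push (SmoothFamily.mul (.of_param
    (D.continuous_scale.comp continuous_fst).continuousOn)
    ((A.gaps i).smoothFamily_amount (f := fun z : Y × (Fin n → I) => z.2 i) (by fun_prop)))
    (D.smooth c i)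

/-- The fields of `PushFamily` ask for the support condition only as far as the push does not supply
it: interior values when the scale is zero, and a nonzero speed at the ends unless the scale is
positive. -/
lemma isLinkMap_pushed (y : Y) (u : Fin n → I) (c : Idx n) (h : carrier u ≤ c) :
    IsLinkMap β a (A.domain c) (fun i s => D.pushed y u i s) := by
  have hdom : ∀ (i : Fin n) (s : A.domain c i), 0 ≤ (s : ℝ) ∧ (s : ℝ) ≤ 1 := fun i s => s.2.1
  have hext : ∀ i, Set.EqOn (extendZero fun s : A.domain c i => D.pushed y u i s)
      (D.pushed y u i) (A.domain c i) := fun i s hs =>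
    extendZero_apply (fun s : A.domain c i => D.pushed y u i s) ⟨s, hs⟩
  have hmem : ∀ i, ∀ s ∈ A.domain c i, D.pushed y u i s ∈ cylinder := fun i s hs =>
    have h1 := D.scale_mul_mem y (u i) i hs.1.1 hs.1.2
    push_mem_cylinder h1.1 h1.2 (D.mem_cylinder y u c h i s hs)
  refine ⟨fun i => ?_, fun i s => hmem i s s.2, fun i x hx => ?_, fun i x hx => ?_,
    fun i j hij x x' => D.disjoint y u c h i j hij x x.2 x' x'.2, fun hβ i => ⟨fun x h0 h1 => ?_,
      fun x hx => ?_⟩⟩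
  · exact (((smoothFamily_iff (A.uniqueDiffOn c i)).1 (D.smooth_pushed c i)).1 (y, u) h).congr
      (hext i)
  · simp [pushed, hx, Gaps.amount_zero, D.bottom]
  · simp [pushed, hx, Gaps.amount_one, D.top]
  · have h2 := D.scale_mul_mem y (u i) i (hdom i x).1 (hdom i x).2
    rcases (D.scale_nonneg y).eq_or_lt with h3 | h3
    · simp only [pushed, ← h3, zero_mul, push_zero]
      exact D.mem_interior hβ y u c h h3.symm i x x.2 h0 h1
    · exact push_mem_interior (mul_pos h3 ((A.gaps i).amount_pos (u i) h0 h1)) h2.2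
        (D.mem_cylinder y u c h i x x.2)
  · obtain ⟨e, he, hpos⟩ := D.hasDeriv hβ y u c h i x hx
    rw [derivWithin_congr (hext i) (hext i x.2)]
    have hu := A.uniqueDiffOn c i x x.2
    have hsub0 : Set.Ico 0 (A.gaps i).l₀ ⊆ A.domain c i := A.domain_eq c i ▸ Gaps.Ico_subset_dom _ _
    have hsub1 : Set.Ioc (A.gaps i).r₁ 1 ⊆ A.domain c i := A.domain_eq c i ▸ Gaps.Ioc_subset_dom _ _
    rcases hx with hx | hx
    · rw [hx] at he hu ⊢
      -- The speed after pushing is `e + scale / 2`, a sum of nonnegative terms of which one is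
      -- positive.
      have he0 : 0 ≤ e := deriv_snd_nonneg (A.gaps i).l₀_pos hsub0 (D.mem_cylinder y u c h i)
        (by rw [D.bottom]) he
      have hl := (((A.gaps i).hasDerivAt_amount_zero (u i)).const_mul (D.scale y)).hasDerivWithinAt
        (s := A.domain c i)
      have hd := hasDerivWithinAt_push hl (by rw [Gaps.amount_zero, mul_zero]) he
      unfold pushed
      rw [hd.derivWithin hu, D.bottom]
      refine ⟨rfl, ne_of_gt ?_⟩
      have h4 := D.scale_nonneg y
      rcases hpos with h5 | h5
      · simp only; linarith
      · have := lt_of_le_of_ne he0 h5.symm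
        simp only; linarith
    · rw [hx] at he hu ⊢
      -- At the top the amount has derivative `-1` and the factor `1 / 2 - height` is `-1 / 2`, so
      -- the speed is again `e + scale / 2`.
      have he0 : 0 ≤ e := deriv_snd_nonneg' (A.gaps i).r₁_lt hsub1 (D.mem_cylinder y u c h i)
        (by rw [D.top]) he
      have hl := (((A.gaps i).hasDerivAt_amount_one (u i)).const_mul (D.scale y)).hasDerivWithinAt
        (s := A.domain c i)
      have hd := hasDerivWithinAt_push hl (by rw [Gaps.amount_one, mul_zero]) he
      unfold pushed
      rw [hd.derivWithin hu, D.top]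
      refine ⟨rfl, ne_of_gt ?_⟩
      have h4 := D.scale_nonneg y
      rcases hpos with h5 | h5
      · simp only; linarith
      · have := lt_of_le_of_ne he0 h5.symm
        simp only; linarith

/-- The map to the first stage of the Taylor tower given by the pushed strands. -/
def map : C(Y, TaylorStage β a A) := taylorMap D.pushed D.isLinkMap_pushed D.smooth_pushed

lemma map_link (y : Y) (c : Idx n) (w : realizationOver c) (i : Fin n) (s : A.domain c i) :
    ((D.map y).link c w).1 i s = D.pushed y (coord w) i s := rfl

lemma eval_map (y : Y) {u : Fin n → I} {c : Idx n} (h : carrier u ≤ c) (i : Fin n) {s : ℝ}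
    (hs : s ∈ A.domain c i) : (D.map y).eval u i s = D.pushed y (coord (bary u)) i s :=
  (D.map y).eval_eq h i ⟨s, hs⟩

end PushFamily

/-! ### Dropping the support condition for maps from the cube -/

/-- The space of based maps from the cube to the configuration space, without the support
condition. -/
def BasedMapSpace (a : Fin n → EuclideanSpace ℝ (Fin 2)) : Type :=
  {f : C(Fin n → I, Conf cylinder n) //
    (∀ i t, t i = 0 → (f t).1 i = (a i, 0)) ∧ (∀ i t, t i = 1 → (f t).1 i = (a i, 1))}

instance : TopologicalSpace (BasedMapSpace a) := instTopologicalSpaceSubtype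

namespace BasedMapSpace

instance : CoeFun (BasedMapSpace a) fun _ => (Fin n → I) → Fin n → Space :=
  ⟨fun f t => (f.1 t).1⟩

lemma ext {f g : BasedMapSpace a} (h : ∀ t i, f t i = g t i) : f = g :=
  Subtype.ext (ContinuousMap.ext fun t => Subtype.ext (funext fun i => h t i))

lemma continuous_eval : Continuous fun z : BasedMapSpace a × (Fin n → I) => z.1 z.2 :=
  continuous_subtype_val.comp
    (ContinuousEval.continuous_eval.comp (continuous_subtype_val.prodMap continuous_id))

lemma mem_cylinder (f : BasedMapSpace a) (t : Fin n → I) (i : Fin n) : f t i ∈ cylinder :=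
  (f.1 t).2.1 i

lemma ne (f : BasedMapSpace a) (t : Fin n → I) {i j : Fin n} (h : i ≠ j) : f t i ≠ f t j :=
  (f.1 t).2.2 i j h

lemma apply_zero (f : BasedMapSpace a) {t : Fin n → I} {i : Fin n} (h : t i = 0) :
    f t i = (a i, 0) := f.2.1 i t h

lemma apply_one (f : BasedMapSpace a) {t : Fin n → I} {i : Fin n} (h : t i = 1) :
    f t i = (a i, 1) := f.2.2 i t h

lemma snd_of_corner (f : BasedMapSpace a) {t : Fin n → I} {i : Fin n} {j : Fin 2}
    (h : t i = corner j) : (f t i).2 = 0 ∨ (f t i).2 = 1 := by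
  fin_cases j
  · exact .inl (by rw [f.apply_zero h])
  · exact .inr (by rw [f.apply_one h])

end BasedMapSpace

section

variable {Y : Type*} [TopologicalSpace Y]

/-- A continuous map to the space of maps from the cube to the configuration space. -/
def confMap (g : Y → (Fin n → I) → Fin n → Space)
    (hg : Continuous fun z : Y × (Fin n → I) => g z.1 z.2)
    (hmem : ∀ y t i, g y t i ∈ cylinder) (hne : ∀ y t i j, i ≠ j → g y t i ≠ g y t j) :
    C(Y, C(Fin n → I, Conf cylinder n)) :=
  ContinuousMap.curry ⟨fun z => (⟨g z.1 z.2, hmem z.1 z.2, hne z.1 z.2⟩ : Conf cylinder n),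
    hg.subtype_mk _⟩

/-- A continuous map to the space of based maps from the cube to the configuration space. -/
def basedMap (g : Y → (Fin n → I) → Fin n → Space)
    (hg : Continuous fun z : Y × (Fin n → I) => g z.1 z.2)
    (hmem : ∀ y t i, g y t i ∈ cylinder) (hne : ∀ y t i j, i ≠ j → g y t i ≠ g y t j)
    (h0 : ∀ y t i, t i = 0 → g y t i = (a i, 0)) (h1 : ∀ y t i, t i = 1 → g y t i = (a i, 1)) :
    C(Y, BasedMapSpace a) where
  toFun y := ⟨confMap g hg hmem hne y, (fun i t => h0 y t i), (fun i t => h1 y t i)⟩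
  continuous_toFun := Continuous.subtype_mk (confMap g hg hmem hne).continuous
    (fun y => ⟨fun i t => h0 y t i, fun i t => h1 y t i⟩)

end

lemma mem_interior_conf {x : Fin n → Space} (h : ∀ i, x i ∈ interior cylinder)
    (hx : ∀ i j, i ≠ j → x i ≠ x j) : x ∈ interior (Conf cylinder n) := by
  have ho : IsOpen {x : Fin n → Space | (∀ i, x i ∈ interior cylinder) ∧
      ∀ i j, i ≠ j → x i ≠ x j} := by
    simp only [Set.ofPred_and, Set.ofPred_forall]
    refine (isOpen_iInter_of_finite fun i => isOpen_interior.preimage (continuous_apply i)).inter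
      (isOpen_iInter_of_finite fun i => isOpen_iInter_of_finite fun j =>
        isOpen_iInter_of_finite fun _ => ?_)
    exact isOpen_ne_fun (continuous_apply i) (continuous_apply j)
  refine interior_maximal ?_ ho ⟨h, hx⟩
  exact fun y (hy : (∀ i, y i ∈ interior cylinder) ∧ _) =>
    (⟨fun i => interior_subset (hy.1 i), hy.2⟩ : y ∈ Conf cylinder n)

/-- A function on the cube that vanishes on the boundary only. -/
def depth (t : Fin n → I) : ℝ := 1 / 2 * ∏ i, (t i : ℝ) * (1 - t i)

lemma continuous_depth : Continuous (depth : (Fin n → I) → ℝ) := by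
  unfold depth
  fun_prop

lemma depth_nonneg (t : Fin n → I) : 0 ≤ depth t :=
  mul_nonneg (by norm_num) (Finset.prod_nonneg fun i _ =>
    mul_nonneg (t i).2.1 (sub_nonneg.2 (t i).2.2))

/-- The factor `1 / 2` in `depth` secures the strict inequality when `n = 0`, where the empty
product is `1`; strictness is needed for injectivity of the push. -/
lemma depth_lt_one (t : Fin n → I) : depth t < 1 := by
  have : ∏ i, (t i : ℝ) * (1 - t i) ≤ 1 := Finset.prod_le_one
    (fun i _ => mul_nonneg (t i).2.1 (sub_nonneg.2 (t i).2.2)) fun i _ => by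
      nlinarith [(t i).2.1, (t i).2.2]
  unfold depth
  linarith

lemma depth_pos {t : Fin n → I} (h : ∀ i, 0 < t i ∧ t i < 1) : 0 < depth t :=
  mul_pos (by norm_num) (Finset.prod_pos fun i _ => mul_pos (h i).1 (sub_pos.2 (h i).2))

lemma depth_eq_zero {t : Fin n → I} {i : Fin n} (h : t i = 0 ∨ t i = 1) : depth t = 0 := by
  rw [depth, Finset.prod_eq_zero (Finset.mem_univ i), mul_zero]
  rcases h with h | h <;> simp [h]

lemma mul_depth_mem (r : I) (t : Fin n → I) : 0 ≤ r * depth t ∧ r * depth t < 1 :=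
  ⟨mul_nonneg r.2.1 (depth_nonneg t),
    (mul_le_of_le_one_left (depth_nonneg t) r.2.2).trans_lt (depth_lt_one t)⟩

/-- Pushing a family of based maps into the interior of the configuration space, away from the
boundary of the cube. -/
def pushBased : C(I × BasedMapSpace a, BasedMapSpace a) :=
  basedMap (fun y t i => push (y.1 * depth t) (y.2 t i))
    (by
      refine continuous_pi fun i => continuous_push.comp (Continuous.prodMk ?_ ?_)
      · exact (continuous_subtype_val.comp (continuous_fst.comp continuous_fst)).mul
          (continuous_depth.comp continuous_snd)
      · exact (continuous_apply i).comp (BasedMapSpace.continuous_eval.comp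
          ((continuous_snd.comp continuous_fst).prodMk continuous_snd)))
    (fun y t i => push_mem_cylinder (mul_depth_mem _ _).1 (mul_depth_mem _ _).2.le
      (y.2.mem_cylinder t i))
    (fun y t i j hij h => y.2.ne t hij (push_injective (mul_depth_mem _ _).1
      (mul_depth_mem _ _).2 h))
    (fun y t i h => by rw [depth_eq_zero (.inl h), mul_zero, push_zero, y.2.apply_zero h])
    (fun y t i h => by rw [depth_eq_zero (.inr h), mul_zero, push_zero, y.2.apply_one h])

lemma pushBased_apply (y : I × BasedMapSpace a) (t : Fin n → I) (i : Fin n) :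
    pushBased y t i = push (y.1 * depth t) (y.2 t i) := rfl

/-- The inclusion of the maps that satisfy the support condition. -/
def includeBased : C(MapSpace a, BasedMapSpace a) where
  toFun f := ⟨f.1, f.2.1, f.2.2.1⟩
  continuous_toFun := continuous_subtype_val.subtype_mk _

lemma pushBased_mem_interior (r : I) (f : BasedMapSpace a) {t : Fin n → I}
    (ht : ∀ i, 0 < t i ∧ t i < 1) (h : 0 < r ∨ f t ∈ interior (Conf cylinder n)) :
    pushBased (r, f) t ∈ interior (Conf cylinder n) := by
  rcases r.2.1.eq_or_lt with h0 | h0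
  · have e : pushBased (r, f) t = f t := by
      funext i
      rw [pushBased_apply, ← h0, zero_mul, push_zero]
    rw [e]
    exact h.resolve_left fun h' => (ne_of_gt (Subtype.coe_lt_coe.2 h')) h0.symm
  · exact mem_interior_conf (fun i => push_mem_interior (mul_pos h0 (depth_pos ht))
      (mul_depth_mem r t).2.le (f.mem_cylinder t i)) fun i j hij => (pushBased (r, f)).ne t hij

/-- Dropping the support condition does not change the homotopy type. -/
def mapSpaceEquiv (a : Fin n → EuclideanSpace ℝ (Fin 2)) :
    ContinuousMap.HomotopyEquiv (MapSpace a) (BasedMapSpace a) where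
  toFun := includeBased
  invFun :=
    { toFun := fun f => ⟨(pushBased (1, f)).1, (pushBased (1, f)).2.1, (pushBased (1, f)).2.2,
        fun _ ht => pushBased_mem_interior 1 f ht (.inl one_pos)⟩
      continuous_toFun :=
        (continuous_subtype_val.comp (pushBased.continuous.comp (by fun_prop))).subtype_mk _ }
  -- The homotopy turns the push on. It preserves the support condition at time zero because the
  -- original map satisfies it, and at positive times because the push enforces it.
  left_inv := ⟨ContinuousMap.Homotopy.symm
    { toFun := fun y => ⟨(pushBased (y.1, includeBased y.2)).1,
        (pushBased (y.1, includeBased y.2)).2.1, (pushBased (y.1, includeBased y.2)).2.2,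
        fun t ht => pushBased_mem_interior y.1 _ ht (.inr (y.2.2.2.2 t ht))⟩
      continuous_toFun := (continuous_subtype_val.comp (pushBased.continuous.comp
        (continuous_fst.prodMk (includeBased.continuous.comp continuous_snd)))).subtype_mk _
      map_zero_left := fun f => Subtype.ext (ContinuousMap.ext fun t => Subtype.ext
        (funext fun i => (by
          change push (((0 : I) : ℝ) * depth t) _ = _
          rw [Set.Icc.coe_zero, zero_mul, push_zero]
          rfl)))
      map_one_left := fun _ => rfl }⟩
  right_inv := ⟨ContinuousMap.Homotopy.symm
    { toFun := pushBased
      continuous_toFun := pushBased.continuous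
      map_zero_left := fun f => BasedMapSpace.ext fun t i => by
        simp [pushBased_apply]
      map_one_left := fun _ => rfl }⟩

/-! ### From the Taylor tower to based maps -/

/-- The closed thirds of the interval, indexed by the punctures that remain there. -/
def Zone (S : Finset (Fin 2)) (v : I) : Prop :=
  ((0 ∈ S → 1 / 3 ≤ (v : ℝ)) ∧ (1 ∈ S → (v : ℝ) ≤ 2 / 3)) ∧
    (0 ∉ S → (v : ℝ) ≤ 1 / 3) ∧ (1 ∉ S → 2 / 3 ≤ (v : ℝ))

lemma exists_zone (v : I) : ∃ S : {S : Finset (Fin 2) // S.Nonempty}, Zone S.1 v := by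
  rcases le_total (v : ℝ) (1 / 3) with h | h
  · exact ⟨⟨{1}, by simp⟩, by simp [Zone]; constructor <;> linarith⟩
  rcases le_total (v : ℝ) (2 / 3) with h' | h'
  · exact ⟨⟨Finset.univ, by simp⟩, by simp [Zone]; constructor <;> linarith⟩
  · exact ⟨⟨{0}, by simp⟩, by simp [Zone]; constructor <;> linarith⟩

lemma Zone.stretch_eq {S : Finset (Fin 2)} {v : I} (h : Zone S v) (j : Fin 2) (hj : j ∉ S) :
    stretch v = corner j := by
  fin_cases j
  · exact stretch_eq_zero (h.2.1 hj)
  · exact stretch_eq_one (h.2.2 hj)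

lemma SmoothFamily.of_zones {Z E : Type*} [TopologicalSpace Z] [NormedAddCommGroup E]
    [NormedSpace ℝ E] {J : Set ℝ} (hJ : UniqueDiffOn ℝ J) {Ω : Set Z} {F : Z → ℝ → E}
    {v : Z → I} (hv : Continuous v)
    (h : ∀ S : {S : Finset (Fin 2) // S.Nonempty},
      SmoothFamily J (Ω ∩ {z | Zone S.1 (v z)}) F) : SmoothFamily J Ω F := by
  have hv' : Continuous fun z => (v z : ℝ) := by fun_prop
  refine SmoothFamily.of_closed_cover hJ (C₁ := {z | (v z : ℝ) ≤ 1 / 3})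
    (C₂ := {z | 1 / 3 ≤ (v z : ℝ)}) (isClosed_le hv' continuous_const)
    (isClosed_le continuous_const hv') (fun z _ => le_total (v z : ℝ) (1 / 3)) ?_ ?_
  · refine (h ⟨{1}, by simp⟩).mono fun z hz => ⟨hz.1, ?_⟩
    have h2 : (v z : ℝ) ≤ 1 / 3 := hz.2
    simp [Zone]
    constructor <;> linarith
  refine SmoothFamily.of_closed_cover hJ (C₁ := {z | (v z : ℝ) ≤ 2 / 3})
    (C₂ := {z | 2 / 3 ≤ (v z : ℝ)}) (isClosed_le hv' continuous_const)
    (isClosed_le continuous_const hv') (fun z _ => le_total (v z : ℝ) (2 / 3)) ?_ ?_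
  · refine (h ⟨Finset.univ, by simp⟩).mono fun z hz => ⟨hz.1.1, ?_⟩
    have h2 : 1 / 3 ≤ (v z : ℝ) := hz.1.2
    have h3 : (v z : ℝ) ≤ 2 / 3 := hz.2
    simp [Zone]
    constructor <;> linarith
  · refine (h ⟨{0}, by simp⟩).mono fun z hz => ⟨hz.1.1, ?_⟩
    have h3 : 2 / 3 ≤ (v z : ℝ) := hz.2
    simp [Zone]
    constructor <;> linarith

/-- The object with prescribed `i`-th component and all other components maximal. -/
def single (i : Fin n) (S : {S : Finset (Fin 2) // S.Nonempty}) : Idx n :=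
  fun k => if k = i then S else ⟨Finset.univ, Finset.univ_nonempty⟩

lemma single_self (i : Fin n) (S : {S : Finset (Fin 2) // S.Nonempty}) : single i S i = S := by
  simp [single]

lemma carrier_stretch_le_single {t : Fin n → I} {i : Fin n}
    {S : {S : Finset (Fin 2) // S.Nonempty}} (h : Zone S.1 (t i)) :
    carrier (fun k => stretch (t k)) ≤ single i S := by
  refine carrier_le_iff.2 fun k j hj => ?_
  by_cases hk : k = i
  · subst hk
    rw [single_self] at hj
    exact h.stretch_eq j hj
  · simp [single, hk] at hj

/-- Strands over different points of the cube have different domains, so joint smoothness is checked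
zone by zone. The zones are closed, and over each of them the stretched point lies in the face of
the fixed object `single i S`, on whose domain the evaluation is smooth. -/
lemma TaylorStage.smoothFamily_eval_comp {Z : Type*} [TopologicalSpace Z] {J : Set ℝ}
    (hJ : UniqueDiffOn ℝ J) {Ω : Set Z} {φ : Z → TaylorStage β a A} (hφ : Continuous φ)
    {t : Z → Fin n → I} (ht : Continuous t) (i : Fin n) {ρ : Z → ℝ → ℝ}
    (hρ : SmoothFamily J Ω ρ)
    (hmem : ∀ z ∈ Ω, ∀ s ∈ J, ∀ S : Finset (Fin 2), (0 ∈ S → 1 / 3 ≤ (t z i : ℝ)) →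
      (1 ∈ S → (t z i : ℝ) ≤ 2 / 3) → ρ z s ∈ (A.gaps i).dom S) :
    SmoothFamily J Ω (fun z s => (φ z).eval (fun k => stretch (t z k)) i (ρ z s)) := by
  refine SmoothFamily.of_zones hJ ((continuous_apply i).comp ht) fun S => ?_
  refine (smoothFamily_eval (β := β) (a := a) (A := A) (single i S) i).comp
    (g := fun z => (φ z, fun k => stretch (t z k))) ?_ ?_ (hρ.mono Set.inter_subset_left) ?_
  · exact (hφ.prodMk (continuous_pi fun k =>
      continuous_stretch.comp ((continuous_apply k).comp ht))).continuousOn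
  · exact fun z hz => carrier_stretch_le_single hz.2
  · intro z hz s hs
    rw [A.domain_eq, single_self]
    exact hmem z hz.1 s hs S.1 hz.2.1.1 hz.2.1.2

/-- The object over which a stretched point of the cube lies. -/
lemma exists_zones (t : Fin n → I) : ∃ c : Idx n, carrier (fun k => stretch (t k)) ≤ c ∧
    ∀ i, (0 ∈ (c i).1 → 1 / 3 ≤ (t i : ℝ)) ∧ (1 ∈ (c i).1 → (t i : ℝ) ≤ 2 / 3) := by
  choose c hc using fun i => exists_zone (t i)
  exact ⟨c, carrier_le_iff.2 fun i j hj => (hc i).stretch_eq j hj, fun i => (hc i).1⟩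

lemma TaylorStage.eval_mem_cylinder (φ : TaylorStage β a A) {u : Fin n → I} {c : Idx n}
    (h : carrier u ≤ c) {i : Fin n} {s : ℝ} (hs : s ∈ A.domain c i) :
    φ.eval u i s ∈ cylinder := (φ.isLinkMap_eval h).mem_cylinder i ⟨s, hs⟩

lemma TaylorStage.eval_ne (φ : TaylorStage β a A) {u : Fin n → I} {c : Idx n}
    (h : carrier u ≤ c) {i j : Fin n} (hij : i ≠ j) {s s' : ℝ} (hs : s ∈ A.domain c i)
    (hs' : s' ∈ A.domain c j) : φ.eval u i s ≠ φ.eval u j s' :=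
  (φ.isLinkMap_eval h).disjoint i j hij ⟨s, hs⟩ ⟨s', hs'⟩

lemma TaylorStage.eval_zero (φ : TaylorStage β a A) (u : Fin n → I) (i : Fin n) :
    φ.eval u i 0 = (a i, 0) :=
  (φ.isLinkMap_eval le_rfl).bottom i ⟨0, A.domain_eq _ i ▸ Gaps.zero_mem_dom _ _⟩ rfl

lemma TaylorStage.eval_one (φ : TaylorStage β a A) (u : Fin n → I) (i : Fin n) :
    φ.eval u i 1 = (a i, 1) :=
  (φ.isLinkMap_eval le_rfl).top i ⟨1, A.domain_eq _ i ▸ Gaps.one_mem_dom _ _⟩ rfl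

/-- The based map of the cube to the configuration space that is given by a point of the first
stage of the Taylor tower. -/
def toBased : C(TaylorStage β a A, BasedMapSpace a) :=
  basedMap (fun φ t i => φ.eval (fun k => stretch (t k)) i ((A.gaps i).path (t i)))
    (by
      refine continuous_pi fun i => ?_
      have h := TaylorStage.smoothFamily_eval_comp (Z := TaylorStage β a A × (Fin n → I))
        (Ω := Set.univ) uniqueDiffOn_univ continuous_fst continuous_snd i
        (ρ := fun z _ => (A.gaps i).path (z.2 i))
        (.of_param ((A.gaps i).continuous_path.comp (by fun_prop)).continuousOn)
        fun z _ s _ S h0 h1 => Gaps.path_mem_dom h0 h1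
      exact h.continuousOn.comp_continuous
        (f := fun z : TaylorStage β a A × (Fin n → I) => (z, (0 : ℝ))) (by fun_prop)
        fun _ => ⟨trivial, trivial⟩)
    (fun φ t i => by
      obtain ⟨c, hc, h⟩ := exists_zones t
      exact φ.eval_mem_cylinder hc (A.domain_eq c i ▸ Gaps.path_mem_dom (h i).1 (h i).2))
    (fun φ t i j hij => by
      obtain ⟨c, hc, h⟩ := exists_zones t
      exact φ.eval_ne hc hij (A.domain_eq c i ▸ Gaps.path_mem_dom (h i).1 (h i).2)
        (A.domain_eq c j ▸ Gaps.path_mem_dom (h j).1 (h j).2))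
    (fun φ t i h => by
      have := (A.gaps i).path_corner 0
      rw [h]
      exact (congrArg _ this).trans (φ.eval_zero _ i))
    (fun φ t i h => by
      have := (A.gaps i).path_corner 1
      rw [h]
      exact (congrArg _ this).trans (φ.eval_one _ i))

lemma toBased_apply (φ : TaylorStage β a A) (t : Fin n → I) (i : Fin n) :
    toBased φ t i = φ.eval (fun k => stretch (t k)) i ((A.gaps i).path (t i)) := rfl

/-! ### From based maps to the Taylor tower -/

lemma stretch_eq_corner_of_face {u : Fin n → I} {c : Idx n} (h : carrier u ≤ c) (i : Fin n) :
    ∀ j ∉ (c i).1, stretch (u i) = corner j := fun j hj => by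
  rw [carrier_le_iff.1 h i j hj, stretch_corner]

lemma exists_stretch_eq_corner {v : I} (h : bump v ≠ 1) : ∃ j, stretch v = corner j := by
  rcases le_total (v : ℝ) (1 / 3) with h1 | h1
  · exact ⟨0, stretch_eq_zero h1⟩
  rcases le_total (v : ℝ) (2 / 3) with h2 | h2
  · exact absurd (bump_eq_one h1 h2) h
  · exact ⟨1, stretch_eq_one h2⟩

/-- The function `slot` with values in the interval. -/
def Gaps.slotPoint (g : Gaps) (v : I) (s : ℝ) : I := ⟨g.slot v s, g.slot_mem v s⟩

/-- The locally constant strands obtained from a map from the cube to the configuration space. -/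
def BasedMapSpace.strand (A : Punctures (fun _ : Fin n => 1)) (f : BasedMapSpace a)
    (u : Fin n → I) (i : Fin n) (s : ℝ) : Space :=
  f (Function.update (fun k => stretch (u k)) i ((A.gaps i).slotPoint (stretch (u i)) s)) i

namespace BasedMapSpace

lemma strand_of_slot_eq_zero (f : BasedMapSpace a) {u : Fin n → I} {i : Fin n} {s : ℝ}
    (h : (A.gaps i).slot (stretch (u i)) s = 0) : f.strand A u i s = (a i, 0) :=
  f.apply_zero (by rw [Function.update_self]; exact Subtype.ext h)

lemma strand_of_slot_eq_one (f : BasedMapSpace a) {u : Fin n → I} {i : Fin n} {s : ℝ}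
    (h : (A.gaps i).slot (stretch (u i)) s = 1) : f.strand A u i s = (a i, 1) :=
  f.apply_one (by rw [Function.update_self]; exact Subtype.ext h)

lemma strand_of_slot_eq (f : BasedMapSpace a) {u : Fin n → I} {i : Fin n} {s : ℝ}
    (h : (A.gaps i).slot (stretch (u i)) s = stretch (u i)) :
    f.strand A u i s = f (fun k => stretch (u k)) i := by
  have : (A.gaps i).slotPoint (stretch (u i)) s = stretch (u i) := Subtype.ext h
  rw [strand, this, Function.update_eq_self_iff.2 rfl]

/-- `bump` differs from `1` only where `stretch` has already reached an endpoint, and there the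
based map takes a prescribed value. So full pushing occurs only at values of the based map at one
common point of the cube, and every other value is an endpoint. The inequality `s * (1 - s) ≠ 1`
keeps the two cases apart. -/
lemma strand_cases (f : BasedMapSpace a) {u : Fin n → I} {c : Idx n} (h : carrier u ≤ c)
    {i : Fin n} {s : ℝ} (hs : s ∈ A.domain c i) :
    ((A.gaps i).amount (u i) s = 1 ∧ f.strand A u i s = f (fun k => stretch (u k)) i) ∨
    ((A.gaps i).amount (u i) s ≠ 1 ∧
      (f.strand A u i s = (a i, 0) ∨ f.strand A u i s = (a i, 1))) := by
  have hs' : s ∈ (A.gaps i).dom (c i).1 := A.domain_eq c i ▸ hs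
  have hlt : s * (1 - s) ≠ 1 := by nlinarith [sq_nonneg (s - 1 / 2)]
  rcases Gaps.dom_trichotomy (carrier_le_iff.1 h i) (stretch_eq_corner_of_face h i) hs'
    with h1 | h1 | h1
  · exact .inr ⟨by rwa [h1.2.2.2.2], .inl (f.strand_of_slot_eq_zero h1.2.2.2.1)⟩
  · exact .inr ⟨by rwa [h1.2.2.2.2], .inr (f.strand_of_slot_eq_one h1.2.2.2.1)⟩
  · have h2 := f.strand_of_slot_eq h1.2.2.2.1
    by_cases hb : bump (u i) = 1
    · exact .inl ⟨by rw [h1.2.2.2.2, hb]; ring, h2⟩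
    · refine .inr ⟨fun h3 => hb ?_, ?_⟩
      · rw [h1.2.2.2.2] at h3
        have h4 : (bump (u i) - 1) * (1 - s * (1 - s)) = 0 := by linarith
        rcases mul_eq_zero.1 h4 with h5 | h5
        · linarith
        · exact absurd (by linarith) hlt
      · obtain ⟨j, hj⟩ := exists_stretch_eq_corner hb
        rw [h2]
        fin_cases j
        · exact .inl (f.apply_zero hj)
        · exact .inr (f.apply_one hj)

lemma hasDerivWithinAt_strand (f : BasedMapSpace a) {u : Fin n → I} {c : Idx n}
    (h : carrier u ≤ c) {i : Fin n} {s : ℝ} (hs : s ∈ A.domain c i) :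
    HasDerivWithinAt (f.strand A u i) 0 (A.domain c i) s := by
  refine (hasDerivWithinAt_const s _ (f.strand A u i s)).congr_of_eventuallyEq ?_ rfl
  have h1 := Gaps.slot_locally_constant (stretch_eq_corner_of_face h i)
    ((A.domain_eq c i).subset hs)
  rw [← A.domain_eq c i] at h1
  filter_upwards [h1] with s' hs'
  have : (A.gaps i).slotPoint (stretch (u i)) s' = (A.gaps i).slotPoint (stretch (u i)) s :=
    Subtype.ext hs'
  rw [strand, this, ← strand]

end BasedMapSpace

/-- The family of strands given by a family of maps from the cube to the configuration space. -/
def basedFamily (β : BoundaryBehavior) (A : Punctures (fun _ : Fin n => 1))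
    (ha : ∀ i j, i ≠ j → a i ≠ a j) {Y : Type*} [TopologicalSpace Y]
    (f : C(Y, BasedMapSpace a)) (m : C(Y, ℝ)) (h0 : ∀ y, 0 < m y) (h1 : ∀ y, m y < 1) :
    PushFamily β a A Y where
  scale := m
  continuous_scale := m.continuous
  scale_nonneg y := (h0 y).le
  scale_lt_one := h1
  strand y := (f y).strand A
  smooth c i k := by
    refine .of_hasDerivWithinAt_zero (Continuous.continuousOn ?_)
      fun z hz s hs => (f z.1).hasDerivWithinAt_strand hz hs
    have hst := continuous_stretch
    have hslot : Continuous fun x : (Y × (Fin n → I)) × ℝ =>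
        (A.gaps i).slotPoint (stretch (x.1.2 i)) x.2 := by
      refine Continuous.subtype_mk ?_ _
      have hw := (A.gaps i).contDiff_window.continuous
      have hs := (A.gaps i).contDiff_step₁.continuous
      unfold Gaps.slot
      fun_prop
    refine (continuous_apply i).comp (BasedMapSpace.continuous_eval.comp
      ((f.continuous.comp (by fun_prop)).prodMk (Continuous.update ?_ i hslot)))
    fun_prop
  mem_cylinder y u c _ i s _ := (f y).mem_cylinder _ _
  bottom y u i := (f y).strand_of_slot_eq_zero (by
    simp [Gaps.slot, Gaps.window, Gaps.step₀_eq_zero (A.gaps i).l₀_pos.le,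
      Gaps.step₁_eq_zero (show 0 ≤ (A.gaps i).l₁ by
        linarith [(A.gaps i).l₀_pos, (A.gaps i).l₀_lt, (A.gaps i).r₀_lt])])
  top y u i := (f y).strand_of_slot_eq_one (by
    simp [Gaps.slot, Gaps.window, Gaps.step₁_eq_one (A.gaps i).r₁_lt.le])
  disjoint y u c h i j hij s hs s' hs' e := by
    have key : ∀ k s, s ∈ A.domain c k → (A.gaps k).amount (u k) s = 1 ∨
        ((f y).strand A u k s).2 = 0 ∨ ((f y).strand A u k s).2 = 1 := fun k s hs => by
      rcases (f y).strand_cases h hs with h | ⟨-, h | h⟩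
      · exact .inl h.1
      · exact .inr (.inl (by rw [h]))
      · exact .inr (.inr (by rw [h]))
    have m1 := (A.gaps i).amount_mem (u i) hs.1.1 hs.1.2
    have m2 := (A.gaps j).amount_mem (u j) hs'.1.1 hs'.1.2
    -- A collision after pushing would be one before pushing with equal amounts. Equal amounts put
    -- both strands in the same case of `strand_cases`: two coordinates of one configuration, or
    -- endpoints over distinct points of the disk.
    obtain ⟨e1, e2⟩ : (A.gaps i).amount (u i) s = (A.gaps j).amount (u j) s' ∧
        (f y).strand A u i s = (f y).strand A u j s' := push_eq_push (h0 y) (h1 y) m1.1 m2.1 m1.2 m2.2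
      ((f y).mem_cylinder _ _) ((f y).mem_cylinder _ _) (key i s hs) (key j s' hs') e
    have hends : ∀ r r' : ℝ, ((a i, r) : Space) ≠ (a j, r') := fun r r' h =>
      ha i j hij (congrArg Prod.fst h)
    rcases (f y).strand_cases h hs with h3 | ⟨h3, h4⟩ <;>
      rcases (f y).strand_cases h hs' with h5 | ⟨h5, h6⟩
    · exact (f y).ne _ hij ((h3.2.symm.trans e2).trans h5.2)
    · exact h5 (e1 ▸ h3.1)
    · exact h3 (e1 ▸ h5.1)
    · rcases h4 with h4 | h4 <;> rcases h6 with h6 | h6 <;> rw [h4, h6] at e2 <;>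
        exact hends _ _ e2
  mem_interior _ y _ _ _ h := absurd h (h0 y).ne'
  hasDeriv _ y u c h i s hs := ⟨0, by
    refine (f y).hasDerivWithinAt_strand h ?_
    rcases hs with rfl | rfl
    · exact A.domain_eq c i ▸ Gaps.zero_mem_dom _ _
    · exact A.domain_eq c i ▸ Gaps.one_mem_dom _ _, .inl (h0 y)⟩

/-- The point of the first stage of the Taylor tower that is given by a based map of the cube to
the configuration space. -/
def fromBased (β : BoundaryBehavior) (A : Punctures (fun _ : Fin n => 1))
    (ha : ∀ i j, i ≠ j → a i ≠ a j) : C(BasedMapSpace a, TaylorStage β a A) :=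
  (basedFamily β A ha (.id _) (.const _ (1 / 2)) (fun _ => by norm_num [ContinuousMap.const_apply])
    fun _ => by norm_num [ContinuousMap.const_apply]).map

/-- The self-map of the cube that underlies the passage to the Taylor tower and back. -/
def roundTrip (t : Fin n → I) : Fin n → I := coord (bary fun k => stretch (t k))

lemma continuous_roundTrip : Continuous (roundTrip : (Fin n → I) → Fin n → I) :=
  continuous_coord.comp (continuous_bary.comp
    (continuous_pi fun k => continuous_stretch.comp (continuous_apply k)))

/-- Preservation of faces is all that is used about `coord ∘ bary` on the cube: it allows
`roundTrip` to be deformed along segments without leaving a face. -/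
lemma carrier_roundTrip_le (t : Fin n → I) :
    carrier (roundTrip t) ≤ carrier (fun k => stretch (t k)) :=
  carrier_coord_le (bary_mem_over le_rfl)

lemma roundTrip_eq_corner {t : Fin n → I} {i : Fin n} {j : Fin 2} (h : stretch (t i) = corner j) :
    roundTrip t i = corner j :=
  carrier_le_iff.1 (carrier_roundTrip_le t) i j (by simp [carrier, h])

lemma stretch_roundTrip_eq_corner {t : Fin n → I} {i : Fin n} {j : Fin 2}
    (h : stretch (t i) = corner j) : stretch (roundTrip t i) = corner j := by
  rw [roundTrip_eq_corner h, stretch_corner]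

/-- On the outer thirds `roundTrip` is at an endpoint, where `slot` is constant on the side of the
gap containing the path; on the middle third the path rests at the midpoint, inside the middle
component. -/
lemma Gaps.slot_path (g : Gaps) (t : Fin n → I) (i : Fin n) :
    g.slot (stretch (roundTrip t i)) (g.path (t i)) = stretch (roundTrip t i) := by
  have h1 := g.r₀_lt_mid
  have h2 := g.mid_lt_l₁
  rcases le_total (t i : ℝ) (1 / 3) with h | h
  · have e := stretch_roundTrip_eq_corner (j := 0) (stretch_eq_zero h)
    have h3 := path_le_mid (g := g) (v := t i) (by linarith)
    rw [e]
    simp [slot, corner, step₁_eq_zero (h3.trans h2.le)]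
  rcases le_total (t i : ℝ) (2 / 3) with h' | h'
  · have h3 := path_le_mid (g := g) (v := t i) h'
    have h4 := mid_le_path (g := g) (v := t i) h
    simp [slot, window, step₁_eq_zero (h3.trans h2.le), step₀_eq_one (h1.le.trans h4)]
  · have e := stretch_roundTrip_eq_corner (j := 1) (stretch_eq_one h')
    have h4 := mid_le_path (g := g) (v := t i) (by linarith)
    rw [e]
    simp [slot, corner, window, step₀_eq_one (h1.le.trans h4)]

lemma toBased_fromBased (ha : ∀ i j, i ≠ j → a i ≠ a j) (f : BasedMapSpace a) (t : Fin n → I)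
    (i : Fin n) : toBased (fromBased β A ha f) t i =
      push (1 / 2 * (A.gaps i).amount (roundTrip t i) ((A.gaps i).path (t i)))
        (f (fun k => stretch (roundTrip t k)) i) := by
  obtain ⟨c, hc, h⟩ := exists_zones t
  rw [toBased_apply, fromBased, PushFamily.eval_map _ _ hc i
    (A.domain_eq c i ▸ Gaps.path_mem_dom (h i).1 (h i).2)]
  exact congrArg (push _) (f.strand_of_slot_eq ((A.gaps i).slot_path t i))

/-- This is the hypothesis of `push_eq_push` along the path, needed to undo the push without
collisions. Whenever neither `t i` nor `roundTrip t i` stretches to an endpoint, the path is at the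
midpoint and the push is full. -/
lemma amount_path_cases (g : Gaps) (f : BasedMapSpace a) (t : Fin n → I) (i : Fin n) :
    g.amount (roundTrip t i) (g.path (t i)) = 1 ∨
      (f (fun k => stretch (roundTrip t k)) i).2 = 0 ∨
      (f (fun k => stretch (roundTrip t k)) i).2 = 1 := by
  by_cases hb : bump (roundTrip t i) = 1
  · by_cases h : ∃ j, stretch (t i) = corner j
    · obtain ⟨j, hj⟩ := h
      exact .inr (f.snd_of_corner (stretch_roundTrip_eq_corner hj))
    · left
      have h1 := g.r₀_lt_mid
      have h2 := g.mid_lt_l₁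
      have h3 : 1 / 3 ≤ (t i : ℝ) := by
        by_contra! hn
        exact h ⟨0, stretch_eq_zero hn.le⟩
      have h4 : (t i : ℝ) ≤ 2 / 3 := by
        by_contra! hn
        exact h ⟨1, stretch_eq_one hn.le⟩
      have h5 := Gaps.path_le_mid (g := g) (v := t i) h4
      have h6 := Gaps.mid_le_path (g := g) (v := t i) h3
      simp [Gaps.amount, Gaps.window, hb, Gaps.step₁_eq_zero (h5.trans h2.le),
        Gaps.step₀_eq_one (h1.le.trans h6)]
  · obtain ⟨j, hj⟩ := exists_stretch_eq_corner hb
    exact .inr (f.snd_of_corner hj)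

lemma Gaps.continuous_amount (g : Gaps) : Continuous fun z : I × ℝ => g.amount z.1 z.2 := by
  have h1 := continuous_bump
  have h2 := g.contDiff_window.continuous
  unfold Gaps.amount
  fun_prop

/-- The homotopy that undoes the push. -/
def unpush (A : Punctures (fun _ : Fin n => 1)) :
    C(I × BasedMapSpace a, BasedMapSpace a) :=
  basedMap (fun y t i => push (1 / 2 * (1 - y.1) *
      (A.gaps i).amount (roundTrip t i) ((A.gaps i).path (t i)))
        (y.2 (fun k => stretch (roundTrip t k)) i))
    (by
      have h1 := continuous_roundTrip (n := n)
      have h2 := continuous_stretch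
      refine continuous_pi fun i => continuous_push.comp (Continuous.prodMk ?_ ?_)
      · have h3 := (A.gaps i).continuous_path
        have h4 := (A.gaps i).continuous_amount
        refine Continuous.mul (by fun_prop) (h4.comp (f := fun z : (I × BasedMapSpace a) ×
          (Fin n → I) => (roundTrip z.2 i, (A.gaps i).path (z.2 i))) (by fun_prop))
      · exact (continuous_apply i).comp (BasedMapSpace.continuous_eval.comp
          ((continuous_snd.comp continuous_fst).prodMk (continuous_pi fun k => h2.comp
            ((continuous_apply k).comp (h1.comp continuous_snd))))))
    (fun y t i => by
      have h1 := (A.gaps i).path_mem (t i)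
      have h2 := (A.gaps i).amount_mem (roundTrip t i) h1.1 h1.2
      have h3 := y.1.2.1
      have h4 := y.1.2.2
      refine push_mem_cylinder (mul_nonneg (by linarith) h2.1)
        (mul_le_one₀ (by linarith) h2.1 h2.2) (y.2.mem_cylinder _ i))
    (fun y t i j hij e => by
      have h3 := y.1.2.1
      rcases y.1.2.2.eq_or_lt with h4 | h4
      · rw [h4] at e
        simp only [sub_self, mul_zero, zero_mul, push_zero] at e
        exact y.2.ne _ hij e
      · have h1 := (A.gaps i).path_mem (t i)
        have h2 := (A.gaps i).amount_mem (roundTrip t i) h1.1 h1.2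
        have h1' := (A.gaps j).path_mem (t j)
        have h2' := (A.gaps j).amount_mem (roundTrip t j) h1'.1 h1'.2
        exact y.2.ne _ hij (push_eq_push (by linarith) (by linarith) h2.1 h2'.1 h2.2 h2'.2
          (y.2.mem_cylinder _ i) (y.2.mem_cylinder _ j) (amount_path_cases _ _ _ _)
          (amount_path_cases _ _ _ _) e).2)
    (fun y t i h => by
      have hc : t i = corner 0 := h
      have e := stretch_roundTrip_eq_corner (t := t) (i := i) (j := 0) (by rw [hc, stretch_corner])
      rw [y.2.apply_zero e, hc, (A.gaps i).path_corner 0]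
      simp [corner, Gaps.amount_zero])
    (fun y t i h => by
      have hc : t i = corner 1 := h
      have e := stretch_roundTrip_eq_corner (t := t) (i := i) (j := 1) (by rw [hc, stretch_corner])
      rw [y.2.apply_one e, hc, (A.gaps i).path_corner 1]
      simp [corner, Gaps.amount_one])

/-- The point at time `r` on the segment between two points of the interval. -/
def lerp (r x y : I) : I :=
  ⟨(1 - r) * x + r * y, by
    have := convex_Icc (0 : ℝ) 1 x.2 y.2 (sub_nonneg.2 r.2.2) r.2.1 (by ring)
    simpa using this⟩

lemma continuous_lerp : Continuous fun z : I × I × I => lerp z.1 z.2.1 z.2.2 := by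
  unfold lerp
  fun_prop

@[simp] lemma lerp_zero (x y : I) : lerp 0 x y = x := Subtype.ext (by simp [lerp])

@[simp] lemma lerp_one (x y : I) : lerp 1 x y = y := Subtype.ext (by simp [lerp])

lemma lerp_self (r x : I) : lerp r x x = x := Subtype.ext (by simp only [lerp]; ring)

/-- The homotopy that contracts the self-map of the cube to the identity. -/
def unstretch : C(I × BasedMapSpace a, BasedMapSpace a) :=
  basedMap (fun y t i => y.2 (fun k => lerp y.1 (stretch (roundTrip t k)) (t k)) i)
    (by
      have h1 := continuous_roundTrip (n := n)
      have h2 := continuous_stretch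
      have h3 := continuous_lerp
      refine continuous_pi fun i => (continuous_apply i).comp
        (BasedMapSpace.continuous_eval.comp ((continuous_snd.comp continuous_fst).prodMk
          (continuous_pi fun k => h3.comp (f := fun z : (I × BasedMapSpace a) × (Fin n → I) =>
            (z.1.1, stretch (roundTrip z.2 k), z.2 k)) (by fun_prop)))))
    (fun y t i => y.2.mem_cylinder _ i)
    (fun y t i j hij => y.2.ne _ hij)
    (fun y t i h => y.2.apply_zero (by
      have hc : t i = corner 0 := h
      rw [stretch_roundTrip_eq_corner (t := t) (i := i) (j := 0) (by rw [hc, stretch_corner]), hc,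
        lerp_self]
      rfl))
    (fun y t i h => y.2.apply_one (by
      have hc : t i = corner 1 := h
      rw [stretch_roundTrip_eq_corner (t := t) (i := i) (j := 1) (by rw [hc, stretch_corner]), hc,
        lerp_self]
      rfl))

lemma toBased_comp_fromBased_homotopic (ha : ∀ i j, i ≠ j → a i ≠ a j) :
    ((toBased (β := β) (A := A)).comp (fromBased β A ha)).Homotopic
      (ContinuousMap.id (BasedMapSpace a)) := by
  -- The intermediate map is precomposition with `stretch ∘ roundTrip`, reached once the push is
  -- undone.
  refine ContinuousMap.Homotopic.trans (g := (unstretch (a := a)).comp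
    ((ContinuousMap.const _ 0).prodMk (.id _))) ⟨?_⟩ ⟨?_⟩
  · exact
      { toFun := unpush A
        continuous_toFun := (unpush A).continuous
        map_zero_left := fun f => BasedMapSpace.ext fun t i =>
          Eq.trans (congrArg (fun r => push (r * _) _) (by simp)) (toBased_fromBased ha f t i).symm
        map_one_left := fun f => BasedMapSpace.ext fun t i => by
          change push (1 / 2 * (1 - ((1 : I) : ℝ)) * _) _ =
            f (fun k => lerp 0 (stretch (roundTrip t k)) (t k)) i
          simp }
  · exact
      { toFun := unstretch
        continuous_toFun := unstretch.continuous
        map_zero_left := fun f => rfl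
        map_one_left := fun f => BasedMapSpace.ext fun t i => by
          change f (fun k => lerp 1 (stretch (roundTrip t k)) (t k)) i = f t i
          simp }

/-! ### The distance between contracted strands -/

lemma LinkMapSpace.continuous_eval {J : Fin n → Set ℝ} (i : Fin n) (hJ : UniqueDiffOn ℝ (J i))
    [LocallyCompactSpace (J i)] :
    Continuous fun z : LinkMapSpace β a J × J i => z.1.1 i z.2 := by
  have h := (LinkMapSpace.smoothFamily_eval (β := β) (a := a) (J := J) i hJ).continuousOn
  refine (h.comp_continuous (f := fun z : LinkMapSpace β a J × J i => (z.1, (z.2 : ℝ)))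
    (by fun_prop) fun z => ⟨trivial, z.2.2⟩).congr fun z => ?_
  exact extendZero_apply (z.1.1 i) z.2

/-- The minimal distance between the contracted `i`-th and `j`-th strands over `c`. -/
def separation (φ : TaylorStage β a A) (p : Idx n × Fin n × Fin n) : ℝ :=
  sInf ((fun x : realizationOver p.1 × (A.gaps p.2.1).core (p.1 p.2.1).1 ×
      (A.gaps p.2.2).core (p.1 p.2.2).1 =>
    dist (extendZero ((φ.link p.1 x.1).1 p.2.1) x.2.1)
      (extendZero ((φ.link p.1 x.1).1 p.2.2) x.2.2)) '' Set.univ)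

lemma continuous_extendZero_link (c : Idx n) (i : Fin n) :
    Continuous fun z : (TaylorStage β a A × realizationOver c) × (A.gaps i).core (c i).1 =>
      extendZero ((z.1.1.link c z.1.2).1 i) z.2 := by
  have hJ : ∀ s : (A.gaps i).core (c i).1, (s : ℝ) ∈ A.domain c i := fun s =>
    A.domain_eq c i ▸ Gaps.core_subset_dom _ _ s.2
  have h := ((LinkMapSpace.continuous_eval (β := β) (a := a) i (A.uniqueDiffOn c i))).comp
    (((TaylorStage.continuous_link (β := β) (a := a) (A := A) c).comp continuous_fst).prodMk
      ((continuous_subtype_val.comp continuous_snd).subtype_mk fun z => hJ z.2))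
  refine h.congr fun z => ?_
  exact (extendZero_apply ((z.1.1.link c z.1.2).1 i) ⟨_, hJ z.2⟩).symm

lemma continuous_dist_strands (c : Idx n) (i j : Fin n) :
    Continuous fun z : TaylorStage β a A × realizationOver c × (A.gaps i).core (c i).1 ×
        (A.gaps j).core (c j).1 =>
      dist (extendZero ((z.1.link c z.2.1).1 i) z.2.2.1)
        (extendZero ((z.1.link c z.2.1).1 j) z.2.2.2) :=
  ((continuous_extendZero_link c i).comp
    (f := fun z : TaylorStage β a A × realizationOver c × (A.gaps i).core (c i).1 ×
        (A.gaps j).core (c j).1 => ((z.1, z.2.1), z.2.2.1)) (by fun_prop)).dist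
    ((continuous_extendZero_link c j).comp
    (f := fun z : TaylorStage β a A × realizationOver c × (A.gaps i).core (c i).1 ×
        (A.gaps j).core (c j).1 => ((z.1, z.2.1), z.2.2.2)) (by fun_prop))

instance (g : Gaps) (S : Finset (Fin 2)) : CompactSpace (g.core S) :=
  isCompact_iff_compactSpace.1 (g.isCompact_core S)

lemma continuous_separation (p : Idx n × Fin n × Fin n) :
    Continuous fun φ : TaylorStage β a A => separation φ p :=
  isCompact_univ.continuous_sInf (continuous_dist_strands p.1 p.2.1 p.2.2)

instance (c : Idx n) : Nonempty (realizationOver c) := by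
  classical
  have h : ∀ s, (Pi.single c 1 : Idx n → ℝ) s ≠ 0 → s = c := fun s hs => by
    by_contra h
    exact hs (by simp [h])
  refine ⟨⟨Pi.single c 1, ⟨fun s => ?_, by simp, fun s hs s' hs' hne => ?_⟩,
    fun s hs => (h s hs).le⟩⟩
  · by_cases h : s = c
    · subst h; simp
    · simp [h]
  · exact absurd ((h s hs).trans (h s' hs').symm) hne

instance (g : Gaps) (S : Finset (Fin 2)) : Nonempty (g.core S) := ⟨⟨0, g.zero_mem_core S⟩⟩

/-- The infimum over a compact set is attained, at two points on distinct strands of one link map.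
-/
lemma separation_pos (φ : TaylorStage β a A) {c : Idx n} {i j : Fin n} (hij : i ≠ j) :
    0 < separation φ (c, i, j) := by
  have hc := (continuous_dist_strands (β := β) (a := a) (A := A) c i j).comp
    (Continuous.prodMk_right φ)
  obtain ⟨x, -, hx⟩ := (isCompact_univ.image hc).sInf_mem (Set.image_nonempty.2 Set.univ_nonempty)
  rw [separation]
  refine lt_of_lt_of_eq ?_ hx
  have hJ : ∀ (k : Fin n) (s : (A.gaps k).core (c k).1), (s : ℝ) ∈ A.domain c k := fun k s =>
    A.domain_eq c k ▸ Gaps.core_subset_dom _ _ s.2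
  refine dist_pos.2 ?_
  have e1 := extendZero_apply ((φ.link c x.1).1 i) ⟨_, hJ i x.2.1⟩
  have e2 := extendZero_apply ((φ.link c x.1).1 j) ⟨_, hJ j x.2.2⟩
  simp only at e1 e2
  rw [e1, e2]
  exact (φ.link c x.1).2.disjoint i j hij _ _

lemma separation_le (φ : TaylorStage β a A) {u : Fin n → I} {c : Idx n} (h : carrier u ≤ c)
    (i j : Fin n) {s s' : ℝ} (hs : s ∈ (A.gaps i).core (c i).1)
    (hs' : s' ∈ (A.gaps j).core (c j).1) :
    separation φ (c, i, j) ≤ dist (φ.eval u i s) (φ.eval u j s') := by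
  have hc := (continuous_dist_strands (β := β) (a := a) (A := A) c i j).comp
    (Continuous.prodMk_right φ)
  refine csInf_le (isCompact_univ.image hc).bddBelow
    ⟨(⟨bary u, bary_mem_over h⟩, ⟨s, hs⟩, ⟨s', hs'⟩), trivial, ?_⟩
  have hJ : ∀ (k : Fin n), ∀ s ∈ (A.gaps k).core (c k).1, s ∈ A.domain c k := fun k s hs =>
    A.domain_eq c k ▸ Gaps.core_subset_dom _ _ hs
  have e1 := φ.eval_eq h i ⟨s, hJ i s hs⟩
  have e2 := φ.eval_eq h j ⟨s', hJ j s' hs'⟩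
  simp only at e1 e2 ⊢
  rw [e1, e2, extendZero_apply _ (⟨s, hJ i s hs⟩ : A.domain c i),
    extendZero_apply _ (⟨s', hJ j s' hs'⟩ : A.domain c j)]

/-- A positive function on the first stage of the Taylor tower by which contracted strands may be
moved while remaining disjoint. -/
def margin (φ : TaylorStage β a A) : ℝ :=
  1 / 4 * ∏ p : Idx n × Fin n × Fin n, if p.2.1 = p.2.2 then 1 else min 1 (separation φ p)

lemma continuous_margin : Continuous (margin : TaylorStage β a A → ℝ) := by
  unfold margin
  refine continuous_const.mul (continuous_finsetProd _ fun p _ => ?_)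
  split_ifs
  · exact continuous_const
  · exact continuous_const.min (continuous_separation p)

lemma margin_factor_pos (φ : TaylorStage β a A) (p : Idx n × Fin n × Fin n) :
    0 < if p.2.1 = p.2.2 then 1 else min 1 (separation φ p) := by
  split_ifs with h
  · exact one_pos
  · exact lt_min one_pos (separation_pos φ h)

lemma margin_factor_le (φ : TaylorStage β a A) (p : Idx n × Fin n × Fin n) :
    (if p.2.1 = p.2.2 then 1 else min 1 (separation φ p)) ≤ 1 := by
  split_ifs
  · exact le_rfl
  · exact min_le_left _ _

lemma margin_pos (φ : TaylorStage β a A) : 0 < margin φ :=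
  mul_pos (by norm_num) (Finset.prod_pos fun p _ => margin_factor_pos φ p)

lemma margin_le (φ : TaylorStage β a A) : margin φ ≤ 1 / 4 :=
  mul_le_of_le_one_right (by norm_num) (Finset.prod_le_one
    (fun p _ => (margin_factor_pos φ p).le) fun p _ => margin_factor_le φ p)

/-- All factors are at most `1`, so the product is bounded by any one of them. Two pushed points
move by at most `2 * margin φ` together, and the factor `4` leaves the strict inequality required by
`push_ne_of_dist`. -/
lemma margin_le_separation (φ : TaylorStage β a A) {c : Idx n} {i j : Fin n} (hij : i ≠ j) :
    4 * margin φ ≤ separation φ (c, i, j) := by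
  classical
  have h1 := Finset.mul_prod_erase Finset.univ
    (fun p : Idx n × Fin n × Fin n => if p.2.1 = p.2.2 then 1 else min 1 (separation φ p))
    (Finset.mem_univ (c, i, j))
  have h2 := Finset.prod_le_one (s := Finset.univ.erase (c, i, j))
    (fun p _ => (margin_factor_pos φ p).le) fun p _ => margin_factor_le φ p
  have h3 := mul_le_of_le_one_right (margin_factor_pos φ (c, i, j)).le h2
  rw [h1, if_neg hij] at h3
  have := h3.trans (min_le_right _ _)
  unfold margin
  linarith

/-! ### The homotopies of the Taylor tower -/

lemma TaylorStage.hasDerivWithinAt_eval (φ : TaylorStage β a A)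
    (hβ : β = .endpointsAndSupport) {u : Fin n → I} {c : Idx n} (h : carrier u ≤ c) (i : Fin n)
    {s : ℝ} (hs : s = 0 ∨ s = 1) :
    ∃ e ≠ 0, HasDerivWithinAt (φ.eval u i) (0, e) (A.domain c i) s := by
  have hmem : s ∈ A.domain c i := by
    rw [A.domain_eq]
    rcases hs with rfl | rfl
    exacts [Gaps.zero_mem_dom _ _, Gaps.one_mem_dom _ _]
  have h1 := ((φ.isLinkMap_eval h).support hβ i).2 ⟨s, hmem⟩ hs
  have he : Set.EqOn (extendZero fun s : A.domain c i => φ.eval u i s) (φ.eval u i)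
      (A.domain c i) := fun s hs =>
    extendZero_apply (fun s : A.domain c i => φ.eval u i s) ⟨s, hs⟩
  have h2 := (smoothFamily_eval (β := β) (a := a) (A := A) c i).differentiableWithinAt
    (z := (φ, u)) h hmem
  rw [derivWithin_congr he (he hmem)] at h1
  refine ⟨_, h1.2, ?_⟩
  have e : derivWithin (φ.eval u i) (A.domain c i) s =
      (0, (derivWithin (φ.eval u i) (A.domain c i) s).2) := Prod.ext h1.1 rfl
  exact e ▸ h2.hasDerivWithinAt

lemma carrier_lerp_le {u u' : Fin n → I} {c : Idx n} (h : carrier u ≤ c) (h' : carrier u' ≤ c)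
    (r : I) : carrier (fun k => lerp r (u k) (u' k)) ≤ c :=
  carrier_le_iff.2 fun i j hj => by
    rw [carrier_le_iff.1 h i j hj, carrier_le_iff.1 h' i j hj, lerp_self]

lemma carrier_stretch_le {u : Fin n → I} {c : Idx n} (h : carrier u ≤ c) :
    carrier (fun k => stretch (u k)) ≤ c :=
  carrier_le_iff.2 (stretch_eq_corner_of_face h)

/-- The family of strands that reparametrizes the cube. -/
def stretchFamily (β : BoundaryBehavior) (a : Fin n → EuclideanSpace ℝ (Fin 2))
    (A : Punctures (fun _ : Fin n => 1)) : PushFamily β a A (I × TaylorStage β a A) where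
  scale _ := 0
  continuous_scale := continuous_const
  scale_nonneg _ := le_rfl
  scale_lt_one _ := zero_lt_one
  -- One stretching comes from `BasedMapSpace.strand`, the other from `toBased`.
  strand y u := y.2.eval fun k => lerp y.1 (u k) (stretch (stretch (u k)))
  smooth c i := by
    refine (TaylorStage.smoothFamily_eval c i).comp_param
      (g := fun z : (I × TaylorStage β a A) × (Fin n → I) =>
        (z.1.2, fun k => lerp z.1.1 (z.2 k) (stretch (stretch (z.2 k)))))
      (Continuous.continuousOn ?_)
      fun z hz => carrier_lerp_le hz (carrier_stretch_le (carrier_stretch_le hz)) _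
    have h2 := continuous_stretch
    exact (continuous_snd.comp continuous_fst).prodMk (continuous_pi fun k =>
      continuous_lerp.comp (f := fun z : (I × TaylorStage β a A) × (Fin n → I) =>
        (z.1.1, z.2 k, stretch (stretch (z.2 k)))) (by fun_prop))
  mem_cylinder y u c h i s hs := y.2.eval_mem_cylinder
    (carrier_lerp_le h (carrier_stretch_le (carrier_stretch_le h)) _) hs
  bottom y u i := y.2.eval_zero _ i
  top y u i := y.2.eval_one _ i
  disjoint y u c h i j hij s hs s' hs' := by
    simp only [zero_mul, push_zero]
    exact y.2.eval_ne (carrier_lerp_le h (carrier_stretch_le (carrier_stretch_le h)) _) hij hs hs'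
  mem_interior hβ y u c h _ i s hs h0 h1 :=
    ((y.2.isLinkMap_eval (carrier_lerp_le h (carrier_stretch_le (carrier_stretch_le h))
      y.1)).support hβ i).1 ⟨s, hs⟩ h0 h1
  hasDeriv hβ y u c h i s hs := by
    obtain ⟨e, he, hd⟩ := y.2.hasDerivWithinAt_eval hβ
      (carrier_lerp_le h (carrier_stretch_le (carrier_stretch_le h)) y.1) i hs
    exact ⟨e, hd, .inr he⟩

lemma Gaps.smoothFamily_contract (g : Gaps) {Z : Type*} [TopologicalSpace Z] {J : Set ℝ}
    {Ω : Set Z} {τ : Z → ℝ} (hτ : Continuous τ) {v : Z → I} (hv : Continuous v) :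
    SmoothFamily J Ω (fun z s => g.contract (τ z) (v z) s) := by
  have hp := g.continuous_path.comp hv
  have h1 : SmoothFamily J Ω (fun (_ : Z) (s : ℝ) => s) := .of_contDiff contDiff_id
  have h2 : SmoothFamily J Ω (fun (_ : Z) => g.window) := .of_contDiff g.contDiff_window
  have h3 : SmoothFamily J Ω (fun (_ : Z) => g.step₁) := .of_contDiff g.contDiff_step₁
  exact (SmoothFamily.mul (.of_param (continuous_const.sub hτ).continuousOn) h1).add
    (SmoothFamily.mul (.of_param hτ.continuousOn)
      ((SmoothFamily.mul h2 (.of_param hp.continuousOn)).add h3))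

lemma Gaps.hasDerivAt_contract (g : Gaps) (τ : ℝ) (v : I) {s : ℝ} (hs : s = 0 ∨ s = 1) :
    HasDerivAt (g.contract τ v) (1 - τ) s ∧ g.contract τ v s = s := by
  have h1 := g.l₀_pos
  have h2 := g.l₀_lt
  have h3 := g.r₀_lt
  have key : ∀ r : ℝ, HasDerivAt (fun s => (1 - τ) * s + τ * r) (1 - τ) s := fun r => by
    simpa using ((hasDerivAt_id s).const_mul (1 - τ)).add_const (τ * r)
  rcases hs with rfl | rfl
  · have e : ∀ s ∈ Set.Iio g.l₀, g.contract τ v s = (1 - τ) * s + τ * 0 := fun s hs => by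
      have hs' : s < g.l₀ := hs
      simp [contract, base, window, step₀_eq_zero hs'.le,
        step₁_eq_zero (show s ≤ g.l₁ by linarith)]
    refine ⟨(key 0).congr_of_eventuallyEq ?_, by rw [e 0 h1]; ring⟩
    filter_upwards [isOpen_Iio.mem_nhds (show (0 : ℝ) ∈ Set.Iio g.l₀ from h1)] with s hs
    exact e s hs
  · have e : ∀ s ∈ Set.Ioi g.r₁, g.contract τ v s = (1 - τ) * s + τ * 1 := fun s hs => by
      have hs' : g.r₁ < s := hs
      simp [contract, base, window, step₁_eq_one hs'.le]
    refine ⟨(key 1).congr_of_eventuallyEq ?_, by rw [e 1 g.r₁_lt]; ring⟩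
    filter_upwards [isOpen_Ioi.mem_nhds (show (1 : ℝ) ∈ Set.Ioi g.r₁ from g.r₁_lt)] with s hs
    exact e s hs

/-- The family of strands that contracts the components of the punctured intervals. -/
def contractFamily {Y : Type*} [TopologicalSpace Y] (φ : C(Y, TaylorStage β a A)) (τ m : C(Y, ℝ))
    (hτ₀ : ∀ y, 0 ≤ τ y) (hτ₁ : ∀ y, τ y ≤ 1) (hm : ∀ y, 0 ≤ m y)
    -- A complete contraction has zero speed at the ends and sends interior parameters to endpoints,
    -- so it is allowed only together with a push.
    (hpos : ∀ y, 0 < m y ∨ τ y < 1)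
    -- Pushing starts only after half of the contraction, when the strands are evaluated on compact
    -- cores and `margin` controls their distances.
    (hsep : ∀ y, m y = 0 ∨ 1 / 2 ≤ τ y ∧ m y ≤ margin (φ y)) : PushFamily β a A Y where
  scale := m
  continuous_scale := m.continuous
  scale_nonneg := hm
  scale_lt_one y := by
    rcases hsep y with h | h
    · rw [h]; exact zero_lt_one
    · linarith [h.2, margin_le (φ y)]
  strand y u i s := (φ y).eval (fun k => stretch (stretch (u k))) i
    ((A.gaps i).contract (τ y) (stretch (u i)) s)
  smooth c i := by
    have hst := continuous_stretch
    refine TaylorStage.smoothFamily_eval_comp (A.uniqueDiffOn c i)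
      (φ := fun z : Y × (Fin n → I) => φ z.1) (φ.continuous.comp continuous_fst)
      (t := fun z k => stretch (z.2 k)) (by fun_prop) i
      ((A.gaps i).smoothFamily_contract (τ.continuous.comp continuous_fst) (by fun_prop))
      fun z hz s hs S h0 h1 => ?_
    exact Gaps.contract_mem_dom (stretch_eq_corner_of_face hz i) ((A.domain_eq c i).subset hs)
      (hτ₀ _) (hτ₁ _) h0 h1
  mem_cylinder y u c h i s hs := by
    obtain ⟨c', hc', hz⟩ := exists_zones fun k => stretch (u k)
    exact (φ y).eval_mem_cylinder hc' (A.domain_eq c' i ▸ Gaps.contract_mem_dom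
      (stretch_eq_corner_of_face h i) ((A.domain_eq c i).subset hs) (hτ₀ y) (hτ₁ y)
      (hz i).1 (hz i).2)
  bottom y u i := by
    rw [((A.gaps i).hasDerivAt_contract _ _ (.inl rfl)).2, (φ y).eval_zero]
  top y u i := by
    rw [((A.gaps i).hasDerivAt_contract _ _ (.inr rfl)).2, (φ y).eval_one]
  disjoint y u c h i j hij s hs s' hs' := by
    obtain ⟨c', hc', hz⟩ := exists_zones fun k => stretch (u k)
    have key : ∀ k, ∀ s ∈ A.domain c k,
        (A.gaps k).contract (τ y) (stretch (u k)) s ∈ A.domain c' k := fun k s hs =>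
      A.domain_eq c' k ▸ Gaps.contract_mem_dom (stretch_eq_corner_of_face h k)
        ((A.domain_eq c k).subset hs) (hτ₀ y) (hτ₁ y) (hz k).1 (hz k).2
    rcases hsep y with h0 | ⟨h1, h2⟩
    · simp only [h0, zero_mul, push_zero]
      exact (φ y).eval_ne hc' hij (key i s hs) (key j s' hs')
    · have key' : ∀ k, ∀ s ∈ A.domain c k,
          (A.gaps k).contract (τ y) (stretch (u k)) s ∈ (A.gaps k).core (c' k).1 := fun k s hs =>
        Gaps.contract_mem_core (stretch_eq_corner_of_face h k)
          ((A.domain_eq c k).subset hs) h1 (hτ₁ y) (hz k).1 (hz k).2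
      have m1 := (A.gaps i).amount_mem (u i) hs.1.1 hs.1.2
      have m2 := (A.gaps j).amount_mem (u j) hs'.1.1 hs'.1.2
      have h3 := margin_le_separation (φ y) (c := c') hij
      have h4 := separation_le (φ y) hc' i j (key' i s hs) (key' j s' hs')
      have h5 := margin_pos (φ y)
      have h6 := margin_le (φ y)
      exact push_ne_of_dist (m := margin (φ y)) (mul_nonneg (hm y) m1.1)
        (mul_nonneg (hm y) m2.1) ((mul_le_of_le_one_right (hm y) m1.2).trans h2)
        ((mul_le_of_le_one_right (hm y) m2.2).trans h2) (by linarith)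
        ((φ y).eval_mem_cylinder hc' (key i s hs)) ((φ y).eval_mem_cylinder hc' (key j s' hs'))
        (by linarith)
  mem_interior hβ y u c h hm0 i s hs h0 h1 := by
    obtain ⟨c', hc', hz⟩ := exists_zones fun k => stretch (u k)
    have hs' := (A.domain_eq c i).subset hs
    have hv := stretch_eq_corner_of_face h i
    have hb := Gaps.base_mem hv hs'
    have hτ : τ y < 1 := (hpos y).resolve_left (by simp [show m y = 0 from hm0])
    have h2 := hτ₀ y
    refine (((φ y).isLinkMap_eval hc').support hβ i).1 ⟨_, A.domain_eq c' i ▸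
      Gaps.contract_mem_dom hv hs' (hτ₀ y) (hτ₁ y) (hz i).1 (hz i).2⟩ ?_ ?_ <;>
      simp only <;> nlinarith
  hasDeriv hβ y u c h i s hs := by
    obtain ⟨c', hc', hz⟩ := exists_zones fun k => stretch (u k)
    obtain ⟨e, he, hd⟩ := (φ y).hasDerivWithinAt_eval hβ hc' i hs
    obtain ⟨h1, h2⟩ := (A.gaps i).hasDerivAt_contract (τ y) (stretch (u i)) hs
    have hmaps : Set.MapsTo ((A.gaps i).contract (τ y) (stretch (u i))) (A.domain c i)
        (A.domain c' i) := fun s hs =>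
      A.domain_eq c' i ▸ Gaps.contract_mem_dom (stretch_eq_corner_of_face h i)
        ((A.domain_eq c i).subset hs) (hτ₀ y) (hτ₁ y) (hz i).1 (hz i).2
    -- Near the ends the contraction is affine with slope `1 - τ`, so it only rescales the vertical
    -- velocity.
    have h3 := HasDerivWithinAt.scomp_of_eq s hd h1.hasDerivWithinAt hmaps h2.symm
    refine ⟨(1 - τ y) * e, h3.congr_deriv (by simp), (hpos y).imp_right fun h4 => ?_⟩
    exact mul_ne_zero (by linarith) he

/-- The locally constant strands of `toBased φ` are the completely contracted strands of `φ`; this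
joins the contraction to the family defining `fromBased`. -/
lemma strand_toBased (φ : TaylorStage β a A) {u : Fin n → I} {c : Idx n} (h : carrier u ≤ c)
    {i : Fin n} {s : ℝ} (hs : s ∈ A.domain c i) :
    (toBased φ).strand A u i s = φ.eval (fun k => stretch (stretch (u k))) i
      ((A.gaps i).base (stretch (u i)) s) := by
  have hv := stretch_eq_corner_of_face h i
  rcases Gaps.dom_trichotomy hv hv ((A.domain_eq c i).subset hs) with h1 | h1 | h1
  · rw [BasedMapSpace.strand_of_slot_eq_zero _ h1.2.2.2.1, h1.2.2.1, φ.eval_zero]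
  · rw [BasedMapSpace.strand_of_slot_eq_one _ h1.2.2.2.1, h1.2.2.1, φ.eval_one]
  · rw [BasedMapSpace.strand_of_slot_eq _ h1.2.2.2.1, h1.2.2.1]
    rfl

lemma homotopic_of_map {X Z : Type*} [TopologicalSpace X] [TopologicalSpace Z]
    (H : C(I × X, Z)) {f g : C(X, Z)} (h0 : ∀ x, H (0, x) = f x) (h1 : ∀ x, H (1, x) = g x) :
    f.Homotopic g :=
  ⟨{ toFun := H, continuous_toFun := H.continuous, map_zero_left := h0, map_one_left := h1 }⟩

/-- The homotopy that contracts the components halfway. -/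
def halfContractFamily (β : BoundaryBehavior) (a : Fin n → EuclideanSpace ℝ (Fin 2))
    (A : Punctures (fun _ : Fin n => 1)) : PushFamily β a A (I × TaylorStage β a A) :=
  contractFamily .snd ⟨fun y => (y.1 : ℝ) / 2, by fun_prop⟩ (.const _ 0)
    (fun y => div_nonneg y.1.2.1 zero_le_two)
    (fun y => by simp only [ContinuousMap.coe_mk]; linarith [y.1.2.2])
    (fun _ => le_rfl)
    (fun y => .inr (by simp only [ContinuousMap.coe_mk]; linarith [y.1.2.2]))
    (fun _ => .inl rfl)

/-- The homotopy that contracts the half contracted components to points while pushing the strands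
into the interior. -/
def fullContractFamily (β : BoundaryBehavior) (a : Fin n → EuclideanSpace ℝ (Fin 2))
    (A : Punctures (fun _ : Fin n => 1)) : PushFamily β a A (I × TaylorStage β a A) :=
  contractFamily .snd ⟨fun y => (1 + y.1 : ℝ) / 2, by fun_prop⟩
    ⟨fun y => y.1 * margin y.2, by have := continuous_margin (β := β) (a := a) (A := A); fun_prop⟩
    (fun y => by simp only [ContinuousMap.coe_mk]; linarith [y.1.2.1])
    (fun y => by simp only [ContinuousMap.coe_mk]; linarith [y.1.2.2])
    (fun y => mul_nonneg y.1.2.1 (margin_pos y.2).le)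
    (fun y => by
      rcases y.1.2.1.eq_or_lt with h | h
      · right
        simp only [ContinuousMap.coe_mk, ← h]
        norm_num
      · exact .inl (mul_pos h (margin_pos y.2)))
    (fun y => .inr ⟨by simp only [ContinuousMap.coe_mk]; linarith [y.1.2.1],
      mul_le_of_le_one_left (margin_pos y.2).le y.1.2.2⟩)

/-- The homotopy that makes the push uniform. -/
def rescaleFamily (β : BoundaryBehavior) (A : Punctures (fun _ : Fin n => 1))
    (ha : ∀ i j, i ≠ j → a i ≠ a j) : PushFamily β a A (I × TaylorStage β a A) :=
  basedFamily β A ha (toBased.comp .snd)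
    ⟨fun y => (1 - y.1) * margin y.2 + y.1 * (1 / 2), by
      have := continuous_margin (β := β) (a := a) (A := A)
      fun_prop⟩
    (fun y => by
      have h1 := margin_pos y.2
      have h2 := y.1.2.1
      have h3 := margin_le y.2
      simp only [ContinuousMap.coe_mk]
      nlinarith [mul_le_mul_of_nonneg_left h3 h2])
    (fun y => by
      have h1 := margin_le y.2
      have h2 := y.1.2.1
      have h3 := y.1.2.2
      simp only [ContinuousMap.coe_mk]
      nlinarith)

/-- Four homotopies are concatenated, starting at the identity: stretch the cube, contract halfway
with no push, complete the contraction while the push grows to `margin`, and let the size of the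
push go from `margin` to `1 / 2`. In the last one only the values of `toBased φ` matter, so any
scale strictly between `0` and `1` is admissible. -/
lemma fromBased_comp_toBased_homotopic (ha : ∀ i j, i ≠ j → a i ≠ a j) :
    ((fromBased β A ha).comp toBased).Homotopic (ContinuousMap.id (TaylorStage β a A)) := by
  have at_zero : ∀ H : C(I × TaylorStage β a A, TaylorStage β a A),
      (H.comp ((ContinuousMap.const _ 0).prodMk (.id _))).Homotopic
        (H.comp ((ContinuousMap.const _ 1).prodMk (.id _))) := fun H =>
    homotopic_of_map H (fun _ => rfl) fun _ => rfl
  refine ContinuousMap.Homotopic.symm ?_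
  refine (homotopic_of_map (g := (halfContractFamily β a A).map.comp
    ((ContinuousMap.const _ 0).prodMk (.id _))) (stretchFamily β a A).map (fun φ => ?_)
    fun φ => ?_).trans ((at_zero _).trans ?_)
  · refine TaylorStage.ext fun c w i s => ?_
    rw [PushFamily.map_link]
    change push (0 * _) (φ.eval (fun k => lerp 0 (coord w k) _) i s) = _
    simp only [zero_mul, push_zero, lerp_zero]
    exact φ.eval_coord c w i s
  · refine TaylorStage.ext fun c w i s => ?_
    change push (0 * _) (φ.eval (fun k => lerp 1 (coord w k) _) i s) =
      push (0 * _) (φ.eval _ i (Gaps.contract _ (((0 : I) : ℝ) / 2) _ s))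
    simp
  -- Both sides are contracted by `1 / 2` and not pushed.
  have e1 : (halfContractFamily β a A).map.comp ((ContinuousMap.const _ 1).prodMk (.id _)) =
      (fullContractFamily β a A).map.comp ((ContinuousMap.const _ 0).prodMk (.id _)) := by
    refine ContinuousMap.ext fun φ => TaylorStage.ext fun c w i s => ?_
    change push (0 * _) (φ.eval _ i (Gaps.contract _ (((1 : I) : ℝ) / 2) _ s)) =
      push (((0 : I) : ℝ) * _ * _) (φ.eval _ i (Gaps.contract _ ((1 + ((0 : I) : ℝ)) / 2) _ s))
    simp
  rw [e1]
  refine (at_zero _).trans ?_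
  -- Both sides are contracted completely and pushed with scale `margin φ`.
  have e2 : (fullContractFamily β a A).map.comp ((ContinuousMap.const _ 1).prodMk (.id _)) =
      (rescaleFamily β A ha).map.comp ((ContinuousMap.const _ 0).prodMk (.id _)) := by
    refine ContinuousMap.ext fun φ => TaylorStage.ext fun c w i s => ?_
    change push (((1 : I) : ℝ) * margin φ * _)
        (φ.eval _ i (Gaps.contract _ ((1 + ((1 : I) : ℝ)) / 2) _ s)) =
      push (((1 - ((0 : I) : ℝ)) * margin φ + ((0 : I) : ℝ) * (1 / 2)) * _)
        ((toBased φ).strand A (coord w) i s)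
    rw [strand_toBased φ (carrier_coord_le w.2) s.2]
    simp
  rw [e2]
  refine homotopic_of_map (rescaleFamily β A ha).map (fun _ => rfl) fun φ => ?_
  refine TaylorStage.ext fun c w i s => ?_
  change push (((1 - ((1 : I) : ℝ)) * margin φ + ((1 : I) : ℝ) * (1 / 2)) * _)
      ((toBased φ).strand A (coord w) i s) =
    push (1 / 2 * _) ((toBased φ).strand A (coord w) i s)
  simp

/-- Based maps from the cube to the configuration space form the first stage of the Taylor tower,
up to homotopy. -/
def taylorEquiv (β : BoundaryBehavior) (A : Punctures (fun _ : Fin n => 1))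
    (ha : ∀ i j, i ≠ j → a i ≠ a j) :
    ContinuousMap.HomotopyEquiv (BasedMapSpace a) (TaylorStage β a A) where
  toFun := fromBased β A ha
  invFun := toBased
  left_inv := toBased_comp_fromBased_homotopic ha
  right_inv := fromBased_comp_toBased_homotopic ha

end StringLink

end

theorem mainTheorem3 (n : ℕ) (a : Fin n → EuclideanSpace ℝ (Fin 2))
    (ha_mem : ∀ i, a i ∈ Metric.closedBall (0 : EuclideanSpace ℝ (Fin 2)) 1)
    (ha_distinct : ∀ i j, i ≠ j → a i ≠ a j)
    (A : StringLink.Punctures (fun _ : Fin n => 1)) (β : StringLink.BoundaryBehavior) :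
    Nonempty (ContinuousMap.HomotopyEquiv (StringLink.MapSpace a)
      (StringLink.TaylorStage β a A)) := by
  exact ⟨(StringLink.mapSpaceEquiv a).trans (StringLink.taylorEquiv β A ha_distinct)⟩
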